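/- Let $S^1=\mathbb R/2\pi\mathbb Z$ and let the plane $\mathbb R^2$ have its counterclockwise orientation. An *I-doodle* is a $C^\infty$-immersion $\phi:S^1\to\mathbb R^2$ such that $\phi(x)=\phi(y)=\phi(z)$ for no three different points $x,y,z\in S^1$. Two I-doodles are *equivalent* if they are joined by a path of I-doodles that is continuous in the $C^\infty$-topology. An I-doodle is *regular* if all its double points are transverse. Let $\phi$ be a regular I-doodle, $c=\phi(S^1)$, and for $t\notin c$ let $\mathrm{ind}_c(t)$ be the counterclockwise rotation number of the vector from $t$ to $\phi(s)$ when $s$ runs once along $S^1$. The index $i(x)$ of a double point $x$ is the arithmetic mean of the four values of $\mathrm{ind}_c$ in the four sectors of $\mathbb R^2\setminus c$ at $x$. Choose a base point $*\in c$ that is not a double point; $i(*)$ is the greater of the two values of $\mathrm{ind}_c$ on the two sides of $c$ at $*$. If $v_1,v_2$ are the velocities of $c$ at the first and at the second visit of $x$ after leaving $*$, then $\sigma(x)=+1$ if the frame $(v_2,v_1)$ is positively oriented, and $\sigma(x)=-1$ if it is negatively oriented. For $\beta\in\mathbb N$ put $$M(\beta)=\sum_{x}\sigma(x)\binom{i(x)}{\beta}+2\binom{i(*)}{\beta+1},\qquad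 \binom{i}{\beta}=\frac{i(i-1)\cdots(i-\beta+1)}{\beta!},$$ where $x$ runs over all double points of $c$. **Proposition.** (a) For every $\beta\ge 1$ the number $M(\beta)$ is an invariant of I-doodles and does not depend on the choice of $*$: there is a function on the set of all I-doodles that takes equal values on equivalent I-doodles and whose value at every regular I-doodle is $M(\beta)$, computed with any base point. (b) $M(1)$ is Arnold's strangeness $St$, i.e. it is an integer-valued function $St$ on regular I-doodles with the following properties. 1. It takes equal values on equivalent regular I-doodles. 2. It is the linking number with the cooriented set of immersions with triple points: let $(\gamma_t)_{0\le t\le 1}$ be a smooth path of immersions $S^1\to\mathbb R^2$ with regular I-doodles $\gamma_0,\gamma_1$ as its ends, which has triple points only at finitely many times in $(0,1)$, each time exactly one, of multiplicity exactly three, with pairwise transverse branches, and such that the path crosses the set of immersions with triple points transversally there. Then $St(\gamma_1)-St(\gamma_0)$ is the sum of the signs of these crossings. The sign of a crossing is $(-1)^q$: the small triangle born at the crossing has its three sides cyclically ordered by the order in which the curve visits them, which orients its boundary, and $q$ is the number of sides on which the direction of the curve agrees with this orientation. 3. It is normalized by $St=0$ on the figure eight $s\mapsto(\sin s,\sin 2s)$,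 and $St=n-1$ for $n\ge1$ on the standard curve $s\mapsto (n-1)e^{is}+e^{ins}\in\mathbb C=\mathbb R^2$ (a closed curve with $n-1$ small inner loops), as well as on the same curve with the reversed direction. -/

import Mathlib

/-!  Immersed closed plane curves without triple points (I-doodles), their moments, and the
strangeness of plane curves.  The plane is `ℂ` with its counterclockwise orientation, and the circle
is `ℝ / 2πℤ`: maps on it are `2π`-periodic maps on `ℝ`, and two reals are the same point of it iff
they are equal in `Real.Angle`. -/

namespace PlaneCurve

open scoped ContDiff Topology Real

noncomputable section

/-- The determinant of the frame `(u, v)`: positive iff the frame is positively oriented. -/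
def cross (u v : ℂ) : ℝ := u.re * v.im - u.im * v.re

/-- A `C^∞` immersion of the circle into the plane. -/
structure ImmersedCurve where
  toFun : ℝ → ℂ
  smooth : ContDiff ℝ ∞ toFun
  periodic : Function.Periodic toFun (2 * π)
  immersion : ∀ s, deriv toFun s ≠ 0

instance : CoeFun ImmersedCurve (fun _ => ℝ → ℂ) := ⟨ImmersedCurve.toFun⟩

/-- Three different points of the circle have the same image. -/
def ImmersedCurve.IsTriple (φ : ImmersedCurve) (x y z : ℝ) : Prop :=
  (x : Real.Angle) ≠ y ∧ (y : Real.Angle) ≠ z ∧ (x : Real.Angle) ≠ z ∧ φ x = φ y ∧ φ y = φ z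

/-- An I-doodle: an immersed curve without triple points (self-tangencies are allowed). -/
structure IDoodle extends ImmersedCurve where
  no_triple : ∀ x y z, ¬ toImmersedCurve.IsTriple x y z

instance : CoeFun IDoodle (fun _ => ℝ → ℂ) := ⟨fun φ => φ.toFun⟩

/-- Two I-doodles are equivalent if they are joined by a path of I-doodles which is continuous for
the `C^∞` topology: all derivatives along the curve depend continuously on (time, point). -/
def IDoodle.Equivalent (φ ψ : IDoodle) : Prop :=
  ∃ h : unitInterval → IDoodle, h 0 = φ ∧ h 1 = ψ ∧
    ∀ k : ℕ, Continuous fun p : unitInterval × ℝ => iteratedDeriv k (h p.1) p.2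

/-- A regular I-doodle: all its double points are transverse. -/
structure RegularIDoodle extends IDoodle where
  transverse : ∀ x y : ℝ, (x : Real.Angle) ≠ y → toFun x = toFun y →
    cross (deriv toFun x) (deriv toFun y) ≠ 0

instance : CoeFun RegularIDoodle (fun _ => ℝ → ℂ) := ⟨fun φ => φ.toFun⟩

/-! ### Indices and moments -/

/-- `ind_c(t)`, the (counterclockwise) rotation number of the vector from `t` to `φ s` when `s` runs
once along the circle (for `t` off the curve). -/
def ImmersedCurve.ind (φ : ImmersedCurve) (t : ℂ) : ℝ :=
  (2 * π)⁻¹ * ∫ s in (0 : ℝ)..(2 * π), (deriv φ s / (φ s - t)).im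

/-- The value of `ind` in the component of the complement that one enters when leaving the point `p`
of the curve in the direction `w` (transverse to the curve at `p`). -/
def ImmersedCurve.indNear (φ : ImmersedCurve) (p w : ℂ) : ℝ :=
  Filter.limUnder (𝓝[>] (0 : ℝ)) fun ε : ℝ => φ.ind (p + (ε : ℂ) * w)

/-- The index `i(x)` of the transverse double point `x = φ a = φ b`: the arithmetic mean of the
values of `ind` in the four sectors at `x`. -/
def ImmersedCurve.doubleIndex (φ : ImmersedCurve) (a b : ℝ) : ℝ :=
  (φ.indNear (φ a) (deriv φ a + deriv φ b) + φ.indNear (φ a) (deriv φ a - deriv φ b) +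
    φ.indNear (φ a) (-deriv φ a + deriv φ b) + φ.indNear (φ a) (-deriv φ a - deriv φ b)) / 4

/-- The sign `σ(x)` of the double point `x = φ a = φ b` that the curve visits first at `a`, then at
`b`: `+1` if the frame (first velocity, second velocity) is negatively oriented (equivalently, the
frame (second, first) is positively oriented), and `-1` otherwise. -/
def ImmersedCurve.doubleSign (φ : ImmersedCurve) (a b : ℝ) : ℝ :=
  (SignType.sign (cross (deriv φ b) (deriv φ a)) : ℝ)

/-- `φ s` is a regular (not double) point of the curve, so it may serve as the base point. -/
def ImmersedCurve.IsBasePoint (φ : ImmersedCurve) (s : ℝ) : Prop :=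
  ∀ x : ℝ, φ x = φ s → (x : Real.Angle) = s

/-- The index `i(*)` of the base point `* = φ s`: the greatest of the values of `ind` on the two
sides of the curve. -/
def ImmersedCurve.baseIndex (φ : ImmersedCurve) (s : ℝ) : ℝ :=
  max (φ.indNear (φ s) (Complex.I * deriv φ s)) (φ.indNear (φ s) (-(Complex.I * deriv φ s)))

/-- The double points, each one represented by its pair of parameters, in the order of the visits
after leaving the base point `φ s`. -/
def ImmersedCurve.doublePairs (φ : ImmersedCurve) (s : ℝ) : Set (ℝ × ℝ) :=
  {p | s < p.1 ∧ p.1 < p.2 ∧ p.2 < s + 2 * π ∧ φ p.1 = φ p.2}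

/-- `x (x - 1) ⋯ (x - β + 1) / β!`. -/
def binom (x : ℝ) (β : ℕ) : ℝ := (∏ j ∈ Finset.range β, (x - (j : ℝ))) / (β.factorial : ℝ)

/-- The `β`-th moment of a regular I-doodle, computed with the base point `φ s`. -/
def RegularIDoodle.moment (φ : RegularIDoodle) (β : ℕ) (s : ℝ) : ℝ :=
  (∑ᶠ (p : ℝ × ℝ) (_ : p ∈ φ.doublePairs s),
      φ.doubleSign p.1 p.2 * binom (φ.doubleIndex p.1 p.2) β) +
    2 * binom (φ.baseIndex s) (β + 1)

/-! ### Strangeness: the linking number with the set of immersed curves with triple points -/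

/-- Three strands with velocities `u₁, u₂, u₃` (pairwise independent, in the cyclic order of visits)
that meet at one point and move with the velocities `w₁, w₂, w₃`.  The three lines
`w_j + ℝ u_j` bound the triangle that is born at the crossing, up to first order and scaling; the
strands remain concurrent to first order iff the defect vanishes, and its sign is the sign of the
newborn triangle (see `crossingDefect_pow_three`). -/
def crossingDefect (u₁ u₂ u₃ w₁ w₂ w₃ : ℂ) : ℝ :=
  cross u₂ u₃ * cross u₁ w₁ + cross u₃ u₁ * cross u₂ w₂ + cross u₁ u₂ * cross u₃ w₃

/-- Let `P₁₂, P₂₃, P₃₁` be the vertices of the newborn triangle, and go round it along the sides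
1, 2, 3 in this order: side `j` is `m_j u_j`.  If `q` is the number of sides along which the strand
runs in the same direction (`m_j > 0`), then `-m₁ m₂ m₃`, and hence the defect, has the sign
`(-1)^q`: this is the sign of a vanishing triangle. -/
theorem crossingDefect_pow_three (u₁ u₂ u₃ w₁ w₂ w₃ P₁₂ P₂₃ P₃₁ : ℂ) (m₁ m₂ m₃ : ℝ)
    (h11 : cross u₁ P₁₂ = cross u₁ w₁) (h21 : cross u₂ P₁₂ = cross u₂ w₂)
    (h22 : cross u₂ P₂₃ = cross u₂ w₂) (h32 : cross u₃ P₂₃ = cross u₃ w₃)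
    (h33 : cross u₃ P₃₁ = cross u₃ w₃) (h13 : cross u₁ P₃₁ = cross u₁ w₁)
    (hm₁ : P₁₂ - P₃₁ = (m₁ : ℂ) * u₁) (hm₂ : P₂₃ - P₁₂ = (m₂ : ℂ) * u₂)
    (hm₃ : P₃₁ - P₂₃ = (m₃ : ℂ) * u₃) :
    crossingDefect u₁ u₂ u₃ w₁ w₂ w₃ ^ 3 =
      -(m₁ * m₂ * m₃) * (cross u₁ u₂ * cross u₂ u₃ * cross u₃ u₁) ^ 2 := by
  have key : ∀ (a b c P Q : ℂ) (m : ℝ), P - Q = (m : ℂ) * a →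
      cross b c * cross a P + cross c a * cross b P + cross a b * cross c Q =
        -m * (cross a b * cross c a) := by
    intro a b c P Q m h
    have hQ : Q = P - (m : ℂ) * a := by rw [← h]; ring
    subst hQ
    simp only [cross, Complex.sub_re, Complex.sub_im, Complex.mul_re, Complex.mul_im,
      Complex.ofReal_re, Complex.ofReal_im]
    ring
  have e1 := key u₁ u₂ u₃ P₁₂ P₃₁ m₁ hm₁
  have e2 := key u₂ u₃ u₁ P₂₃ P₁₂ m₂ hm₂
  have e3 := key u₃ u₁ u₂ P₃₁ P₂₃ m₃ hm₃
  rw [h11, h21, h33] at e1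
  rw [h22, h32, h11] at e2
  rw [h33, h13, h22] at e3
  have d1 : crossingDefect u₁ u₂ u₃ w₁ w₂ w₃ = -m₁ * (cross u₁ u₂ * cross u₃ u₁) := by
    rw [← e1, crossingDefect]
  have d2 : crossingDefect u₁ u₂ u₃ w₁ w₂ w₃ = -m₂ * (cross u₂ u₃ * cross u₁ u₂) := by
    rw [← e2, crossingDefect]; ring
  have d3 : crossingDefect u₁ u₂ u₃ w₁ w₂ w₃ = -m₃ * (cross u₃ u₁ * cross u₂ u₃) := by
    rw [← e3, crossingDefect]; ring
  calc crossingDefect u₁ u₂ u₃ w₁ w₂ w₃ ^ 3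
      = crossingDefect u₁ u₂ u₃ w₁ w₂ w₃ * crossingDefect u₁ u₂ u₃ w₁ w₂ w₃ *
          crossingDefect u₁ u₂ u₃ w₁ w₂ w₃ := by ring
    _ = (-m₁ * (cross u₁ u₂ * cross u₃ u₁)) * (-m₂ * (cross u₂ u₃ * cross u₁ u₂)) *
          (-m₃ * (cross u₃ u₁ * cross u₂ u₃)) := by
        nth_rewrite 1 [d1]; nth_rewrite 1 [d2]; rw [d3]
    _ = _ := by ring

/-- The curve has exactly one triple point, which is not of higher multiplicity and whose three
branches, at the parameters `x₁ < x₂ < x₃ < x₁ + 2π`, are pairwise transverse. -/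
def ImmersedCurve.IsOrdinaryTriple (φ : ImmersedCurve) (x₁ x₂ x₃ : ℝ) : Prop :=
  x₁ < x₂ ∧ x₂ < x₃ ∧ x₃ < x₁ + 2 * π ∧ φ x₁ = φ x₂ ∧ φ x₂ = φ x₃ ∧
    cross (deriv φ x₁) (deriv φ x₂) ≠ 0 ∧ cross (deriv φ x₂) (deriv φ x₃) ≠ 0 ∧
    cross (deriv φ x₃) (deriv φ x₁) ≠ 0 ∧
    ∀ x y z, φ.IsTriple x y z →
      (x : Real.Angle) = x₁ ∨ (x : Real.Angle) = x₂ ∨ (x : Real.Angle) = x₃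

/-- `crossingDefect` for the branches with the parameters `x₁, x₂, x₃` of a moving curve `γ` at the
time `t`. -/
def defectAt (γ : ℝ → ImmersedCurve) (t x₁ x₂ x₃ : ℝ) : ℝ :=
  crossingDefect (deriv (γ t) x₁) (deriv (γ t) x₂) (deriv (γ t) x₃)
    (deriv (fun τ => γ τ x₁) t) (deriv (fun τ => γ τ x₂) t) (deriv (fun τ => γ τ x₃) t)

/-- A smooth path in the space of immersed curves that, for the times in `[0, 1]`, meets the set of
curves with triple points only at finitely many times in `(0, 1)`, each time at a curve with one
ordinary triple point and transversally.  The branches at the triple point at the time `t` have the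
parameters `x₁ t, x₂ t, x₃ t`. -/
structure GenericPath where
  curve : ℝ → ImmersedCurve
  smooth : ContDiff ℝ ∞ fun p : ℝ × ℝ => curve p.1 p.2
  times : Finset ℝ
  times_mem : ∀ t ∈ times, 0 < t ∧ t < 1
  off_times : ∀ t, 0 ≤ t → t ≤ 1 → t ∉ times → ∀ x y z, ¬ (curve t).IsTriple x y z
  x₁ : ℝ → ℝ
  x₂ : ℝ → ℝ
  x₃ : ℝ → ℝ
  ordinary : ∀ t ∈ times, (curve t).IsOrdinaryTriple (x₁ t) (x₂ t) (x₃ t)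
  transversal : ∀ t ∈ times, defectAt curve t (x₁ t) (x₂ t) (x₃ t) ≠ 0

/-- The intersection number of the path with the cooriented set of curves with triple points: the
number of its positive minus the number of its negative triple point crossings, where a crossing is
positive if the newborn triangle is. -/
def GenericPath.intersectionNumber (γ : GenericPath) : ℤ :=
  ∑ t ∈ γ.times, (SignType.sign (defectAt γ.curve t (γ.x₁ t) (γ.x₂ t) (γ.x₃ t)) : ℤ)

/-- The figure eight, the standard curve with rotation number `0`. -/
def figureEight (s : ℝ) : ℂ := (Real.sin s : ℂ) + (Real.sin (2 * s) : ℂ) * Complex.I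

/-- The standard curve with rotation number `n ≥ 1`: a closed curve with `n - 1` small
loops inside (the circle for `n = 1`, the limaçon for `n = 2`). -/
def standardCurve (n : ℕ) (s : ℝ) : ℂ :=
  ((n : ℂ) - 1) * Complex.exp (Complex.I * s) + Complex.exp (Complex.I * (n * s))

/-- Arnold's strangeness as a function on regular immersed curves without triple points: the linking
number with the cooriented set of immersed curves with triple points, normalized on the standard
curves (with either direction). -/
structure IsStrangeness (St : RegularIDoodle → ℤ) : Prop where
  /-- It is constant on classes of I-doodles; in particular, self-tangencies do not change it. -/
  invariant : ∀ φ ψ : RegularIDoodle, φ.toIDoodle.Equivalent ψ.toIDoodle → St φ = St ψ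
  /-- Along a generic path it changes by the intersection number with the set of curves with triple
  points. -/
  linking : ∀ (γ : GenericPath) (φ ψ : RegularIDoodle), γ.curve 0 = φ.toImmersedCurve →
    γ.curve 1 = ψ.toImmersedCurve → St ψ - St φ = γ.intersectionNumber
  eight : ∀ φ : RegularIDoodle, (∀ s, φ s = figureEight s) → St φ = 0
  standard : ∀ (n : ℕ) (φ : RegularIDoodle), 1 ≤ n → (∀ s, φ s = standardCurve n s) →
    St φ = (n : ℤ) - 1
  standard_reversed : ∀ (n : ℕ) (φ : RegularIDoodle), 1 ≤ n →
    (∀ s, φ s = standardCurve n (-s)) → St φ = (n : ℤ) - 1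

end

end PlaneCurve

/-!
# Moments of I-doodles and Arnold's strangeness

For a point `q` on the curve, the integral `φ.ind q` converges: only the real part of the
logarithmic derivative is singular at a simple zero.  This principal value is the mean of the values
of the index nearby (`C1Tendsto.tendsto_ind`), so `i(x) = φ.ind x` at a transverse double point
(`ImmersedCurve.doubleIndex_eq`), and `i(*) = φ.ind * + 1/2` at a base point
(`ImmersedCurve.baseIndex_eq`).  A point on two strands has an integral principal value.  As it
depends continuously on the curve while only two strands are involved, the index of a double point
is constant as long as the double point does not become triple (`C1Tendsto.eventually_ind_eq`).

The double points of an I-doodle may be arbitrarily degenerate, so paths of I-doodles are not put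
into general position.  Instead, the sum over the double points is written in a form that makes
sense for every I-doodle.  Let `θ (a, u)` be the direction of the chord from `φ u` to `φ a`, and let
`g` be a smooth function of `(a, u)` that is locally constant near the double points.  Then the
integral of `-dg ∧ dθ / 2π` over the triangle `0 < a < u < 2π`, with a boundary term, counts the
double points `φ a = φ u` with their signs and the weight `g`, as `θ` winds once around each
transverse double point (`ImmersedCurve.weightedCount`, `ImmersedCurve.exists_bump`,
`ImmersedCurve.IsAdapted.weightedCount_eq_sum`).  This integral does not change if the chords turn
by less than a right angle where `g` varies: by Green's formula the difference is a boundary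
integral (`ImmersedCurve.weightedCount_add_ind_eq`).  The weights of interest take the value
`binom (i(x)) β` near each double point `x`.  Such a weight exists because the index is locally
constant on the compact set of double points, and it is adapted to all nearby I-doodles too.

The boundary term takes care of a base point that passes through a double point `x`.  Then one
double point changes its sign, while `ind *` moves by `1/2` at a time, and the identity
`binom (i + 1) (β + 1) - binom i (β + 1) = binom i β` makes the two contributions cancel
(`C1Tendsto.eventually_baseTerm`).  Hence the moment is locally constant on I-doodles
(`C1Tendsto.eventually_doodleMoment`), which proves the invariance.  As it is also constant when the
parameter is shifted, it does not depend on the base point.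

When the curve passes an ordinary triple point, each of the three double points nearby is a point on
two strands that changes from one side of the third strand to the other, so its index jumps by `1`
up to sign.  The side is told by the sign of the defect
(`hasSides_of_defect_ne_zero`, `eventually_ind_of_triple`).  For `β = 1`, correcting an adapted
weight by bump functions at the three double points shows that the moment jumps by the sum of these
jumps multiplied by the signs of the double points, and this is the sign of the crossing
(`exists_eventually_doodleMoment_eq_of_triple`).  Summing the jumps gives the linking number
(`GenericPath.doodleMoment_sub`).

The values on the standard curves are computed directly.  A base point that is seen from infinity
contributes `0` to the first moment.  The double point of the figure eight has index `0` by symmetry,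
and each of the `n - 1` double points of the `n`-th standard curve is the farthest point of the curve
in its direction from the origin, so its index is `1` or `-1` and is equal to its sign.
-/

namespace PlaneCurve

open scoped ContDiff Topology Real
open Filter Set MeasureTheory

noncomputable section

/-! ### The angular speed of a smooth arc, and the angle that it sweeps -/

/-- At a simple zero the imaginary part of the logarithmic derivative stays bounded: only the real
part `1 / (s - s₀)` blows up. -/
lemma eventually_abs_im_logDeriv_le {η : ℝ → ℂ} (hη : ContDiff ℝ 2 η) {s₀ : ℝ} (h0 : η s₀ = 0)
    (h1 : deriv η s₀ ≠ 0) : ∃ C : ℝ, ∀ᶠ s in 𝓝 s₀, |(deriv η s / η s).im| ≤ C := by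
  have hd : Differentiable ℝ η := hη.differentiable (by norm_num)
  have hη' : ContDiff ℝ 1 (deriv η) := by
    have : ContDiff ℝ (1 + 1) η := by simpa [one_add_one_eq_two] using hη
    exact (contDiff_succ_iff_deriv.1 this).2.2
  obtain ⟨K, t, ht, hK⟩ := hη'.contDiffAt.exists_lipschitzOnWith (x := s₀)
  obtain ⟨r, hr, hrt⟩ := Metric.mem_nhds_iff.1 ht
  set m := ‖deriv η s₀‖ / 2 with hm
  have hm0 : 0 < m := by positivity
  have hlow : ∀ᶠ s in 𝓝 s₀, m * |s - s₀| ≤ ‖η s‖ := by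
    have := (hd s₀).hasDerivAt.isLittleO.def hm0
    filter_upwards [this] with s hs
    have e1 : ‖(s - s₀) • deriv η s₀‖ = 2 * m * |s - s₀| := by
      rw [norm_smul, Real.norm_eq_abs, hm]; ring
    have e2 := norm_sub_norm_le ((s - s₀) • deriv η s₀) ((s - s₀) • deriv η s₀ - η s)
    rw [sub_sub_cancel, norm_sub_rev _ (η s)] at e2
    rw [h0, sub_zero, Real.norm_eq_abs] at hs
    linarith
  refine ⟨K / m, ?_⟩
  filter_upwards [hlow, Metric.ball_mem_nhds s₀ hr] with s hs hsr
  rcases eq_or_ne s s₀ with rfl | hne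
  · rw [h0]; simp; positivity
  have hpos : 0 < |s - s₀| := abs_pos.2 (sub_ne_zero.2 hne)
  have hηs : η s ≠ 0 := by
    intro h; rw [h, norm_zero] at hs; nlinarith [mul_pos hm0 hpos]
  have hest : ‖η s - (s - s₀) • deriv η s‖ ≤ K * |s - s₀| * |s - s₀| := by
    have := (convex_uIcc s₀ s).norm_image_sub_le_of_norm_hasDerivWithin_le
      (f := fun x => η x - x • deriv η s) (f' := fun x => deriv η x - deriv η s)
      (C := K * |s - s₀|) (x := s₀) (y := s) ?_ ?_ left_mem_uIcc right_mem_uIcc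
    · simp only [h0, Real.norm_eq_abs] at this
      rwa [show (η s - (s - s₀) • deriv η s) = η s - s • deriv η s - (0 - s₀ • deriv η s) by
        rw [sub_smul]; abel]
    · intro x _
      have := ((hd x).hasDerivAt.sub ((hasDerivAt_id x).smul_const (deriv η s)))
      rw [one_smul] at this
      exact this.hasDerivWithinAt
    · intro x hx
      have hxs : |x - s| ≤ |s - s₀| := by
        have := abs_sub_right_of_mem_uIcc hx
        rwa [abs_sub_comm] at this
      have hxr : x ∈ Metric.ball s₀ r := by
        rw [Metric.mem_ball, Real.dist_eq]
        exact (abs_sub_left_of_mem_uIcc hx).trans_lt (by simpa [Real.dist_eq] using hsr)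
      have := hK.norm_sub_le (hrt hxr) (hrt hsr)
      rw [Real.norm_eq_abs] at this
      exact this.trans (by gcongr)
  have hre : (deriv η s / η s).im = (((s - s₀) • deriv η s - η s) / η s).im / (s - s₀) := by
    have h2 : (s - s₀) ≠ 0 := sub_ne_zero.2 hne
    rw [sub_div, div_self hηs, Complex.sub_im, Complex.one_im, sub_zero, smul_div_assoc,
      Complex.smul_im, smul_eq_mul]
    field_simp
  rw [hre, abs_div, div_le_iff₀ hpos]
  refine (Complex.abs_im_le_norm _).trans ?_
  rw [norm_div, div_le_iff₀ (norm_pos_iff.2 hηs), norm_sub_rev]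
  calc ‖η s - (s - s₀) • deriv η s‖ ≤ K * |s - s₀| * |s - s₀| := hest
    _ = K / m * |s - s₀| * (m * |s - s₀|) := by field_simp
    _ ≤ _ := by gcongr

lemma intervalIntegrable_im_logDeriv {η : ℝ → ℂ} (hη : ContDiff ℝ 2 η) {a b : ℝ}
    (h1 : ∀ s ∈ uIcc a b, η s = 0 → deriv η s ≠ 0) :
    IntervalIntegrable (fun s => (deriv η s / η s).im) volume a b := by
  have hc : Continuous (deriv η) := hη.continuous_deriv (by norm_num)
  have hmeas : Measurable (fun s => (deriv η s / η s).im) :=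
    Complex.measurable_im.comp (hc.measurable.div hη.continuous.measurable)
  refine (LocallyIntegrableOn.integrableOn_isCompact (fun s hs => ?_)
    isCompact_uIcc).intervalIntegrable
  obtain ⟨C, hC⟩ : ∃ C : ℝ, ∀ᶠ x in 𝓝 s, |(deriv η x / η x).im| ≤ C := by
    by_cases h : η s = 0
    · exact eventually_abs_im_logDeriv_le hη h (h1 s hs h)
    · have hcont : ContinuousAt (fun x => |(deriv η x / η x).im|) s :=
        (Complex.continuous_im.continuousAt.comp
          (hc.continuousAt.div hη.continuous.continuousAt h)).abs
      exact ⟨|(deriv η s / η s).im| + 1, (hcont.eventually_lt_const (lt_add_one _)).mono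
        fun x hx => hx.le⟩
  refine ((volume.finiteAt_nhds s).filter_mono nhdsWithin_le_nhds).integrableAtFilter
    hmeas.aestronglyMeasurable.stronglyMeasurableAtFilter ?_
  exact ⟨C, by simpa [eventually_map] using hC.filter_mono nhdsWithin_le_nhds⟩

lemma hasDerivAt_arg_const_mul {η : ℝ → ℂ} {η' : ℂ} {s : ℝ} (h : HasDerivAt η η' s) {c : ℂ}
    (hs : c * η s ∈ Complex.slitPlane) :
    HasDerivAt (fun x => (c * η x).arg) (η' / η s).im s := by
  have hc : c * η s ≠ 0 := Complex.slitPlane_ne_zero hs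
  have h1 := ((h.const_mul c).clog_real hs)
  have h2 := Complex.imCLM.hasFDerivAt.comp_hasDerivAt s h1
  simp only [Complex.imCLM_apply, Function.comp_def, Complex.log_im] at h2
  rwa [mul_div_mul_left _ _ (left_ne_zero_of_mul hc)] at h2

lemma arg_I_mul_of_re_pos {z : ℂ} (h : 0 < z.re) : (Complex.I * z).arg = z.arg + π / 2 := by
  have hz : z ≠ 0 := by rintro rfl; simp at h
  have := abs_lt.1 (Complex.abs_arg_lt_pi_div_two_iff.2 (Or.inl h))
  rw [Complex.arg_mul Complex.I_ne_zero hz, Complex.arg_I, add_comm]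
  rw [Complex.arg_I]; constructor <;> linarith

lemma arg_neg_I_mul_of_re_pos {z : ℂ} (h : 0 < z.re) :
    (-Complex.I * z).arg = z.arg - π / 2 := by
  have hz : z ≠ 0 := by rintro rfl; simp at h
  have := abs_lt.1 (Complex.abs_arg_lt_pi_div_two_iff.2 (Or.inl h))
  rw [Complex.arg_mul (neg_ne_zero.2 Complex.I_ne_zero) hz, Complex.arg_neg_I]
  · ring
  rw [Complex.arg_neg_I]; constructor <;> linarith

/-- The angle swept, as seen from `0`, by an arc that crosses the imaginary axis once, from left to
right: it is determined by the end points up to the term `π σ`, where `σ` tells on which side of the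
arc the point `0` lies (`σ = 0` if `0` is on the arc).  The side is read off at any point `η x` of
the arc from which `0` is seen outside the cone that contains all chords. -/
lemma integral_im_logDeriv_strand {η : ℝ → ℂ} (hη : ContDiff ℝ 2 η) {a b x κ σ : ℝ}
    (hx : x ∈ Icc a b) (hre : ∀ s ∈ Icc a b, 0 < (deriv η s).re)
    (hκ : ∀ s ∈ Icc a b, |(deriv η s).im| ≤ κ * (deriv η s).re)
    (ha : (η a).re < 0) (hb : 0 < (η b).re)
    (hσ : (σ = 0 ∧ η x = 0) ∨ (σ = 1 ∧ κ * |(η x).re| < -(η x).im) ∨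
      (σ = -1 ∧ κ * |(η x).re| < (η x).im)) :
    ∫ s in a..b, (deriv η s / η s).im = (η b).arg - (-η a).arg + π * σ := by
  have hab : a ≤ b := hx.1.trans hx.2
  have hd : Differentiable ℝ η := hη.differentiable (by norm_num)
  have hdre : ∀ s, HasDerivAt (fun s => (η s).re) (deriv η s).re s := fun s =>
    Complex.reCLM.hasFDerivAt.comp_hasDerivAt s (hd s).hasDerivAt
  have hdim : ∀ s, HasDerivAt (fun s => (η s).im) (deriv η s).im s := fun s =>
    Complex.imCLM.hasFDerivAt.comp_hasDerivAt s (hd s).hasDerivAt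
  have hcre : Continuous fun s => (η s).re := Complex.continuous_re.comp hη.continuous
  have hcim : Continuous fun s => (η s).im := Complex.continuous_im.comp hη.continuous
  have hmono : StrictMonoOn (fun s => (η s).re) (Icc a b) := by
    refine strictMonoOn_of_deriv_pos (convex_Icc a b) hcre.continuousOn fun s hs => ?_
    rw [(hdre s).deriv]
    exact hre s (interior_subset hs)
  have cone : ∀ s ∈ Icc a b, ∀ y ∈ Icc a b,
      |(η s).im - (η y).im| ≤ κ * |(η s).re - (η y).re| := by
    have key : ∀ s ∈ Icc a b, ∀ y ∈ Icc a b, s ≤ y →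
        |(η s).im - (η y).im| ≤ κ * |(η s).re - (η y).re| := by
      intro s hs y hy hsy
      have m1 : MonotoneOn (fun s => κ * (η s).re - (η s).im) (Icc a b) := by
        refine monotoneOn_of_deriv_nonneg (convex_Icc a b)
          ((continuous_const.mul hcre).sub hcim).continuousOn ?_ fun s hs => ?_
        · exact fun s _ =>
            (((hdre s).const_mul κ).sub (hdim s)).differentiableAt.differentiableWithinAt
        · rw [HasDerivAt.deriv (f := fun s => κ * (η s).re - (η s).im)
            (((hdre s).const_mul κ).sub (hdim s))]
          linarith [(abs_le.1 (hκ s (interior_subset hs))).2]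
      have m2 : MonotoneOn (fun s => κ * (η s).re + (η s).im) (Icc a b) := by
        refine monotoneOn_of_deriv_nonneg (convex_Icc a b)
          ((continuous_const.mul hcre).add hcim).continuousOn ?_ fun s hs => ?_
        · exact fun s _ =>
            (((hdre s).const_mul κ).add (hdim s)).differentiableAt.differentiableWithinAt
        · rw [HasDerivAt.deriv (f := fun s => κ * (η s).re + (η s).im)
            (((hdre s).const_mul κ).add (hdim s))]
          linarith [(abs_le.1 (hκ s (interior_subset hs))).1]
      have i1 := m1 hs hy hsy
      have i2 := m2 hs hy hsy
      have i3 := hmono.monotoneOn hs hy hsy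
      simp only at i1 i2 i3
      rw [abs_sub_comm (η s).re, abs_of_nonneg (sub_nonneg.2 i3), abs_le]
      constructor <;> linarith
    intro s hs y hy
    rcases le_total s y with h | h
    · exact key s hs y hy h
    · rw [abs_sub_comm, abs_sub_comm (η s).re]; exact key y hy s hs h
  obtain ⟨z, hz, hz0⟩ : ∃ z ∈ Icc a b, (η z).re = 0 :=
    intermediate_value_Icc hab hcre.continuousOn ⟨ha.le, hb.le⟩
  have hint : IntervalIntegrable (fun s => (deriv η s / η s).im) volume a b := by
    refine intervalIntegrable_im_logDeriv hη fun s hs _ h => ?_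
    rw [uIcc_of_le hab] at hs
    have := hre s hs
    rw [h] at this
    simp at this
  -- if `0` is off the arc, a multiple `c η` stays in the slit plane, where `arg` is smooth
  have slit : ∀ c : ℂ, (∀ s ∈ Icc a b, c * η s ∈ Complex.slitPlane) →
      ∫ s in a..b, (deriv η s / η s).im = (c * η b).arg - (c * η a).arg := by
    intro c hc
    refine intervalIntegral.integral_eq_sub_of_hasDerivAt (f := fun s => (c * η s).arg)
      (fun s hs => ?_) hint
    rw [uIcc_of_le hab] at hs
    exact hasDerivAt_arg_const_mul (hd s).hasDerivAt (hc s hs)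
  have hx' := cone z hz x hx
  rw [hz0, zero_sub, abs_neg] at hx'
  have ha' : 0 < (-η a).re := by simpa using ha
  rcases hσ with ⟨rfl, h0⟩ | ⟨rfl, h0⟩ | ⟨rfl, h0⟩
  · have hpos : ∀ s ∈ Icc a b, 0 < (dslope η x s).re := by
      intro s hs
      rcases eq_or_ne s x with rfl | hne
      · rw [dslope_same]; exact hre s hs
      rw [dslope_of_ne _ hne, slope_def_module, h0, sub_zero, Complex.smul_re, smul_eq_mul]
      rcases lt_or_gt_of_ne hne with h | h
      · have := hmono hs hx h
        simp only [h0, Complex.zero_re] at this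
        exact mul_pos_of_neg_of_neg (inv_lt_zero.2 (sub_neg.2 h)) this
      · have := hmono hx hs h
        simp only [h0, Complex.zero_re] at this
        exact mul_pos (inv_pos.2 (sub_pos.2 h)) this
    have hgt : ∀ s, x < s → (dslope η x s).arg = (η s).arg := by
      intro s h
      rw [dslope_of_ne _ h.ne', slope_def_module, h0, sub_zero, Complex.real_smul,
        Complex.arg_real_mul _ (inv_pos.2 (sub_pos.2 h))]
    have hlt : ∀ s, s < x → (dslope η x s).arg = (-1 * η s).arg := by
      intro s h
      rw [dslope_of_ne _ h.ne, slope_def_module, h0, sub_zero, Complex.real_smul]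
      have : ((s - x)⁻¹ : ℝ) * η s = (((x - s)⁻¹ : ℝ) : ℂ) * (-1 * η s) := by
        rw [← neg_sub x s, inv_neg]; push_cast; ring
      rw [this, Complex.arg_real_mul _ (inv_pos.2 (sub_pos.2 h))]
    have hax : a < x := lt_of_le_of_ne hx.1 (by rintro rfl; simp [h0] at ha)
    have hxb : x < b := lt_of_le_of_ne hx.2 (by rintro rfl; simp [h0] at hb)
    rw [mul_zero, add_zero, ← hgt b hxb, ← neg_one_mul, ← hlt a hax]
    refine integral_eq_of_hasDerivAt_off_countable (fun s => (dslope η x s).arg) _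
      (countable_singleton x) ?_ ?_ hint
    · rw [uIcc_of_le hab]
      intro s hs
      have hcont : ContinuousAt (dslope η x) s := by
        rcases eq_or_ne s x with rfl | hne
        · exact continuousAt_dslope_same.2 (hd s)
        · exact (continuousAt_dslope_of_ne hne).2 hη.continuous.continuousAt
      exact (ContinuousAt.comp (f := dslope η x) (Complex.continuousAt_arg (Or.inl (hpos s hs)))
        hcont).continuousWithinAt
    · rw [min_eq_left hab, max_eq_right hab]
      rintro s ⟨hs, hsx⟩
      have hs' := Ioo_subset_Icc_self hs
      rcases lt_or_gt_of_ne hsx with h | h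
      · have hsl : -1 * η s ∈ Complex.slitPlane := by
          refine Or.inl ?_
          have := hmono hs' hx h
          simp only [h0, Complex.zero_re] at this
          simpa using this
        refine (hasDerivAt_arg_const_mul (hd s).hasDerivAt hsl).congr_of_eventuallyEq ?_
        filter_upwards [eventually_lt_nhds h] with y hy using hlt y hy
      · have hsl : 1 * η s ∈ Complex.slitPlane := by
          refine Or.inl ?_
          have := hmono hx hs' h
          simp only [h0, Complex.zero_re] at this
          simpa using this
        refine (hasDerivAt_arg_const_mul (hd s).hasDerivAt hsl).congr_of_eventuallyEq ?_
        filter_upwards [eventually_gt_nhds h] with y hy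
        rw [one_mul]; exact hgt y hy
  · have hneg : (η z).im < 0 := by have := abs_le.1 hx'; linarith
    rw [slit Complex.I, arg_I_mul_of_re_pos hb,
      show Complex.I * η a = -Complex.I * -η a by ring, arg_neg_I_mul_of_re_pos ha']
    · ring
    intro s hs
    rw [Complex.mem_slitPlane_iff]
    simp only [Complex.mul_re, Complex.I_re, zero_mul, Complex.I_im, one_mul, zero_sub,
      Complex.mul_im, zero_add]
    by_cases h : (η s).re = 0
    · have : s = z := hmono.injOn hs hz (by simp [h, hz0])
      subst this; left; simpa using hneg
    · exact Or.inr (by simpa using h)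
  · have hneg : 0 < (η z).im := by have := abs_le.1 hx'; linarith
    rw [slit (-Complex.I), arg_neg_I_mul_of_re_pos hb,
      show -Complex.I * η a = Complex.I * -η a by ring, arg_I_mul_of_re_pos ha']
    · ring
    intro s hs
    rw [Complex.mem_slitPlane_iff]
    by_cases h : (η s).re = 0
    · have : s = z := hmono.injOn hs hz (by simp [h, hz0])
      subst this; left; simpa using hneg
    · exact Or.inr (by simpa using h)

/-! ### Curves near a given one, and the jumps of the index -/

/-- The angular velocity of the point `φ s` as seen from `q`: the integrand of `2π ind`.  It is
bounded even if `q` is on the curve, so that `φ.ind q` is a principal value there. -/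
def ImmersedCurve.angularSpeed (φ : ImmersedCurve) (q : ℂ) (s : ℝ) : ℝ :=
  (deriv φ s / (φ s - q)).im

namespace ImmersedCurve

variable (φ : ImmersedCurve)

lemma ind_eq (q : ℂ) : φ.ind q = (2 * π)⁻¹ * ∫ s in (0 : ℝ)..(2 * π), φ.angularSpeed q s := rfl

lemma differentiable : Differentiable ℝ φ := φ.smooth.differentiable (by simp)

lemma hasDerivAt (s : ℝ) : HasDerivAt φ (deriv φ s) s := (φ.differentiable s).hasDerivAt

lemma continuous : Continuous φ := φ.smooth.continuous

lemma continuous_deriv : Continuous (deriv φ) := φ.smooth.continuous_deriv (by simp)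

lemma contDiff_deriv : ContDiff ℝ ∞ (deriv φ) :=
  (contDiff_infty_iff_deriv.1 φ.smooth).2

lemma periodic_deriv : Function.Periodic (deriv φ) (2 * π) := by
  intro s
  have : (fun x => φ (x + 2 * π)) = φ := funext φ.periodic
  rw [← deriv_comp_add_const, this]

lemma eq_of_angle_eq {x y : ℝ} (h : (x : Real.Angle) = y) : φ x = φ y := by
  obtain ⟨k, hk⟩ := Real.Angle.angle_eq_iff_two_pi_dvd_sub.1 h
  rw [show x = y + k * (2 * π) by linarith]
  exact (φ.periodic.int_mul k) y

lemma deriv_eq_of_angle_eq {x y : ℝ} (h : (x : Real.Angle) = y) : deriv φ x = deriv φ y := by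
  obtain ⟨k, hk⟩ := Real.Angle.angle_eq_iff_two_pi_dvd_sub.1 h
  rw [show x = y + k * (2 * π) by linarith]
  exact (φ.periodic_deriv.int_mul k) y

lemma angularSpeed_periodic (q : ℂ) : Function.Periodic (φ.angularSpeed q) (2 * π) := by
  intro s
  rw [angularSpeed, angularSpeed, φ.periodic, φ.periodic_deriv]

lemma intervalIntegrable_angularSpeed (q : ℂ) (a b : ℝ) :
    IntervalIntegrable (φ.angularSpeed q) volume a b := by
  have hd : ∀ s, deriv (fun s => φ s - q) s = deriv φ s := fun s => deriv_sub_const q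
  have := intervalIntegrable_im_logDeriv (η := fun s => φ s - q) (a := a) (b := b)
    ((φ.smooth.of_le (by norm_cast)).sub contDiff_const)
    (fun s _ _ => by rw [hd]; exact φ.immersion s)
  simp only [hd] at this
  exact this

lemma ind_eq_integral (q : ℂ) (x : ℝ) :
    φ.ind q = (2 * π)⁻¹ * ∫ s in x..(x + 2 * π), φ.angularSpeed q s := by
  rw [ind_eq, (φ.angularSpeed_periodic q).intervalIntegral_add_eq x 0, zero_add]

/-- Off the curve the index is an integer. -/
lemma exists_int_ind {q : ℂ} (hq : ∀ s, φ s ≠ q) : ∃ n : ℤ, φ.ind q = n := by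
  have hne : ∀ s, φ s - q ≠ 0 := fun s => sub_ne_zero.2 (hq s)
  have hcont : Continuous fun s => deriv φ s / (φ s - q) :=
    φ.continuous_deriv.div (φ.continuous.sub continuous_const) hne
  set G : ℝ → ℂ := fun x => ∫ s in (0 : ℝ)..x, deriv φ s / (φ s - q) with hG
  have hGd : ∀ x, HasDerivAt G (deriv φ x / (φ x - q)) x := fun x =>
    hcont.integral_hasStrictDerivAt 0 x |>.hasDerivAt
  have hH : ∀ x, HasDerivAt (fun x => (φ x - q) * Complex.exp (-G x)) 0 x := by
    intro x
    have := ((φ.hasDerivAt x).sub_const q).mul ((hGd x).neg.cexp)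
    refine this.congr_deriv ?_
    have := hne x
    simp only [Pi.neg_apply]
    field_simp
    ring
  have hconst := is_const_of_deriv_eq_zero (fun x => (hH x).differentiableAt)
    (fun x => (hH x).deriv) (2 * π) 0
  have hper : φ (2 * π) = φ 0 := by simpa using φ.periodic 0
  simp only [hper, hG, intervalIntegral.integral_same, neg_zero, Complex.exp_zero] at hconst
  have h1 := mul_left_cancel₀ (hne 0) hconst
  obtain ⟨n, hn⟩ := Complex.exp_eq_one_iff.1 h1
  -- the sign comes from the factor `exp (-G)`
  refine ⟨-n, ?_⟩
  have him : ∫ s in (0 : ℝ)..(2 * π), φ.angularSpeed q s =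
      (∫ s in (0 : ℝ)..(2 * π), deriv φ s / (φ s - q)).im :=
    Complex.imCLM.intervalIntegral_comp_comm (hcont.intervalIntegrable _ _)
  rw [ind_eq, him, ← neg_neg (∫ s in (0 : ℝ)..(2 * π), deriv φ s / (φ s - q)), hn]
  have := Real.pi_pos
  simp
  field_simp

/-- If some ray from `q` misses the curve, the index of `q` is zero. -/
lemma ind_eq_zero_of_ray {q w : ℂ} (hw : w ≠ 0) (h : ∀ s, ∀ x : ℝ, 0 ≤ x → φ s ≠ q + x * w) :
    φ.ind q = 0 := by
  have hsl : ∀ s, (-w⁻¹) * (φ s - q) ∈ Complex.slitPlane := by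
    intro s
    by_contra hs
    rw [Complex.mem_slitPlane_iff, not_or, not_lt, not_not] at hs
    refine h s (-((-w⁻¹) * (φ s - q)).re) (by linarith [hs.1]) ?_
    have e : (((-w⁻¹) * (φ s - q)).re : ℂ) = (-w⁻¹) * (φ s - q) := by
      apply Complex.ext
      · simp
      · simpa using hs.2.symm
    push_cast
    rw [e]
    field_simp
    ring
  rw [ind_eq, intervalIntegral.integral_eq_sub_of_hasDerivAt (f' := φ.angularSpeed q)
    (f := fun s => ((-w⁻¹) * (φ s - q)).arg)
    (fun s _ => hasDerivAt_arg_const_mul ((φ.hasDerivAt s).sub_const q) (hsl s))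
    (φ.intervalIntegrable_angularSpeed q _ _)]
  have hper : φ (2 * π) = φ 0 := by simpa using φ.periodic 0
  simp [hper]

end ImmersedCurve

lemma eventually_forall_of_isCompact {ι Y : Type*} [TopologicalSpace Y] {l : Filter ι} {K : Set Y}
    (hK : IsCompact K) {P : ι → Y → Prop} (h : ∀ y ∈ K, ∀ᶠ z in l ×ˢ 𝓝 y, P z.1 z.2) :
    ∀ᶠ i in l, ∀ y ∈ K, P i y := by
  have := hK.mem_prod_nhdsSet_of_forall (s := {z : ι × Y | P z.1 z.2}) h
  filter_upwards [Eventually.curry (show ∀ᶠ z : ι × Y in l ×ˢ 𝓝ˢ K, P z.1 z.2 from this)]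
    with i hi y hy
  exact Eventually.self_of_nhdsSet (p := P i) hi y hy

/-- `Ψ i` converges to `φ` along `l` in the `C¹` topology. -/
structure C1Tendsto {ι : Type*} (Ψ : ι → ImmersedCurve) (l : Filter ι) (φ : ImmersedCurve) :
    Prop where
  fst : TendstoUniformly (fun i s => Ψ i s) φ l
  snd : TendstoUniformly (fun i s => deriv (Ψ i) s) (deriv φ) l

section

variable {ι : Type*} {Ψ : ι → ImmersedCurve} {l : Filter ι} {φ : ImmersedCurve}

lemma C1Tendsto.comp {κ : Type*} {l' : Filter κ} {k : κ → ι} (h : C1Tendsto Ψ l φ)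
    (hk : Tendsto k l' l) : C1Tendsto (fun j => Ψ (k j)) l' φ :=
  ⟨fun u hu => hk.eventually (h.fst u hu), fun u hu => hk.eventually (h.snd u hu)⟩

lemma c1Tendsto_const (φ : ImmersedCurve) (l : Filter ι) : C1Tendsto (fun _ => φ) l φ :=
  ⟨fun _ hu => Eventually.of_forall fun _ _ => refl_mem_uniformity hu,
    fun _ hu => Eventually.of_forall fun _ _ => refl_mem_uniformity hu⟩

lemma C1Tendsto.tendsto (h : C1Tendsto Ψ l φ) {x : ι → ℝ} {s : ℝ} (hx : Tendsto x l (𝓝 s)) :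
    Tendsto (fun i => Ψ i (x i)) l (𝓝 (φ s)) :=
  h.fst.tendsto_comp φ.continuous.continuousAt hx

lemma C1Tendsto.tendsto_deriv (h : C1Tendsto Ψ l φ) {x : ι → ℝ} {s : ℝ}
    (hx : Tendsto x l (𝓝 s)) : Tendsto (fun i => deriv (Ψ i) (x i)) l (𝓝 (deriv φ s)) :=
  h.snd.tendsto_comp φ.continuous_deriv.continuousAt hx

/-- The numbers `σ i ∈ {0, 1, -1}` tell whether the point `q i` is on the strand of `Ψ i` near the
parameter `s`, on its left, or on its right.  The side is witnessed by a point of the strand from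
which `q i` is seen in a direction that stays away from the direction of the strand. -/
def HasSides (Ψ : ι → ImmersedCurve) (l : Filter ι) (φ : ImmersedCurve) (q : ι → ℂ) (s : ℝ)
    (σ : ι → ℝ) : Prop :=
  ∃ x : ι → ℝ, Tendsto x l (𝓝 s) ∧ ∃ κ : ℝ, 0 < κ ∧ ∀ᶠ i in l,
    (σ i = 0 ∧ q i = Ψ i (x i)) ∨ (q i ≠ Ψ i (x i) ∧
      ((σ i = 1 ∧ κ * ‖q i - Ψ i (x i)‖ ≤ cross (deriv φ s) (q i - Ψ i (x i))) ∨
      (σ i = -1 ∧ κ * ‖q i - Ψ i (x i)‖ ≤ -cross (deriv φ s) (q i - Ψ i (x i)))))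

lemma cross_eq_normSq_mul_im_div (e v : ℂ) (he : e ≠ 0) :
    cross e v = ‖e‖ ^ 2 * (v / e).im := by
  rw [← Complex.normSq_eq_norm_sq, Complex.div_im]
  have := (Complex.normSq_pos.2 he).ne'
  rw [cross]
  field_simp

/-- Near the parameter `s` the velocities of curves close to `φ` stay in a thin cone. -/
lemma C1Tendsto.eventually_cone (h : C1Tendsto Ψ l φ) (s : ℝ) {κ : ℝ} (hκ : 0 < κ) :
    ∀ᶠ δ in 𝓝[>] (0 : ℝ), ∀ᶠ i in l, ∀ x ∈ Icc (s - δ) (s + δ),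
      1 / 2 < (deriv (Ψ i) x / deriv φ s).re ∧
        |(deriv (Ψ i) x / deriv φ s).im| ≤ κ * (deriv (Ψ i) x / deriv φ s).re := by
  set e := deriv φ s
  have he : e ≠ 0 := φ.immersion s
  set r := min (1 / 2) (κ / 2)
  have hr : 0 < r := by positivity
  have hcont : ContinuousAt (fun x => deriv φ x / e) s :=
    (φ.continuous_deriv.div_const e).continuousAt
  have h1 : ∀ᶠ x in 𝓝 s, dist (deriv φ x / e) 1 < r / 2 := by
    have := hcont.eventually (Metric.ball_mem_nhds (deriv φ s / e) (half_pos hr))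
    simpa [e, div_self he] using this
  obtain ⟨δ₀, hδ₀, hball⟩ := Metric.eventually_nhds_iff.1 h1
  have h2 : ∀ᶠ i in l, ∀ x, dist (deriv φ x) (deriv (Ψ i) x) < r / 2 * ‖e‖ :=
    Metric.tendstoUniformly_iff.1 h.snd _ (by positivity)
  filter_upwards [Ioo_mem_nhdsGT hδ₀] with δ hδ
  filter_upwards [h2] with i hi x hx
  have hxs : dist x s < δ₀ := by
    rw [Real.dist_eq, abs_lt]; constructor <;> linarith [hx.1, hx.2, hδ.2]
  have h3 : dist (deriv (Ψ i) x / e) (deriv φ x / e) < r / 2 := by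
    rw [dist_eq_norm, ← sub_div, norm_div, div_lt_iff₀ (norm_pos_iff.2 he), ← dist_eq_norm,
      dist_comm]
    exact hi x
  have h4 : ‖deriv (Ψ i) x / e - 1‖ < r := by
    rw [← dist_eq_norm]
    calc _ ≤ _ := dist_triangle _ (deriv φ x / e) _
      _ < r / 2 + r / 2 := add_lt_add h3 (hball hxs)
      _ = r := by ring
  have h5 := (Complex.abs_re_le_norm _).trans_lt h4
  have h6 := (Complex.abs_im_le_norm _).trans_lt h4
  rw [Complex.sub_re, Complex.one_re, abs_lt] at h5
  rw [Complex.sub_im, Complex.one_im, sub_zero] at h6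
  have h7 : r ≤ 1 / 2 := min_le_left _ _
  have h8 : r ≤ κ / 2 := min_le_right _ _
  have h9 : 1 / 2 < (deriv (Ψ i) x / e).re := by linarith
  refine ⟨h9, ?_⟩
  nlinarith

/-- The angle swept by a strand near a point `p` of the curve depends continuously on the curve and
on the point from which it is seen, up to the jump by `π` on each side. -/
lemma C1Tendsto.tendsto_strand (h : C1Tendsto Ψ l φ) {q : ι → ℂ} {p : ℂ}
    (hq : Tendsto q l (𝓝 p)) {s : ℝ} (hs : φ s = p) {σ : ι → ℝ} (hσ : HasSides Ψ l φ q s σ) :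
    ∀ᶠ δ in 𝓝[>] (0 : ℝ), Tendsto (fun i =>
      (∫ x in (s - δ)..(s + δ), (Ψ i).angularSpeed (q i) x) - π * σ i) l
      (𝓝 (∫ x in (s - δ)..(s + δ), φ.angularSpeed p x)) := by
  obtain ⟨x, hx, κ₀, hκ₀, hside⟩ := hσ
  set e := deriv φ s with hedef
  have he : e ≠ 0 := φ.immersion s
  have hne : 0 < ‖e‖ := norm_pos_iff.2 he
  set κ := κ₀ / (2 * ‖e‖) with hκdef
  have hκ : 0 < κ := by positivity
  have strand : ∀ (ψ : ImmersedCurve) (y : ℂ) (δ x σ : ℝ), x ∈ Icc (s - δ) (s + δ) →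
      (∀ x ∈ Icc (s - δ) (s + δ), 1 / 2 < (deriv ψ x / e).re ∧
        |(deriv ψ x / e).im| ≤ κ * (deriv ψ x / e).re) →
      ((ψ (s - δ) - y) / e).re < 0 → 0 < ((ψ (s + δ) - y) / e).re →
      ((σ = 0 ∧ y = ψ x) ∨ (y ≠ ψ x ∧ ((σ = 1 ∧ κ₀ * ‖y - ψ x‖ ≤ cross e (y - ψ x)) ∨
        (σ = -1 ∧ κ₀ * ‖y - ψ x‖ ≤ -cross e (y - ψ x))))) →
      ∫ x in (s - δ)..(s + δ), ψ.angularSpeed y x =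
        ((ψ (s + δ) - y) / e).arg - (-((ψ (s - δ) - y) / e)).arg + π * σ := by
    intro ψ y δ x σ hx hcone h1 h2 h3
    have hd : ∀ u, deriv (fun s => (ψ s - y) / e) u = deriv ψ u / e := fun u =>
      (((ψ.hasDerivAt u).sub_const y).div_const e).deriv
    have hside : ∀ τ : ℝ, κ₀ * ‖y - ψ x‖ ≤ τ * cross e (y - ψ x) → y ≠ ψ x →
        κ * |((ψ x - y) / e).re| < τ * -((ψ x - y) / e).im := by
      intro τ hτ hy
      rw [cross_eq_normSq_mul_im_div _ _ he] at hτ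
      have a1 : ((y - ψ x) / e).im = -((ψ x - y) / e).im := by
        rw [← neg_sub, neg_div, Complex.neg_im]
      have a2 : ‖y - ψ x‖ = ‖e‖ * ‖(ψ x - y) / e‖ := by
        rw [norm_div, norm_sub_rev]; field_simp
      have a3 : 0 < ‖(ψ x - y) / e‖ := by
        rw [norm_pos_iff]; exact div_ne_zero (sub_ne_zero.2 hy.symm) he
      have a4 := Complex.abs_re_le_norm ((ψ x - y) / e)
      rw [a1, a2] at hτ
      have a5 : κ₀ * ‖(ψ x - y) / e‖ ≤ ‖e‖ * (τ * -((ψ x - y) / e).im) := by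
        refine le_of_mul_le_mul_left ?_ hne
        calc _ = _ := by ring
          _ ≤ _ := hτ
          _ = _ := by ring
      have a6 : κ₀ = 2 * κ * ‖e‖ := by rw [hκdef]; field_simp
      rw [a6] at a5
      have a7 : 2 * κ * ‖(ψ x - y) / e‖ ≤ τ * -((ψ x - y) / e).im := by
        refine le_of_mul_le_mul_left ?_ hne
        calc _ = _ := by ring
          _ ≤ _ := a5
      nlinarith [mul_pos hκ a3, mul_le_mul_of_nonneg_left a4 hκ.le]
    have := integral_im_logDeriv_strand (η := fun s => (ψ s - y) / e) (κ := κ) (σ := σ)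
      (((ψ.smooth.of_le (by norm_cast)).sub contDiff_const).div_const e) hx
      (fun u hu => by rw [hd]; linarith [(hcone u hu).1])
      (fun u hu => by rw [hd]; exact (hcone u hu).2) h1 h2 ?_
    · rw [← this]
      refine intervalIntegral.integral_congr fun u _ => ?_
      simp only [hd, ImmersedCurve.angularSpeed]
      rw [div_div_div_cancel_right₀ he]
    · rcases h3 with ⟨rfl, h3⟩ | ⟨hy, ⟨rfl, h3⟩ | ⟨rfl, h3⟩⟩
      · exact Or.inl ⟨rfl, by simp [h3]⟩
      · exact Or.inr (Or.inl ⟨rfl, by simpa using hside 1 (by simpa using h3) hy⟩)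
      · exact Or.inr (Or.inr ⟨rfl, by simpa using hside (-1) (by simpa using h3) hy⟩)
  have hφcone := (c1Tendsto_const φ (pure ())).eventually_cone s hκ
  filter_upwards [h.eventually_cone s hκ, hφcone, self_mem_nhdsWithin] with δ hδ hδφ hδ0
  rw [mem_Ioi] at hδ0
  have hδφ' := eventually_pure.1 hδφ
  -- the end points of the strand of `φ`
  have hmono : StrictMonoOn (fun u => ((φ u - p) / e).re) (Icc (s - δ) (s + δ)) := by
    refine strictMonoOn_of_deriv_pos (convex_Icc _ _)
      (Complex.continuous_re.comp ((φ.continuous.sub continuous_const).div_const e)).continuousOn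
      fun u hu => ?_
    have : HasDerivAt (fun u => ((φ u - p) / e).re) (deriv φ u / e).re u :=
      Complex.reCLM.hasFDerivAt.comp_hasDerivAt u (((φ.hasDerivAt u).sub_const p).div_const e)
    rw [this.deriv]
    linarith [(hδφ' u (interior_subset hu)).1]
  have hm : s ∈ Icc (s - δ) (s + δ) := ⟨by linarith, by linarith⟩
  have hl : ((φ (s - δ) - p) / e).re < 0 := by
    have := hmono (left_mem_Icc.2 (by linarith)) hm (by linarith)
    simpa [hs] using this
  have hr : 0 < ((φ (s + δ) - p) / e).re := by
    have := hmono hm (right_mem_Icc.2 (by linarith)) (by linarith)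
    simpa [hs] using this
  have htl : Tendsto (fun i => (Ψ i (s - δ) - q i) / e) l (𝓝 ((φ (s - δ) - p) / e)) :=
    ((h.tendsto tendsto_const_nhds).sub hq).div_const e
  have htr : Tendsto (fun i => (Ψ i (s + δ) - q i) / e) l (𝓝 ((φ (s + δ) - p) / e)) :=
    ((h.tendsto tendsto_const_nhds).sub hq).div_const e
  have hel : ∀ᶠ i in l, ((Ψ i (s - δ) - q i) / e).re < 0 :=
    ((Complex.continuous_re.tendsto _).comp htl).eventually_lt_const hl
  have her : ∀ᶠ i in l, 0 < ((Ψ i (s + δ) - q i) / e).re :=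
    ((Complex.continuous_re.tendsto _).comp htr).eventually_const_lt hr
  have hxi : ∀ᶠ i in l, x i ∈ Icc (s - δ) (s + δ) :=
    hx (Icc_mem_nhds (by linarith) (by linarith))
  rw [strand φ p δ s 0 hm hδφ' hl hr (Or.inl ⟨rfl, hs.symm⟩), mul_zero, add_zero]
  have hlim : Tendsto (fun i => ((Ψ i (s + δ) - q i) / e).arg - (-((Ψ i (s - δ) - q i) / e)).arg) l
      (𝓝 (((φ (s + δ) - p) / e).arg - (-((φ (s - δ) - p) / e)).arg)) := by
    refine Tendsto.sub ((Complex.continuousAt_arg (Or.inl hr)).tendsto.comp htr)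
      ((Complex.continuousAt_arg (Or.inl ?_)).tendsto.comp htl.neg)
    rw [Complex.neg_re]; linarith
  refine hlim.congr' ?_
  filter_upwards [hδ, hel, her, hxi, hside] with i h1 h2 h3 h4 h5
  rw [strand (Ψ i) (q i) δ (x i) (σ i) h4 h1 h2 h3 h5]
  ring

/-- The parameters in `S`, all in the window `(x₀, x₀ + 2π)`, are those of the strands of `φ` at the
point `p`. -/
structure IsStrandSet (φ : ImmersedCurve) (p : ℂ) (x₀ : ℝ) (S : Finset ℝ) : Prop where
  mem_Ioo : ∀ a ∈ S, a ∈ Ioo x₀ (x₀ + 2 * π)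
  eq : ∀ a ∈ S, φ a = p
  exists_angle_eq : ∀ s, φ s = p → ∃ a ∈ S, (s : Real.Angle) = a

lemma eq_of_angle_eq_of_abs_lt {x y : ℝ} (h : (x : Real.Angle) = y) (hxy : |x - y| < 2 * π) :
    x = y := by
  obtain ⟨k, hk⟩ := Real.Angle.angle_eq_iff_two_pi_dvd_sub.1 h
  have hpi := Real.pi_pos
  rw [hk, abs_mul, abs_of_pos (by positivity)] at hxy
  have h1 : |(k : ℝ)| < 1 := by
    by_contra hc; push Not at hc; nlinarith
  have h2 : k = 0 := by
    have : |k| < 1 := by exact_mod_cast h1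
    exact Int.abs_lt_one_iff.1 this
  rw [h2] at hk; simp at hk; linarith

lemma IsStrandSet.mem {p : ℂ} {x₀ : ℝ} {S : Finset ℝ} (hS : IsStrandSet φ p x₀ S) {s : ℝ}
    (hs : s ∈ Icc x₀ (x₀ + 2 * π)) (h : φ s = p) : s ∈ S := by
  obtain ⟨a, ha, hsa⟩ := hS.exists_angle_eq s h
  have := hS.mem_Ioo a ha
  rw [eq_of_angle_eq_of_abs_lt hsa]
  · exact ha
  · rw [abs_lt]; constructor <;> linarith [hs.1, hs.2, this.1, this.2]

/-- The index as a function of the curve and of the point is continuous up to jumps by `1 / 2` for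
each side of each strand.  On the curve itself it is the mean of the values nearby. -/
theorem C1Tendsto.tendsto_ind (h : C1Tendsto Ψ l φ) {q : ι → ℂ} {p : ℂ}
    (hq : Tendsto q l (𝓝 p)) {x₀ : ℝ} {S : Finset ℝ} (hS : IsStrandSet φ p x₀ S)
    {σ : ℝ → ι → ℝ} (hσ : ∀ s ∈ S, HasSides Ψ l φ q s (σ s)) :
    Tendsto (fun i => (Ψ i).ind (q i) - 1 / 2 * ∑ s ∈ S, σ s i) l (𝓝 (φ.ind p)) := by
  have hpi := Real.pi_pos
  have e1 : ∀ᶠ δ in 𝓝[>] (0 : ℝ), ∀ s ∈ S, Tendsto (fun i =>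
      (∫ x in (s - δ)..(s + δ), (Ψ i).angularSpeed (q i) x) - π * σ s i) l
      (𝓝 (∫ x in (s - δ)..(s + δ), φ.angularSpeed p x)) :=
    (eventually_all_finset S).2 fun s hs => h.tendsto_strand hq (hS.eq s hs) (hσ s hs)
  have e2 : ∀ᶠ δ in 𝓝[>] (0 : ℝ), ∀ s ∈ S, x₀ ≤ s - δ ∧ s + δ ≤ x₀ + 2 * π := by
    refine (eventually_all_finset S).2 fun s hs => ?_
    have := hS.mem_Ioo s hs
    filter_upwards [Ioo_mem_nhdsGT (sub_pos.2 this.1), Ioo_mem_nhdsGT (sub_pos.2 this.2)]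
      with δ h1 h2
    constructor <;> linarith [h1.2, h2.2]
  have e3 : ∀ᶠ δ in 𝓝[>] (0 : ℝ), ∀ s ∈ S, ∀ t ∈ S, s ≠ t → 2 * δ < |s - t| := by
    refine (eventually_all_finset S).2 fun s _ => (eventually_all_finset S).2 fun t _ => ?_
    rcases eq_or_ne s t with rfl | hst
    · simp
    have : 0 < |s - t| / 2 := by have := abs_pos.2 (sub_ne_zero.2 hst); positivity
    filter_upwards [Ioo_mem_nhdsGT this] with δ hδ _
    linarith [hδ.2]
  obtain ⟨δ, ⟨⟨⟨e1, e2⟩, e3⟩, hδ⟩⟩ :=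
    (((e1.and e2).and e3).and self_mem_nhdsWithin).exists
  set N : ℝ → Set ℝ := fun s => Ioc (s - δ) (s + δ) with hN
  set W : Set ℝ := Ioc x₀ (x₀ + 2 * π) with hW
  set far : Set ℝ := W \ ⋃ s ∈ S, N s with hfar
  have hNW : (⋃ s ∈ S, N s) ⊆ W := iUnion₂_subset fun s hs => Ioc_subset_Ioc (e2 s hs).1 (e2 s hs).2
  have hNmeas : MeasurableSet (⋃ s ∈ S, N s) :=
    Finset.measurableSet_biUnion _ fun _ _ => measurableSet_Ioc
  have split : ∀ (ψ : ImmersedCurve) (y : ℂ), 2 * π * ψ.ind y =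
      (∫ x in far, ψ.angularSpeed y x) +
        ∑ s ∈ S, ∫ x in (s - δ)..(s + δ), ψ.angularSpeed y x := by
    intro ψ y
    have hint : ∀ a b, IntegrableOn (ψ.angularSpeed y) (Ioc a b) := fun a b =>
      (ψ.intervalIntegrable_angularSpeed y a b).1
    have hU : ∫ x in ⋃ s ∈ S, N s, ψ.angularSpeed y x =
        ∑ s ∈ S, ∫ x in (s - δ)..(s + δ), ψ.angularSpeed y x := by
      rw [integral_biUnion_finset S (fun _ _ => measurableSet_Ioc) ?_ (fun s _ => hint _ _)]
      · exact Finset.sum_congr rfl fun s _ =>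
          (intervalIntegral.integral_of_le (by linarith)).symm
      · intro s hs t ht hst
        rw [Function.onFun, Set.disjoint_left]
        rintro z ⟨z1, z2⟩ ⟨z3, z4⟩
        have := e3 s hs t ht hst
        rw [lt_abs] at this
        rcases this with h | h <;> linarith
    rw [ψ.ind_eq_integral y x₀, intervalIntegral.integral_of_le (by linarith), ← hU, hfar,
      setIntegral_sdiff hNmeas (hint _ _) hNW, ← mul_assoc, mul_inv_cancel₀ (by positivity),
      one_mul, sub_add_cancel]
  -- the far part
  have hfarT : Tendsto (fun i => ∫ x in far, (Ψ i).angularSpeed (q i) x) l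
      (𝓝 (∫ x in far, φ.angularSpeed p x)) := by
    set K : Set ℝ := Icc x₀ (x₀ + 2 * π) \ ⋃ s ∈ S, Ioo (s - δ) (s + δ) with hK
    have hKc : IsCompact K :=
      isCompact_Icc.diff (isOpen_biUnion fun _ _ => isOpen_Ioo)
    have hfarK : far ⊆ K := by
      rintro z ⟨z1, z2⟩
      refine ⟨Ioc_subset_Icc_self z1, fun hz => z2 ?_⟩
      simp only [mem_iUnion] at hz ⊢
      obtain ⟨s, hs, hz⟩ := hz
      exact ⟨s, hs, Ioo_subset_Ioc_self hz⟩
    have hKne : ∀ z ∈ K, φ z ≠ p := by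
      rintro z ⟨z1, z2⟩ hz
      refine z2 (mem_iUnion₂.2 ⟨z, hS.mem z1 hz, ?_⟩)
      constructor <;> linarith
    have hpt : ∀ z ∈ K, Tendsto (fun w : ι × ℝ => (Ψ w.1).angularSpeed (q w.1) w.2 -
        φ.angularSpeed p w.2) (l ×ˢ 𝓝 z) (𝓝 0) := by
      intro z hz
      have hc := h.comp (l' := l ×ˢ 𝓝 z) tendsto_fst
      have hz' : φ z - p ≠ 0 := sub_ne_zero.2 (hKne z hz)
      have t1 := (Complex.continuous_im.tendsto _).comp
        ((hc.tendsto_deriv tendsto_snd).div ((hc.tendsto tendsto_snd).sub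
          (hq.comp tendsto_fst)) hz')
      have t2 : Tendsto (fun w : ι × ℝ => φ.angularSpeed p w.2) (l ×ˢ 𝓝 z)
          (𝓝 (φ.angularSpeed p z)) := by
        have : ContinuousAt (φ.angularSpeed p) z := Complex.continuous_im.continuousAt.comp
          (φ.continuous_deriv.continuousAt.div
            (φ.continuous.continuousAt.sub continuousAt_const) hz')
        exact this.tendsto.comp tendsto_snd
      have := t1.sub t2
      rwa [ImmersedCurve.angularSpeed, sub_self] at this
    have hu : ∀ ε > 0, ∀ᶠ i in l, ∀ z ∈ K,
        ‖(Ψ i).angularSpeed (q i) z - φ.angularSpeed p z‖ ≤ ε := by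
      intro ε hε
      refine eventually_forall_of_isCompact hKc fun z hz => ?_
      filter_upwards [(hpt z hz).eventually (Metric.ball_mem_nhds 0 hε)] with w hw
      rw [dist_zero_right] at hw
      exact hw.le
    rw [Metric.tendsto_nhds]
    intro ε hε
    filter_upwards [hu (ε / (2 * π + 1)) (by positivity)] with i hi
    have hint : ∀ (ψ : ImmersedCurve) (y : ℂ), IntegrableOn (ψ.angularSpeed y) far := fun ψ y =>
      (ψ.intervalIntegrable_angularSpeed y x₀ (x₀ + 2 * π)).1.mono_set sdiff_subset
    have hvol : volume far ≤ ENNReal.ofReal (2 * π) := by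
      refine (measure_mono sdiff_subset).trans_eq ?_
      rw [hW, Real.volume_Ioc]; congr 1; ring
    have hfin : volume far < ⊤ := hvol.trans_lt ENNReal.ofReal_lt_top
    rw [dist_eq_norm, ← integral_sub (hint _ _) (hint _ _)]
    refine (norm_setIntegral_le_of_norm_le_const hfin fun z hz => hi z (hfarK hz)).trans_lt ?_
    have : volume.real far ≤ 2 * π := ENNReal.toReal_le_of_le_ofReal (by positivity) hvol
    calc ε / (2 * π + 1) * volume.real far ≤ ε / (2 * π + 1) * (2 * π) := by gcongr
      _ < ε := by rw [div_mul_eq_mul_div, div_lt_iff₀ (by positivity)]; nlinarith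
  have hsum := (hfarT.add (tendsto_finsetSum S e1)).const_mul (2 * π)⁻¹
  rw [← split, ← mul_assoc, inv_mul_cancel₀ (by positivity), one_mul] at hsum
  refine hsum.congr fun i => ?_
  rw [Finset.sum_sub_distrib, ← Finset.mul_sum, ← add_sub_assoc, ← split]
  field_simp

end

/-! ### The values of the index on the curve -/

lemma norm_cross_le (u v : ℂ) : |cross u v| ≤ ‖u‖ * ‖v‖ := by
  have : cross u v = ((starRingEnd ℂ) u * v).im := by
    simp [cross]; ring
  rw [this]
  refine (Complex.abs_im_le_norm _).trans ?_
  rw [norm_mul, RCLike.norm_conj]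

section

variable {φ : ImmersedCurve}

/-- In a direction transverse to all strands one leaves the curve at once. -/
lemma eventually_forall_ne_of_transverse {p w : ℂ}
    (hw : ∀ s, φ s = p → cross (deriv φ s) w ≠ 0) :
    ∀ᶠ ε : ℝ in 𝓝[>] (0 : ℝ), ∀ s, φ s ≠ p + ε * w := by
  have key : ∀ᶠ ε : ℝ in 𝓝[>] (0 : ℝ), ∀ s ∈ Icc (0 : ℝ) (2 * π), φ s ≠ p + ε * w := by
    refine eventually_forall_of_isCompact isCompact_Icc fun s _ => ?_
    by_cases hs : φ s = p
    · set e := deriv φ s with he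
      have hc := hw s hs
      have hc0 : 0 < |cross e w| := abs_pos.2 hc
      have he0 : 0 < ‖e‖ := norm_pos_iff.2 (φ.immersion s)
      -- the slope of the chords is so small that they cannot have the direction `w`
      obtain ⟨r, hr, hr1, hr2⟩ :
          ∃ r > 0, r < ‖e‖ / 2 ∧ ‖e‖ * r * ‖w‖ < |cross e w| * (‖e‖ / 2) := by
        refine ⟨min (‖e‖ / 4) (|cross e w| / (4 * (‖w‖ + 1))), by positivity, ?_, ?_⟩
        · exact (min_le_left _ _).trans_lt (by linarith)
        · have h1 : min (‖e‖ / 4) (|cross e w| / (4 * (‖w‖ + 1))) * ‖w‖ ≤ |cross e w| / 4 := by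
            calc _ ≤ |cross e w| / (4 * (‖w‖ + 1)) * (‖w‖ + 1) := by
                  gcongr
                  · exact min_le_right _ _
                  · linarith
              _ = _ := by field_simp
          nlinarith [mul_pos he0 hc0]
      have hlit := (φ.hasDerivAt s).isLittleO.def hr
      have h2 : ∀ᶠ z : ℝ × ℝ in 𝓝[>] (0 : ℝ) ×ˢ 𝓝 s,
          ‖φ z.2 - φ s - (z.2 - s) • deriv φ s‖ ≤ r * ‖z.2 - s‖ := tendsto_snd.eventually hlit
      have h3 : ∀ᶠ z : ℝ × ℝ in 𝓝[>] (0 : ℝ) ×ˢ 𝓝 s, 0 < z.1 :=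
        tendsto_fst.eventually self_mem_nhdsWithin
      filter_upwards [h2, h3] with z h2 h3 h4
      rw [h4, hs, add_sub_cancel_left, Real.norm_eq_abs] at h2
      set x := z.2 - s
      set ε := z.1
      have b1 : cross e ((ε : ℂ) * w - x • e) = ε * cross e w := by
        simp [cross]; ring
      have b2 := norm_cross_le e ((ε : ℂ) * w - x • e)
      rw [b1, abs_mul, abs_of_pos h3] at b2
      have b3 : ε * |cross e w| ≤ ‖e‖ * (r * |x|) := b2.trans (by gcongr)
      have b4 : ‖e‖ * |x| ≤ ε * ‖w‖ + r * |x| := by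
        calc ‖e‖ * |x| = ‖x • e‖ := by rw [norm_smul, Real.norm_eq_abs, mul_comm]
          _ = ‖(ε : ℂ) * w - ((ε : ℂ) * w - x • e)‖ := by rw [sub_sub_cancel]
          _ ≤ ‖(ε : ℂ) * w‖ + ‖(ε : ℂ) * w - x • e‖ := norm_sub_le _ _
          _ ≤ _ := by
            gcongr
            rw [norm_mul, Complex.norm_real, Real.norm_eq_abs, abs_of_pos h3]
      have b5 : ‖e‖ / 2 * |x| ≤ ε * ‖w‖ := by nlinarith [abs_nonneg x]
      have b6 : ε * |cross e w| * (‖e‖ / 2) ≤ ‖e‖ * r * (ε * ‖w‖) := by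
        calc ε * |cross e w| * (‖e‖ / 2) ≤ ‖e‖ * (r * |x|) * (‖e‖ / 2) := by gcongr
          _ = ‖e‖ * r * (‖e‖ / 2 * |x|) := by ring
          _ ≤ _ := by gcongr
      have b7 : ‖e‖ * r * ‖w‖ * ε < |cross e w| * (‖e‖ / 2) * ε := mul_lt_mul_of_pos_right hr2 h3
      linarith
    · have t1 : Tendsto (fun z : ℝ × ℝ => φ z.2 - (p + z.1 * w)) (𝓝[>] (0 : ℝ) ×ˢ 𝓝 s)
          (𝓝 (φ s - (p + (0 : ℝ) * w))) := by
        refine ((φ.continuous.tendsto s).comp tendsto_snd).sub (tendsto_const_nhds.add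
          (Tendsto.mul_const w ?_))
        exact (Complex.continuous_ofReal.tendsto 0).comp
          (tendsto_fst.mono_right nhdsWithin_le_nhds)
      have : φ s - (p + (0 : ℝ) * w) ≠ 0 := by simpa [sub_eq_zero] using hs
      filter_upwards [t1.eventually_ne this] with z hz h
      exact hz (sub_eq_zero.2 h)
  filter_upwards [key] with ε hε s h
  obtain ⟨y, hy, hys⟩ := φ.periodic.exists_mem_Ico₀ Real.two_pi_pos s
  exact hε y (Ico_subset_Icc_self hy) (hys ▸ h)

lemma IsStrandSet.tendsto_ind_add {p : ℂ} {x₀ : ℝ} {S : Finset ℝ} (hS : IsStrandSet φ p x₀ S)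
    {w : ℂ} (hw : ∀ s ∈ S, cross (deriv φ s) w ≠ 0) :
    Tendsto (fun ε : ℝ => φ.ind (p + ε * w)) (𝓝[>] 0)
      (𝓝 (φ.ind p + 1 / 2 * ∑ s ∈ S, (SignType.sign (cross (deriv φ s) w) : ℝ))) := by
  have hq : Tendsto (fun ε : ℝ => p + ε * w) (𝓝[>] 0) (𝓝 p) := by
    have : Continuous fun ε : ℝ => p + ε * w := by fun_prop
    simpa using (this.tendsto 0).mono_left nhdsWithin_le_nhds
  have := (c1Tendsto_const φ (𝓝[>] (0 : ℝ))).tendsto_ind hq hS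
    (σ := fun s _ => (SignType.sign (cross (deriv φ s) w) : ℝ)) fun s hs => ?_
  · simpa using this.add_const (1 / 2 * ∑ s ∈ S, (SignType.sign (cross (deriv φ s) w) : ℝ))
  have hc := hw s hs
  have hw0 : w ≠ 0 := by rintro rfl; simp [cross] at hc
  refine ⟨fun _ => s, tendsto_const_nhds, |cross (deriv φ s) w| / ‖w‖, by positivity, ?_⟩
  filter_upwards [self_mem_nhdsWithin] with ε hε
  rw [mem_Ioi] at hε
  right
  have e1 : cross (deriv φ s) (ε * w) = ε * cross (deriv φ s) w := by simp [cross]; ring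
  have e2 : |cross (deriv φ s) w| / ‖w‖ * ‖(ε : ℂ) * w‖ = ε * |cross (deriv φ s) w| := by
    rw [norm_mul, Complex.norm_real, Real.norm_eq_abs, abs_of_pos hε]
    have := norm_pos_iff.2 hw0
    field_simp
  rw [hS.eq s hs, add_sub_cancel_left, e1, e2]
  refine ⟨by simp [hε.ne', hw0], ?_⟩
  rcases lt_or_gt_of_ne hc with h | h
  · right; simp [h, abs_of_neg h]
  · left; simp [h, abs_of_pos h]

lemma IsStrandSet.indNear_eq {p : ℂ} {x₀ : ℝ} {S : Finset ℝ} (hS : IsStrandSet φ p x₀ S)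
    {w : ℂ} (hw : ∀ s ∈ S, cross (deriv φ s) w ≠ 0) :
    φ.indNear p w = φ.ind p + 1 / 2 * ∑ s ∈ S, (SignType.sign (cross (deriv φ s) w) : ℝ) :=
  (hS.tendsto_ind_add hw).limUnder_eq

lemma exists_cross_ne_zero (S : Finset ℝ) (φ : ImmersedCurve) :
    ∃ w : ℂ, ∀ s ∈ S, cross (deriv φ s) w ≠ 0 := by
  obtain ⟨t, ht⟩ := Set.Infinite.exists_notMem_finset (s := (univ : Set ℝ)) infinite_univ
    (S.image fun s => (deriv φ s).im / (deriv φ s).re)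
  refine ⟨1 + t * Complex.I, fun s hs h => ht.2 (Finset.mem_image.2 ⟨s, hs, ?_⟩)⟩
  have h' : (deriv φ s).re * t = (deriv φ s).im := by
    simp [cross] at h; linarith
  have hre : (deriv φ s).re ≠ 0 := by
    intro h0
    rw [h0, zero_mul] at h'
    exact φ.immersion s (Complex.ext h0 h'.symm)
  rw [← h']; field_simp

/-- The index of a point on `n` strands is an integer plus `n / 2`. -/
lemma IsStrandSet.exists_int {p : ℂ} {x₀ : ℝ} {S : Finset ℝ} (hS : IsStrandSet φ p x₀ S) :
    ∃ n : ℤ, φ.ind p = n + (S.card : ℝ) / 2 := by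
  obtain ⟨w, hw⟩ := exists_cross_ne_zero S φ
  have hoff := eventually_forall_ne_of_transverse (φ := φ) (p := p) (w := w) fun s hs => by
    obtain ⟨a, ha, hsa⟩ := hS.exists_angle_eq s hs
    rw [φ.deriv_eq_of_angle_eq hsa]
    exact hw a ha
  have hcl : IsClosed (range ((↑) : ℤ → ℝ)) := Int.isClosedEmbedding_coe_real.isClosed_range
  have hval : ∀ᶠ ε : ℝ in 𝓝[>] (0 : ℝ), φ.ind (p + ε * w) ∈ range ((↑) : ℤ → ℝ) :=
    hoff.mono fun ε hε => by
      obtain ⟨n, hn⟩ := φ.exists_int_ind hε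
      exact ⟨n, hn.symm⟩
  obtain ⟨n, hn⟩ := hcl.mem_of_tendsto (hS.tendsto_ind_add hw) hval
  have hsign : ∀ T ⊆ S, ∃ m : ℤ, ∑ s ∈ T, (SignType.sign (cross (deriv φ s) w) : ℝ) =
      2 * m - T.card := by
    intro T
    induction T using Finset.induction_on with
    | empty => exact fun _ => ⟨0, by simp⟩
    | insert a T ha ih =>
      intro hT
      obtain ⟨m, hm⟩ := ih ((Finset.subset_insert _ _).trans hT)
      rw [Finset.sum_insert ha, hm, Finset.card_insert_of_notMem ha]
      rcases lt_or_gt_of_ne (hw a (hT (Finset.mem_insert_self _ _))) with h | h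
      · exact ⟨m, by simp [h]; ring⟩
      · exact ⟨m + 1, by simp [h]; ring⟩
  obtain ⟨m, hm⟩ := hsign S subset_rfl
  refine ⟨n - m, ?_⟩
  rw [hm] at hn
  push_cast
  linarith

/-- Whatever way a point approaches a strand, it has a well-defined side with respect to it. -/
lemma C1Tendsto.exists_hasSides {ι : Type*} {Ψ : ι → ImmersedCurve} {l : Filter ι}
    (h : C1Tendsto Ψ l φ) {q : ι → ℂ} {s : ℝ} (hq : Tendsto q l (𝓝 (φ s))) :
    ∃ σ : ι → ℝ, HasSides Ψ l φ q s σ ∧ ∀ i, |σ i| ≤ 1 := by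
  classical
  set e := deriv φ s with he
  have he0 : e ≠ 0 := φ.immersion s
  have hne : 0 < ‖e‖ := norm_pos_iff.2 he0
  have hφcone := (c1Tendsto_const φ (pure ())).eventually_cone s one_pos
  -- the foot: the point of the strand from which `q` is seen at a right angle
  have foot : ∀ᶠ δ in 𝓝[>] (0 : ℝ), ∀ᶠ i in l, ∃ x ∈ Icc (s - δ) (s + δ),
      ((Ψ i x - q i) / e).re = 0 := by
    filter_upwards [hφcone, self_mem_nhdsWithin] with δ hδ hδ0
    have hδ0' : 0 < δ := hδ0
    have hδ := eventually_pure.1 hδ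
    have hmono : StrictMonoOn (fun u => ((φ u - φ s) / e).re) (Icc (s - δ) (s + δ)) := by
      refine strictMonoOn_of_deriv_pos (convex_Icc _ _)
        (Complex.continuous_re.comp ((φ.continuous.sub continuous_const).div_const e)).continuousOn
        fun u hu => ?_
      have : HasDerivAt (fun u => ((φ u - φ s) / e).re) (deriv φ u / e).re u :=
        Complex.reCLM.hasFDerivAt.comp_hasDerivAt u (((φ.hasDerivAt u).sub_const _).div_const e)
      rw [this.deriv]
      linarith [(hδ u (interior_subset hu)).1]
    have hm : s ∈ Icc (s - δ) (s + δ) := ⟨by linarith, by linarith⟩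
    have hl : ((φ (s - δ) - φ s) / e).re < 0 := by
      simpa using hmono (left_mem_Icc.2 (by linarith)) hm (by linarith)
    have hr : 0 < ((φ (s + δ) - φ s) / e).re := by
      simpa using hmono hm (right_mem_Icc.2 (by linarith)) (by linarith)
    have hel : ∀ᶠ i in l, ((Ψ i (s - δ) - q i) / e).re < 0 :=
      ((Complex.continuous_re.tendsto _).comp
        (((h.tendsto tendsto_const_nhds).sub hq).div_const e)).eventually_lt_const hl
    have her : ∀ᶠ i in l, 0 < ((Ψ i (s + δ) - q i) / e).re :=
      ((Complex.continuous_re.tendsto _).comp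
        (((h.tendsto tendsto_const_nhds).sub hq).div_const e)).eventually_const_lt hr
    filter_upwards [hel, her] with i h1 h2
    exact intermediate_value_Icc (by linarith) (Complex.continuous_re.comp
      (((Ψ i).continuous.sub continuous_const).div_const e)).continuousOn ⟨h1.le, h2.le⟩
  obtain ⟨δ₀, ⟨hcone, hfoot⟩, hδ₀⟩ :=
    (((h.eventually_cone s one_pos).and foot).and self_mem_nhdsWithin).exists
  have hδ₀' : 0 < δ₀ := hδ₀
  choose! x hx using fun i (hi : ∃ x ∈ Icc (s - δ₀) (s + δ₀), ((Ψ i x - q i) / e).re = 0) => hi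
  have hxs : Tendsto x l (𝓝 s) := by
    rw [Metric.tendsto_nhds]
    intro ε hε
    obtain ⟨δ, hδ, hδε⟩ := (foot.and (Ioo_mem_nhdsGT (lt_min hε hδ₀'))).exists
    filter_upwards [hcone, hfoot, hδ] with i h1 h2 ⟨y, hy, hy0⟩
    have hmin := lt_min_iff.1 hδε.2
    have hmono : StrictMonoOn (fun u => ((Ψ i u - q i) / e).re) (Icc (s - δ₀) (s + δ₀)) := by
      refine strictMonoOn_of_deriv_pos (convex_Icc _ _) (Complex.continuous_re.comp
        (((Ψ i).continuous.sub continuous_const).div_const e)).continuousOn fun u hu => ?_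
      have : HasDerivAt (fun u => ((Ψ i u - q i) / e).re) (deriv (Ψ i) u / e).re u :=
        Complex.reCLM.hasFDerivAt.comp_hasDerivAt u
          ((((Ψ i).hasDerivAt u).sub_const _).div_const e)
      rw [this.deriv]
      linarith [(h1 u (interior_subset hu)).1]
    have : x i = y := hmono.injOn (hx i h2).1 ⟨by linarith [hy.1], by linarith [hy.2]⟩
      (by simp only [(hx i h2).2, hy0])
    rw [this, Real.dist_eq, abs_lt]
    constructor <;> linarith [hy.1, hy.2]
  refine ⟨fun i => SignType.sign (cross e (q i - Ψ i (x i))), ⟨x, hxs, ‖e‖, hne, ?_⟩, ?_⟩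
  · filter_upwards [hfoot] with i hi
    obtain ⟨-, h0⟩ := hx i hi
    have hre : ((q i - Ψ i (x i)) / e).re = 0 := by
      rw [← neg_sub, neg_div, Complex.neg_re, h0, neg_zero]
    have habs : |cross e (q i - Ψ i (x i))| = ‖e‖ * ‖q i - Ψ i (x i)‖ := by
      have h1 : ‖q i - Ψ i (x i)‖ = ‖e‖ * |((q i - Ψ i (x i)) / e).im| := by
        rw [Complex.abs_im_eq_norm.2 hre, norm_div]; field_simp
      rw [cross_eq_normSq_mul_im_div _ _ he0, abs_mul, abs_of_pos (by positivity), h1]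
      ring
    by_cases hv : q i = Ψ i (x i)
    · left; exact ⟨by simp [hv, cross], hv⟩
    right
    refine ⟨hv, ?_⟩
    have hpos : 0 < ‖e‖ * ‖q i - Ψ i (x i)‖ :=
      mul_pos hne (norm_pos_iff.2 (sub_ne_zero.2 hv))
    rw [← habs] at hpos ⊢
    rcases lt_or_gt_of_ne (abs_pos.1 hpos) with hc | hc
    · right; simp [← he, hc, abs_of_neg hc]
    · left; simp [← he, hc, abs_of_pos hc]
  · intro i
    rcases lt_trichotomy (cross e (q i - Ψ i (x i))) 0 with hc | hc | hc
    · simp [hc]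
    · simp [hc]
    · simp [hc]

lemma isStrandSet_singleton {a : ℝ} (h : ∀ s, φ s = φ a → (s : Real.Angle) = a) :
    IsStrandSet φ (φ a) (a - π) {a} where
  mem_Ioo := by
    have := Real.pi_pos
    intro b hb
    rw [Finset.mem_singleton.1 hb]
    constructor <;> linarith
  eq := by simp
  exists_angle_eq s hs := ⟨a, by simp, h s hs⟩

/-- At most the points `a` and `b` of the circle are mapped to `φ a`. -/
def ImmersedCurve.OnlyTwo (φ : ImmersedCurve) (a b : ℝ) : Prop :=
  ∀ s, φ s = φ a → (s : Real.Angle) = a ∨ (s : Real.Angle) = b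

lemma isStrandSet_pair {a b : ℝ} (h1 : a < b) (h2 : b < a + 2 * π) (hab : φ a = φ b)
    (h : φ.OnlyTwo a b) :
    IsStrandSet φ (φ a) ((a + b) / 2 - π) {a, b} where
  mem_Ioo := by
    intro c hc
    rcases Finset.mem_insert.1 hc with rfl | hc
    · constructor <;> linarith
    · rw [Finset.mem_singleton.1 hc]; constructor <;> linarith
  eq := by simp [hab]
  exists_angle_eq s hs := by
    rcases h s hs with h | h
    · exact ⟨a, by simp, h⟩
    · exact ⟨b, by simp, h⟩

lemma isStrandSet_triple {a b c : ℝ} (h1 : a < b) (h2 : b < c) (h3 : c < a + 2 * π)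
    (hab : φ a = φ b) (hbc : φ b = φ c) (h : ∀ s, φ s = φ a →
      (s : Real.Angle) = a ∨ (s : Real.Angle) = b ∨ (s : Real.Angle) = c) :
    IsStrandSet φ (φ a) ((a + c) / 2 - π) {a, b, c} where
  mem_Ioo := by
    intro d hd
    simp only [Finset.mem_insert, Finset.mem_singleton] at hd
    rcases hd with rfl | rfl | rfl <;> constructor <;> linarith
  eq := by simp [hab, hbc]
  exists_angle_eq s hs := by
    rcases h s hs with h | h | h
    · exact ⟨a, by simp, h⟩
    · exact ⟨b, by simp, h⟩
    · exact ⟨c, by simp, h⟩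

/-- There are no points through which the curve passes three times. -/
def ImmersedCurve.NoTriple (φ : ImmersedCurve) : Prop := ∀ x y z, ¬ φ.IsTriple x y z

lemma angle_ne_of_lt {a b : ℝ} (h1 : a < b) (h2 : b < a + 2 * π) : (a : Real.Angle) ≠ b := by
  intro h
  have := eq_of_angle_eq_of_abs_lt h (by rw [abs_lt]; constructor <;> linarith)
  linarith

lemma ImmersedCurve.NoTriple.onlyTwo (hφ : φ.NoTriple) {a b : ℝ} (h1 : a < b)
    (h2 : b < a + 2 * π) (hab : φ a = φ b) : φ.OnlyTwo a b := by
  intro s hs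
  by_contra hc
  rw [not_or] at hc
  exact hφ s a b ⟨hc.1, angle_ne_of_lt h1 h2, hc.2, hs, hab⟩

lemma IsStrandSet.exists_int_of_pair {p : ℂ} {x₀ a b : ℝ} (h : a ≠ b)
    (hS : IsStrandSet φ p x₀ {a, b}) : ∃ n : ℤ, φ.ind p = n := by
  obtain ⟨n, hn⟩ := hS.exists_int
  refine ⟨n + 1, ?_⟩
  rw [hn, Finset.card_pair h]; push_cast; ring

/-- The index `i(x)` of a transverse double point is the value at `x` of the principal value of the
integral that defines `ind`. -/
lemma ImmersedCurve.doubleIndex_eq {a b : ℝ} (h1 : a < b) (h2 : b < a + 2 * π) (hab : φ a = φ b)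
    (h : φ.OnlyTwo a b) (ht : cross (deriv φ a) (deriv φ b) ≠ 0) :
    φ.doubleIndex a b = φ.ind (φ a) := by
  have hS := isStrandSet_pair h1 h2 hab h
  set u := deriv φ a
  set v := deriv φ b
  have key : ∀ w : ℂ, cross u w ≠ 0 → cross v w ≠ 0 → φ.indNear (φ a) w = φ.ind (φ a) +
      1 / 2 * ((SignType.sign (cross u w) : ℝ) + (SignType.sign (cross v w) : ℝ)) := by
    intro w hu hv
    rw [hS.indNear_eq, Finset.sum_pair h1.ne]
    intro s hs
    simp only [Finset.mem_insert, Finset.mem_singleton] at hs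
    rcases hs with rfl | rfl
    exacts [hu, hv]
  have c1 : cross u (u + v) = cross u v := by simp [cross]; ring
  have c2 : cross u (u - v) = -cross u v := by simp [cross]; ring
  have c3 : cross u (-u + v) = cross u v := by simp [cross]; ring
  have c4 : cross u (-u - v) = -cross u v := by simp [cross]; ring
  have d1 : cross v (u + v) = -cross u v := by simp [cross]; ring
  have d2 : cross v (u - v) = -cross u v := by simp [cross]; ring
  have d3 : cross v (-u + v) = cross u v := by simp [cross]; ring
  have d4 : cross v (-u - v) = cross u v := by simp [cross]; ring
  have ht' := neg_ne_zero.2 ht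
  rw [doubleIndex, key _ (c1 ▸ ht) (d1 ▸ ht'), key _ (c2 ▸ ht') (d2 ▸ ht'),
    key _ (c3 ▸ ht) (d3 ▸ ht), key _ (c4 ▸ ht') (d4 ▸ ht), c1, c2, c3, c4, d1, d2, d3, d4,
    Left.sign_neg]
  push_cast
  ring

lemma cross_I_mul_self (u : ℂ) : cross u (Complex.I * u) = ‖u‖ ^ 2 := by
  rw [← Complex.normSq_eq_norm_sq, Complex.normSq_apply]; simp [cross]

lemma ImmersedCurve.indNear_of_isBasePoint {s : ℝ} (hs : φ.IsBasePoint s) {w : ℂ}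
    (hw : cross (deriv φ s) w ≠ 0) : φ.indNear (φ s) w =
      φ.ind (φ s) + 1 / 2 * (SignType.sign (cross (deriv φ s) w) : ℝ) := by
  rw [(isStrandSet_singleton hs).indNear_eq (by simpa using hw), Finset.sum_singleton]

lemma ImmersedCurve.baseIndex_eq {s : ℝ} (hs : φ.IsBasePoint s) :
    φ.baseIndex s = φ.ind (φ s) + 1 / 2 := by
  have hp : 0 < cross (deriv φ s) (Complex.I * deriv φ s) := by
    rw [cross_I_mul_self]; have := norm_pos_iff.2 (φ.immersion s); positivity
  have hn : cross (deriv φ s) (-(Complex.I * deriv φ s)) < 0 := by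
    have : cross (deriv φ s) (-(Complex.I * deriv φ s)) =
      -cross (deriv φ s) (Complex.I * deriv φ s) := by simp [cross]; ring
    linarith
  rw [baseIndex, indNear_of_isBasePoint hs hp.ne', indNear_of_isBasePoint hs hn.ne, sign_pos hp,
    sign_neg hn, max_eq_left]
  · simp
  · simp

/-- The index of a double point does not change when the curve moves without triple points. -/
lemma C1Tendsto.eventually_ind_eq {ι : Type*} {Ψ : ι → ImmersedCurve} {l : Filter ι}
    (h : C1Tendsto Ψ l φ) {a b : ι → ℝ} {a₀ b₀ : ℝ} (ha : Tendsto a l (𝓝 a₀))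
    (hb : Tendsto b l (𝓝 b₀)) (h1 : a₀ < b₀) (h2 : b₀ < a₀ + 2 * π) (hab : φ a₀ = φ b₀)
    (hφ : φ.OnlyTwo a₀ b₀) :
    ∀ᶠ i in l, (Ψ i).OnlyTwo (a i) (b i) → Ψ i (a i) = Ψ i (b i) →
      (Ψ i).ind (Ψ i (a i)) = φ.ind (φ a₀) := by
  set l' := l ⊓ 𝓟 {i | Ψ i (a i) = Ψ i (b i)} with hl'
  have hle : l' ≤ l := inf_le_left
  have h' : C1Tendsto Ψ l' φ := h.comp (k := id) hle
  have hS := isStrandSet_pair h1 h2 hab hφ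
  have hq : Tendsto (fun i => Ψ i (a i)) l' (𝓝 (φ a₀)) := h'.tendsto (ha.mono_left hle)
  have hT := h'.tendsto_ind hq hS (σ := fun _ _ => 0) fun s hs => by
    simp only [Finset.mem_insert, Finset.mem_singleton] at hs
    rcases hs with rfl | rfl
    · exact ⟨a, ha.mono_left hle, 1, one_pos, Eventually.of_forall fun i => Or.inl ⟨rfl, rfl⟩⟩
    · refine ⟨b, hb.mono_left hle, 1, one_pos, ?_⟩
      filter_upwards [eventually_inf_principal.2 (Eventually.of_forall fun i hi => hi)] with i hi
      exact Or.inl ⟨rfl, hi⟩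
  simp only [Finset.sum_const_zero, mul_zero, sub_zero] at hT
  have e1 := hT.eventually (Metric.ball_mem_nhds _ one_pos)
  rw [hl', eventually_inf_principal] at e1
  have e2 : ∀ᶠ i in l, a i < b i := by
    filter_upwards [(hb.sub ha).eventually_const_lt (sub_pos.2 h1)] with i hi
    linarith
  have e3 : ∀ᶠ i in l, b i < a i + 2 * π := by
    filter_upwards [(hb.sub ha).eventually_lt_const (show b₀ - a₀ < 2 * π by linarith)] with i hi
    linarith
  filter_upwards [e1, e2, e3] with i e1 e2 e3 hno hi
  have := e1 hi
  obtain ⟨n, hn⟩ := ((isStrandSet_pair e2 e3 hi hno).exists_int_of_pair e2.ne)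
  obtain ⟨m, hm⟩ := hS.exists_int_of_pair h1.ne
  rw [hn, hm, Real.dist_eq] at this
  rw [hn, hm]
  have h3 : |n - m| < 1 := by exact_mod_cast this
  rw [Int.abs_lt_one_iff, sub_eq_zero] at h3
  rw [h3]

end

/-! ### Green's formula on the square of parameters -/

/-- The square of pairs of parameters. -/
def box : Set (ℝ × ℝ) := Icc ((0 : ℝ), (0 : ℝ)) (2 * π, 2 * π)

lemma mem_box {z : ℝ × ℝ} :
    z ∈ box ↔ (0 ≤ z.1 ∧ z.1 ≤ 2 * π) ∧ (0 ≤ z.2 ∧ z.2 ≤ 2 * π) := by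
  simp only [box, mem_Icc, Prod.le_def]; tauto

lemma isCompact_box : IsCompact box := isCompact_Icc

lemma measurableSet_box : MeasurableSet box := measurableSet_Icc

/-- The partial derivative of a function of two real variables in the first variable. -/
def partialFst (g : ℝ × ℝ → ℝ) (z : ℝ × ℝ) : ℝ := fderiv ℝ g z (1, 0)

/-- The partial derivative of a function of two real variables in the second variable. -/
def partialSnd (g : ℝ × ℝ → ℝ) (z : ℝ × ℝ) : ℝ := fderiv ℝ g z (0, 1)

lemma hasDerivAt_partialFst {X : ℝ × ℝ → ℝ} {z : ℝ × ℝ} (h : DifferentiableAt ℝ X z) :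
    HasDerivAt (fun a => X (a, z.2)) (partialFst X z) z.1 :=
  HasFDerivAt.comp_hasDerivAt (f := fun a : ℝ => (a, z.2)) (x := z.1) h.hasFDerivAt
    ((hasDerivAt_id z.1).prodMk (hasDerivAt_const z.1 z.2))

lemma hasDerivAt_partialSnd {X : ℝ × ℝ → ℝ} {z : ℝ × ℝ} (h : DifferentiableAt ℝ X z) :
    HasDerivAt (fun u => X (z.1, u)) (partialSnd X z) z.2 :=
  HasFDerivAt.comp_hasDerivAt (f := fun u : ℝ => (z.1, u)) (x := z.2) h.hasFDerivAt
    ((hasDerivAt_const z.2 z.1).prodMk (hasDerivAt_id z.2))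

lemma partialFst_eq {X : ℝ × ℝ → ℝ} {z : ℝ × ℝ} (h : DifferentiableAt ℝ X z) {d : ℝ}
    (hd : HasDerivAt (fun a => X (a, z.2)) d z.1) : partialFst X z = d :=
  (hasDerivAt_partialFst h).unique hd

lemma partialSnd_eq {X : ℝ × ℝ → ℝ} {z : ℝ × ℝ} (h : DifferentiableAt ℝ X z) {d : ℝ}
    (hd : HasDerivAt (fun u => X (z.1, u)) d z.2) : partialSnd X z = d :=
  (hasDerivAt_partialSnd h).unique hd

lemma contDiff_partialFst {g : ℝ × ℝ → ℝ} (hg : ContDiff ℝ ∞ g) : ContDiff ℝ ∞ (partialFst g) :=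
  (hg.fderiv_right (m := ∞) (by simp)).clm_apply contDiff_const

lemma contDiff_partialSnd {g : ℝ × ℝ → ℝ} (hg : ContDiff ℝ ∞ g) : ContDiff ℝ ∞ (partialSnd g) :=
  (hg.fderiv_right (m := ∞) (by simp)).clm_apply contDiff_const

lemma partialSnd_partialFst {g : ℝ × ℝ → ℝ} (hg : ContDiff ℝ ∞ g) (z : ℝ × ℝ) :
    partialSnd (partialFst g) z = partialFst (partialSnd g) z := by
  have hd : DifferentiableAt ℝ (fderiv ℝ g) z :=
    (hg.fderiv_right (m := ∞) (by simp)).differentiable (by simp) z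
  have hsymm : IsSymmSndFDerivAt ℝ g z := hg.contDiffAt.isSymmSndFDerivAt (by simp; norm_cast)
  have h1 : ∀ v w : ℝ × ℝ,
      fderiv ℝ (fun y => fderiv ℝ g y v) z w = fderiv ℝ (fderiv ℝ g) z w v := by
    intro v w
    rw [fderiv_clm_apply hd (differentiableAt_const _)]
    simp
  rw [partialSnd, partialFst]
  change fderiv ℝ (fun y => fderiv ℝ g y (1, 0)) z (0, 1) =
    fderiv ℝ (fun y => fderiv ℝ g y (0, 1)) z (1, 0)
  rw [h1, h1]
  exact hsymm.eq _ _

lemma partials_eq_zero_of_eventuallyEq_const {g : ℝ × ℝ → ℝ} {z : ℝ × ℝ} {c : ℝ}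
    (h : ∀ᶠ y in 𝓝 z, g y = c) : partialFst g =ᶠ[𝓝 z] 0 ∧ partialSnd g =ᶠ[𝓝 z] 0 := by
  constructor
  all_goals
    filter_upwards [h.eventually_nhds] with y hy
    have : g =ᶠ[𝓝 y] fun _ => c := hy
    simp [partialFst, partialSnd, this.fderiv_eq]

lemma hasDerivAt_im {f : ℝ → ℂ} {f' : ℂ} {x : ℝ} (h : HasDerivAt f f' x) :
    HasDerivAt (fun x => (f x).im) f'.im x := Complex.imCLM.hasFDerivAt.comp_hasDerivAt x h

lemma green {X Y : ℝ × ℝ → ℝ} (hX : ∀ z ∈ box, ContDiffAt ℝ 1 X z)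
    (hY : ∀ z ∈ box, ContDiffAt ℝ 1 Y z) :
    ∫ z in box, (partialFst X z - partialSnd Y z) =
      (∫ u in (0 : ℝ)..(2 * π), X (2 * π, u)) - (∫ u in (0 : ℝ)..(2 * π), X (0, u)) -
      ((∫ a in (0 : ℝ)..(2 * π), Y (a, 2 * π)) - ∫ a in (0 : ℝ)..(2 * π), Y (a, 0)) := by
  have hpi := Real.two_pi_pos
  have hsub : Ioo (0 : ℝ) (2 * π) ×ˢ Ioo (0 : ℝ) (2 * π) ⊆ box := by
    rintro z ⟨h1, h2⟩
    exact mem_box.2 ⟨⟨h1.1.le, h1.2.le⟩, h2.1.le, h2.2.le⟩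
  have hcont : ∀ {X : ℝ × ℝ → ℝ} (v : ℝ × ℝ), (∀ z ∈ box, ContDiffAt ℝ 1 X z) →
      ContinuousOn (fun z => fderiv ℝ X z v) box := fun v h z hz =>
    ((h z hz).fderiv_right (m := 0) (by simp)).continuousAt.clm_apply continuousAt_const
      |>.continuousWithinAt
  have := integral_divergence_prod_Icc_of_hasFDerivAt_of_le X (fun z => -Y z) (fderiv ℝ X)
    (fun z => -fderiv ℝ Y z) (0, 0) (2 * π, 2 * π) ⟨hpi.le, hpi.le⟩
    (fun z hz => (hX z hz).continuousAt.continuousWithinAt)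
    (fun z hz => (hY z hz).continuousAt.neg.continuousWithinAt)
    (fun z hz => ((hX z (hsub hz)).differentiableAt (by simp)).hasFDerivAt)
    (fun z hz => ((hY z (hsub hz)).differentiableAt (by simp)).hasFDerivAt.neg) ?_
  · simp only [neg_apply, ← sub_eq_add_neg, intervalIntegral.integral_neg]
      at this
    rw [box]
    simp only [partialFst, partialSnd]
    rw [this]
    ring
  · simp only [neg_apply, ← sub_eq_add_neg]
    exact ((hcont _ hX).sub (hcont _ hY)).integrableOn_compact isCompact_box

/-- Green's formula for the form `dg ∧ dα = -d(α dg)`, where `α` need not be defined where `g` is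
locally constant. -/
lemma integral_wedge {g α : ℝ × ℝ → ℝ} (hg : ContDiff ℝ ∞ g)
    (h : ∀ z ∈ box, (∀ᶠ y in 𝓝 z, g y = g z) ∨ ContDiffAt ℝ 1 α z) :
    ContinuousOn (fun z => partialFst g z * partialSnd α z - partialSnd g z * partialFst α z) box ∧
    ∫ z in box, (partialFst g z * partialSnd α z - partialSnd g z * partialFst α z) =
      (∫ a in (0 : ℝ)..(2 * π), α (a, 2 * π) * partialFst g (a, 2 * π)) -
      (∫ a in (0 : ℝ)..(2 * π), α (a, 0) * partialFst g (a, 0)) -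
      ((∫ u in (0 : ℝ)..(2 * π), α (2 * π, u) * partialSnd g (2 * π, u)) -
        ∫ u in (0 : ℝ)..(2 * π), α (0, u) * partialSnd g (0, u)) := by
  have hX : ∀ z ∈ box, ContDiffAt ℝ 1 (fun z => α z * partialSnd g z) z := by
    intro z hz
    rcases h z hz with h | h
    · refine contDiffAt_const.congr_of_eventuallyEq (f := fun _ => (0 : ℝ)) ?_
      filter_upwards [(partials_eq_zero_of_eventuallyEq_const h).2] with y hy
      rw [hy, Pi.zero_apply, mul_zero]
    · exact h.mul ((contDiff_partialSnd hg).contDiffAt.of_le (by norm_cast))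
  have hY : ∀ z ∈ box, ContDiffAt ℝ 1 (fun z => α z * partialFst g z) z := by
    intro z hz
    rcases h z hz with h | h
    · refine contDiffAt_const.congr_of_eventuallyEq (f := fun _ => (0 : ℝ)) ?_
      filter_upwards [(partials_eq_zero_of_eventuallyEq_const h).1] with y hy
      rw [hy, Pi.zero_apply, mul_zero]
    · exact h.mul ((contDiff_partialFst hg).contDiffAt.of_le (by norm_cast))
  have heq : ∀ z ∈ box, partialFst g z * partialSnd α z - partialSnd g z * partialFst α z =
      -(partialFst (fun z => α z * partialSnd g z) z -
        partialSnd (fun z => α z * partialFst g z) z) := by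
    intro z hz
    rcases h z hz with h | h
    · obtain ⟨h1, h2⟩ := partials_eq_zero_of_eventuallyEq_const h
      have e1 : (fun z => α z * partialSnd g z) =ᶠ[𝓝 z] fun _ => (0 : ℝ) := by
        filter_upwards [h2] with y hy; rw [hy, Pi.zero_apply, mul_zero]
      have e2 : (fun z => α z * partialFst g z) =ᶠ[𝓝 z] fun _ => (0 : ℝ) := by
        filter_upwards [h1] with y hy; rw [hy, Pi.zero_apply, mul_zero]
      have z1 : partialFst (fun z => α z * partialSnd g z) z = 0 := by
        rw [partialFst, e1.fderiv_eq]; simp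
      have z2 : partialSnd (fun z => α z * partialFst g z) z = 0 := by
        rw [partialSnd, e2.fderiv_eq]; simp
      rw [h1.eq_of_nhds, h2.eq_of_nhds, z1, z2]
      simp
    · have hα := h.differentiableAt (by simp)
      have d1 := (contDiff_partialFst hg).differentiable (by simp) z
      have d2 := (contDiff_partialSnd hg).differentiable (by simp) z
      rw [partialFst_eq (X := fun z => α z * partialSnd g z) (hα.mul d2)
          ((hasDerivAt_partialFst hα).mul (hasDerivAt_partialFst d2)),
        partialSnd_eq (X := fun z => α z * partialFst g z) (hα.mul d1)
          ((hasDerivAt_partialSnd hα).mul (hasDerivAt_partialSnd d1)),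
        partialSnd_partialFst hg]
      ring
  constructor
  · refine ContinuousOn.congr ?_ heq
    refine ContinuousOn.neg (ContinuousOn.sub ?_ ?_)
    · exact fun z hz => (((hX z hz).fderiv_right (m := 0) (by simp)).continuousAt.clm_apply
        continuousAt_const).continuousWithinAt
    · exact fun z hz => (((hY z hz).fderiv_right (m := 0) (by simp)).continuousAt.clm_apply
        continuousAt_const).continuousWithinAt
  · rw [setIntegral_congr_fun measurableSet_box heq, integral_neg, green hX hY]
    ring

/-! ### Counting double points with weights -/

/-- The pairs of parameters `(a, u)`, `a < u < a + 2π`, of different points of the circle. -/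
def pairRegion : Set (ℝ × ℝ) := {z | z.1 < z.2 ∧ z.2 < z.1 + 2 * π}

lemma isOpen_pairRegion : IsOpen pairRegion :=
  (isOpen_lt continuous_fst continuous_snd).inter
    (isOpen_lt continuous_snd (continuous_fst.add continuous_const))

/-- A smooth weight on the pairs of parameters, supported away from the diagonal. -/
structure IsWeight (g : ℝ × ℝ → ℝ) : Prop where
  contDiff : ContDiff ℝ ∞ g
  tsupport_subset : tsupport g ⊆ pairRegion

lemma IsWeight.eventually_eq_zero {g : ℝ × ℝ → ℝ} (hg : IsWeight g) {z : ℝ × ℝ}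
    (hz : z ∉ pairRegion) : ∀ᶠ y in 𝓝 z, g y = 0 :=
  notMem_tsupport_iff_eventuallyEq.1 fun h => hz (hg.tsupport_subset h)

lemma IsWeight.eq_zero {g : ℝ × ℝ → ℝ} (hg : IsWeight g) {z : ℝ × ℝ}
    (hz : z ∉ pairRegion) : g z = 0 := (hg.eventually_eq_zero hz).self_of_nhds

lemma IsWeight.partials_eq_zero {g : ℝ × ℝ → ℝ} (hg : IsWeight g) {z : ℝ × ℝ}
    (hz : z ∉ pairRegion) : partialFst g z = 0 ∧ partialSnd g z = 0 := by
  have := partials_eq_zero_of_eventuallyEq_const (hg.eventually_eq_zero hz)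
  exact ⟨this.1.eq_of_nhds, this.2.eq_of_nhds⟩

lemma IsWeight.add {g h : ℝ × ℝ → ℝ} (hg : IsWeight g) (hh : IsWeight h) :
    IsWeight (fun z => g z + h z) where
  contDiff := hg.contDiff.add hh.contDiff
  tsupport_subset := (tsupport_add g h).trans (union_subset hg.tsupport_subset hh.tsupport_subset)

lemma IsWeight.const_mul {g : ℝ × ℝ → ℝ} (hg : IsWeight g) (c : ℝ) :
    IsWeight (fun z => c * g z) where
  contDiff := contDiff_const.mul hg.contDiff
  tsupport_subset := (tsupport_mul_subset_right (f := fun _ => c) (g := g)).trans hg.tsupport_subset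

/-- The weight is constant near each double point. -/
def IsFlat (φ : ImmersedCurve) (g : ℝ × ℝ → ℝ) : Prop :=
  ∀ z ∈ box, z ∈ pairRegion → φ z.1 = φ z.2 → ∀ᶠ y in 𝓝 z, g y = g z

lemma IsFlat.eventually_eq {φ : ImmersedCurve} {g : ℝ × ℝ → ℝ} (h : IsFlat φ g) (hg : IsWeight g)
    {z : ℝ × ℝ} (hz : z ∈ box) (hφ : φ z.1 = φ z.2) : ∀ᶠ y in 𝓝 z, g y = g z := by
  by_cases hr : z ∈ pairRegion
  · exact h z hz hr hφ
  · rw [hg.eq_zero hr]; exact hg.eventually_eq_zero hr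

lemma IsFlat.add {φ : ImmersedCurve} {g h : ℝ × ℝ → ℝ} (hg : IsFlat φ g) (hh : IsFlat φ h) :
    IsFlat φ (fun z => g z + h z) := by
  intro z hz hr hφ
  filter_upwards [hg z hz hr hφ, hh z hz hr hφ] with y h1 h2
  rw [h1, h2]

lemma IsFlat.const_mul {φ : ImmersedCurve} {g : ℝ × ℝ → ℝ} (hg : IsFlat φ g) (c : ℝ) :
    IsFlat φ (fun z => c * g z) := by
  intro z hz hr hφ
  filter_upwards [hg z hz hr hφ] with y h1
  rw [h1]

namespace ImmersedCurve

/-- The form `dg ∧ dθ`, where `θ` is the direction of the chord from `φ u` to `φ a`. -/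
def wedgeAngle (φ : ImmersedCurve) (g : ℝ × ℝ → ℝ) (z : ℝ × ℝ) : ℝ :=
  partialFst g z * φ.angularSpeed (φ z.1) z.2 - partialSnd g z * φ.angularSpeed (φ z.2) z.1

/-- The double points of `φ` counted with their signs and with the weight `g`, which has to be
locally constant near the double points: as the direction `θ` of the chord winds once around each
double point, this is the integral of `-dg ∧ dθ / 2π` over the triangle `0 < a < u < 2π`, with a
boundary term.  The formula makes sense for arbitrarily degenerate double points. -/
def weightedCount (φ : ImmersedCurve) (g : ℝ × ℝ → ℝ) : ℝ :=
  -(2 * π)⁻¹ * ((∫ z in box, φ.wedgeAngle g z) +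
    ∫ u in (0 : ℝ)..(2 * π), (g (0, u) + g (u, 2 * π)) * φ.angularSpeed (φ 0) u)

variable {φ : ImmersedCurve}

lemma contDiffAt_angularSpeed_fst {z : ℝ × ℝ} (h : φ z.1 ≠ φ z.2) :
    ContDiffAt ℝ ∞ (fun z : ℝ × ℝ => φ.angularSpeed (φ z.1) z.2) z := by
  have h' : φ z.2 - φ z.1 ≠ 0 := sub_ne_zero.2 h.symm
  have h1 : ContDiffAt ℝ ∞ (fun z : ℝ × ℝ => φ z.2 - φ z.1) z :=
    ((φ.smooth.comp contDiff_snd).sub (φ.smooth.comp contDiff_fst)).contDiffAt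
  have h2 : ContDiffAt ℝ ∞ (fun z : ℝ × ℝ => deriv φ z.2) z :=
    (φ.contDiff_deriv.comp contDiff_snd).contDiffAt
  exact Complex.imCLM.contDiff.contDiffAt.comp z (h2.mul (h1.inv h'))

lemma contDiffAt_angularSpeed_snd {z : ℝ × ℝ} (h : φ z.1 ≠ φ z.2) :
    ContDiffAt ℝ ∞ (fun z : ℝ × ℝ => φ.angularSpeed (φ z.2) z.1) z := by
  have h' : φ z.1 - φ z.2 ≠ 0 := sub_ne_zero.2 h
  have h1 : ContDiffAt ℝ ∞ (fun z : ℝ × ℝ => φ z.1 - φ z.2) z :=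
    ((φ.smooth.comp contDiff_fst).sub (φ.smooth.comp contDiff_snd)).contDiffAt
  have h2 : ContDiffAt ℝ ∞ (fun z : ℝ × ℝ => deriv φ z.1) z :=
    (φ.contDiff_deriv.comp contDiff_fst).contDiffAt
  exact Complex.imCLM.contDiff.contDiffAt.comp z (h2.mul (h1.inv h'))

/-- The angle form is closed. -/
lemma partialFst_angularSpeed_eq {z : ℝ × ℝ} (h : φ z.1 ≠ φ z.2) :
    partialFst (fun z : ℝ × ℝ => φ.angularSpeed (φ z.1) z.2) z =
      partialSnd (fun z : ℝ × ℝ => φ.angularSpeed (φ z.2) z.1) z := by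
  have h1 : φ z.2 - φ z.1 ≠ 0 := sub_ne_zero.2 h.symm
  have h2 : φ z.1 - φ z.2 ≠ 0 := sub_ne_zero.2 h
  have d1 : HasDerivAt (fun a => φ.angularSpeed (φ a) z.2)
      (deriv φ z.2 * deriv φ z.1 / (φ z.2 - φ z.1) ^ 2).im z.1 := by
    refine hasDerivAt_im (f := fun a => deriv φ z.2 / (φ z.2 - φ a)) ?_
    refine ((hasDerivAt_const z.1 (deriv φ z.2)).div
      ((φ.hasDerivAt z.1).const_sub (φ z.2)) h1).congr_deriv ?_
    simp
  have d2 : HasDerivAt (fun u => φ.angularSpeed (φ u) z.1)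
      (deriv φ z.1 * deriv φ z.2 / (φ z.1 - φ z.2) ^ 2).im z.2 := by
    refine hasDerivAt_im (f := fun u => deriv φ z.1 / (φ z.1 - φ u)) ?_
    refine ((hasDerivAt_const z.2 (deriv φ z.1)).div
      ((φ.hasDerivAt z.2).const_sub (φ z.1)) h2).congr_deriv ?_
    simp
  rw [partialFst_eq ((contDiffAt_angularSpeed_fst h).differentiableAt (by simp)) d1,
    partialSnd_eq ((contDiffAt_angularSpeed_snd h).differentiableAt (by simp)) d2]
  congr 1
  rw [mul_comm, ← neg_sub, neg_sq]

lemma continuousOn_wedgeAngle {g : ℝ × ℝ → ℝ} (hg : IsWeight g) (hf : IsFlat φ g) :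
    ContinuousOn (φ.wedgeAngle g) box := by
  intro z hz
  refine ContinuousAt.continuousWithinAt ?_
  by_cases h : φ z.1 = φ z.2
  · obtain ⟨h1, h2⟩ := partials_eq_zero_of_eventuallyEq_const (hf.eventually_eq hg hz h)
    refine continuousAt_const.congr (f := fun _ => (0 : ℝ)) ?_
    filter_upwards [h1, h2] with y h1 h2
    simp [wedgeAngle, h1, h2]
  · exact ((contDiff_partialFst hg.contDiff).continuous.continuousAt.mul
      (contDiffAt_angularSpeed_fst h).continuousAt).sub
      ((contDiff_partialSnd hg.contDiff).continuous.continuousAt.mul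
      (contDiffAt_angularSpeed_snd h).continuousAt)

lemma integrableOn_wedgeAngle {g : ℝ × ℝ → ℝ} (hg : IsWeight g) (hf : IsFlat φ g) :
    IntegrableOn (φ.wedgeAngle g) box :=
  (continuousOn_wedgeAngle hg hf).integrableOn_compact isCompact_box

lemma intervalIntegrable_edge (φ : ImmersedCurve) {g : ℝ × ℝ → ℝ} (hg : IsWeight g) :
    IntervalIntegrable (fun u => (g (0, u) + g (u, 2 * π)) * φ.angularSpeed (φ 0) u) volume
      0 (2 * π) := by
  refine (φ.intervalIntegrable_angularSpeed (φ 0) 0 (2 * π)).continuousOn_mul ?_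
  have := hg.contDiff.continuous
  fun_prop

lemma weightedCount_add {g h : ℝ × ℝ → ℝ} (hg : IsWeight g) (hh : IsWeight h) (hgf : IsFlat φ g)
    (hhf : IsFlat φ h) :
    φ.weightedCount (fun z => g z + h z) = φ.weightedCount g + φ.weightedCount h := by
  have e1 : ∀ z, φ.wedgeAngle (fun z => g z + h z) z = φ.wedgeAngle g z + φ.wedgeAngle h z := by
    intro z
    have d1 := hg.contDiff.differentiable (by simp) z
    have d2 := hh.contDiff.differentiable (by simp) z
    simp only [wedgeAngle, partialFst, partialSnd]
    rw [fderiv_fun_add d1 d2]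
    simp only [add_apply]
    ring
  have e2 : ∀ u : ℝ, (g (0, u) + h (0, u) + (g (u, 2 * π) + h (u, 2 * π))) *
      φ.angularSpeed (φ 0) u = (g (0, u) + g (u, 2 * π)) * φ.angularSpeed (φ 0) u +
      (h (0, u) + h (u, 2 * π)) * φ.angularSpeed (φ 0) u := fun u => by ring
  simp only [weightedCount, e1, e2]
  rw [integral_add (integrableOn_wedgeAngle hg hgf) (integrableOn_wedgeAngle hh hhf),
    intervalIntegral.integral_add (φ.intervalIntegrable_edge hg) (φ.intervalIntegrable_edge hh)]
  ring

lemma weightedCount_const_mul {g : ℝ × ℝ → ℝ} (hg : IsWeight g) (c : ℝ) :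
    φ.weightedCount (fun z => c * g z) = c * φ.weightedCount g := by
  have e1 : ∀ z, φ.wedgeAngle (fun z => c * g z) z = c * φ.wedgeAngle g z := by
    intro z
    have d1 := hg.contDiff.differentiable (by simp) z
    simp only [wedgeAngle, partialFst, partialSnd]
    rw [fderiv_const_mul d1]
    simp only [smul_apply, smul_eq_mul]
    ring
  have e2 : ∀ u : ℝ, (c * g (0, u) + c * g (u, 2 * π)) * φ.angularSpeed (φ 0) u =
      c * ((g (0, u) + g (u, 2 * π)) * φ.angularSpeed (φ 0) u) := fun u => by ring
  simp only [weightedCount, e1, e2, integral_const_mul, intervalIntegral.integral_const_mul]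
  ring

lemma weightedCount_sum {ι : Type*} (S : Finset ι) {g : ι → ℝ × ℝ → ℝ}
    (hg : ∀ i ∈ S, IsWeight (g i)) (hf : ∀ i ∈ S, IsFlat φ (g i)) :
    IsWeight (fun z => ∑ i ∈ S, g i z) ∧ IsFlat φ (fun z => ∑ i ∈ S, g i z) ∧
      φ.weightedCount (fun z => ∑ i ∈ S, g i z) = ∑ i ∈ S, φ.weightedCount (g i) := by
  classical
  induction S using Finset.induction_on with
  | empty =>
    simp only [Finset.sum_empty]
    refine ⟨⟨contDiff_const, ?_⟩, fun z _ _ _ => by simp, ?_⟩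
    · have : tsupport (fun _ : ℝ × ℝ => (0 : ℝ)) = ∅ := by
        rw [tsupport_eq_empty_iff]; rfl
      simp [this]
    · simp [weightedCount, wedgeAngle, partialFst, partialSnd]
  | insert a T ha ih =>
    obtain ⟨h1, h2, h3⟩ := ih (fun i hi => hg i (Finset.mem_insert_of_mem hi))
      (fun i hi => hf i (Finset.mem_insert_of_mem hi))
    have ha1 := hg a (Finset.mem_insert_self _ _)
    have ha2 := hf a (Finset.mem_insert_self _ _)
    simp only [Finset.sum_insert ha]
    exact ⟨ha1.add h1, ha2.add h2, by rw [weightedCount_add ha1 h1 ha2 h2, h3]⟩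

/-- A weight that vanishes near the double points counts nothing. -/
lemma weightedCount_eq_zero {g : ℝ × ℝ → ℝ} (hg : IsWeight g)
    (h : ∀ z ∈ box, z ∈ pairRegion → φ z.1 = φ z.2 → ∀ᶠ y in 𝓝 z, g y = 0) :
    φ.weightedCount g = 0 := by
  have h' : ∀ z ∈ box, φ z.1 = φ z.2 → ∀ᶠ y in 𝓝 z, g y = 0 := fun z hz hφ => by
    by_cases hr : z ∈ pairRegion
    · exact h z hz hr hφ
    · exact hg.eventually_eq_zero hr
  set X : ℝ × ℝ → ℝ := fun z => g z * φ.angularSpeed (φ z.1) z.2 with hXdef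
  set Y : ℝ × ℝ → ℝ := fun z => g z * φ.angularSpeed (φ z.2) z.1 with hYdef
  have zX : ∀ z ∈ box, φ z.1 = φ z.2 → X =ᶠ[𝓝 z] fun _ => (0 : ℝ) := fun z hz hφ => by
    filter_upwards [h' z hz hφ] with y hy; rw [hXdef]; simp [hy]
  have zY : ∀ z ∈ box, φ z.1 = φ z.2 → Y =ᶠ[𝓝 z] fun _ => (0 : ℝ) := fun z hz hφ => by
    filter_upwards [h' z hz hφ] with y hy; rw [hYdef]; simp [hy]
  have hX : ∀ z ∈ box, ContDiffAt ℝ 1 X z := by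
    intro z hz
    by_cases hφ : φ z.1 = φ z.2
    · exact contDiffAt_const.congr_of_eventuallyEq (zX z hz hφ)
    · exact (hg.contDiff.contDiffAt.mul (contDiffAt_angularSpeed_fst hφ)).of_le (by norm_cast)
  have hY : ∀ z ∈ box, ContDiffAt ℝ 1 Y z := by
    intro z hz
    by_cases hφ : φ z.1 = φ z.2
    · exact contDiffAt_const.congr_of_eventuallyEq (zY z hz hφ)
    · exact (hg.contDiff.contDiffAt.mul (contDiffAt_angularSpeed_snd hφ)).of_le (by norm_cast)
  have heq : ∀ z ∈ box, φ.wedgeAngle g z = partialFst X z - partialSnd Y z := by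
    intro z hz
    by_cases hφ : φ z.1 = φ z.2
    · obtain ⟨h1, h2⟩ := partials_eq_zero_of_eventuallyEq_const (h' z hz hφ)
      rw [wedgeAngle, h1.eq_of_nhds, h2.eq_of_nhds, partialFst, partialSnd, (zX z hz hφ).fderiv_eq,
        (zY z hz hφ).fderiv_eq]
      simp
    · have d := hg.contDiff.differentiable (by simp) z
      have d1 := (contDiffAt_angularSpeed_fst hφ).differentiableAt (by simp)
      have d2 := (contDiffAt_angularSpeed_snd hφ).differentiableAt (by simp)
      rw [partialFst_eq (X := X) (d.mul d1)
          ((hasDerivAt_partialFst d).mul (hasDerivAt_partialFst d1)),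
        partialSnd_eq (X := Y) (d.mul d2)
          ((hasDerivAt_partialSnd d).mul (hasDerivAt_partialSnd d2)),
        partialFst_angularSpeed_eq hφ, wedgeAngle]
      ring
  have hpi := Real.two_pi_pos
  have b1 : ∫ u in (0 : ℝ)..(2 * π), X (2 * π, u) = 0 := by
    refine intervalIntegral.integral_zero_ae (ae_of_all _ fun u hu => ?_)
    rw [uIoc_of_le hpi.le] at hu
    rw [hXdef]
    simp only
    rw [hg.eq_zero (fun h => absurd h.1 (not_lt.2 hu.2)), zero_mul]
  have b2 : ∫ a in (0 : ℝ)..(2 * π), Y (a, 0) = 0 := by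
    refine intervalIntegral.integral_zero_ae (ae_of_all _ fun u hu => ?_)
    rw [uIoc_of_le hpi.le] at hu
    rw [hYdef]
    simp only
    rw [hg.eq_zero (fun h => absurd h.1 (not_lt.2 hu.1.le)), zero_mul]
  have hper : φ (2 * π) = φ 0 := by simpa using φ.periodic 0
  have c : Continuous g := hg.contDiff.continuous
  have i1 : IntervalIntegrable (fun u => g (0, u) * φ.angularSpeed (φ 0) u) volume 0 (2 * π) :=
    (φ.intervalIntegrable_angularSpeed (φ 0) 0 (2 * π)).continuousOn_mul (by fun_prop)
  have i2 : IntervalIntegrable (fun u => g (u, 2 * π) * φ.angularSpeed (φ 0) u) volume 0 (2 * π) :=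
    (φ.intervalIntegrable_angularSpeed (φ 0) 0 (2 * π)).continuousOn_mul (by fun_prop)
  rw [weightedCount, setIntegral_congr_fun measurableSet_box heq, green hX hY, b1, b2]
  simp only [hXdef, hYdef, hper, add_mul]
  rw [intervalIntegral.integral_add i1 i2]
  ring

end ImmersedCurve

/-! ### The weighted count along converging curves -/

lemma re_div_pos_of_norm_sub_lt {N D : ℂ} (h : ‖N - D‖ < ‖D‖) : 0 < (N / D).re := by
  have hD : 0 < ‖D‖ := (norm_nonneg _).trans_lt h
  have hD1 : D ≠ 0 := norm_pos_iff.1 hD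
  have : N / D = 1 + (N - D) / D := by field_simp; ring
  rw [this, Complex.add_re, Complex.one_re]
  have h4 : ‖(N - D) / D‖ < 1 := by rwa [norm_div, div_lt_one hD]
  linarith [(abs_lt.1 ((Complex.abs_re_le_norm _).trans_lt h4)).1]

section

variable {ι : Type*} {Ψ : ι → ImmersedCurve} {l : Filter ι} {φ : ImmersedCurve}

/-- Short chords of curves that are `C¹`-close have almost the same direction. -/
lemma C1Tendsto.eventually_chord (h : C1Tendsto Ψ l φ) (s : ℝ) :
    ∀ᶠ w : ι × ℝ × ℝ in l ×ˢ 𝓝 (s, s), w.2.1 ≠ w.2.2 →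
      0 < ((Ψ w.1 w.2.1 - Ψ w.1 w.2.2) / (φ w.2.1 - φ w.2.2)).re := by
  set e := deriv φ s with he
  have hne : 0 < ‖e‖ := norm_pos_iff.2 (φ.immersion s)
  have h1 : ∀ᶠ p : ℝ × ℝ in 𝓝 (s, s),
      ‖φ p.1 - φ p.2 - (p.1 - p.2) • e‖ ≤ ‖e‖ / 4 * ‖p.1 - p.2‖ := by
    have hs : HasStrictDerivAt φ e s :=
      φ.smooth.contDiffAt.hasStrictDerivAt (by simp)
    exact hs.isLittleO.def (by positivity)
  have h2 : ∀ᶠ i in l, ∀ x, ‖deriv (Ψ i) x - deriv φ x‖ ≤ ‖e‖ / 4 := by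
    filter_upwards [Metric.tendstoUniformly_iff.1 h.snd (‖e‖ / 4) (by positivity)] with i hi x
    rw [← dist_eq_norm, dist_comm]; exact (hi x).le
  filter_upwards [h2.prod_mk h1] with ⟨i, p⟩ ⟨hi, hp⟩ hne'
  simp only at hi hp hne' ⊢
  set D := φ p.1 - φ p.2
  set Δ := Ψ i p.1 - Ψ i p.2
  have hpp : 0 < ‖p.1 - p.2‖ := norm_pos_iff.2 (sub_ne_zero.2 hne')
  have hΔ : ‖Δ - D‖ ≤ ‖e‖ / 4 * ‖p.1 - p.2‖ := by
    have := convex_univ.norm_image_sub_le_of_norm_hasDerivWithin_le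
      (f := fun x => Ψ i x - φ x) (f' := fun x => deriv (Ψ i) x - deriv φ x) (C := ‖e‖ / 4)
      (fun x _ => (((Ψ i).hasDerivAt x).sub (φ.hasDerivAt x)).hasDerivWithinAt)
      (fun x _ => hi x) (mem_univ p.2) (mem_univ p.1)
    calc ‖Δ - D‖ = ‖Ψ i p.1 - φ p.1 - (Ψ i p.2 - φ p.2)‖ := by
          congr 1; simp only [Δ, D]; ring
      _ ≤ _ := this
  have hD : 3 / 4 * ‖e‖ * ‖p.1 - p.2‖ ≤ ‖D‖ := by
    have h3 : ‖(p.1 - p.2) • e‖ ≤ ‖D‖ + ‖D - (p.1 - p.2) • e‖ := by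
      have := norm_sub_le D (D - (p.1 - p.2) • e)
      simpa using this
    rw [norm_smul] at h3
    nlinarith
  refine re_div_pos_of_norm_sub_lt (hΔ.trans_lt ?_)
  nlinarith [mul_pos hne hpp]

lemma C1Tendsto.eventually_chord_of_ne (h : C1Tendsto Ψ l φ) {z : ℝ × ℝ} (hz : φ z.1 ≠ φ z.2) :
    ∀ᶠ w : ι × ℝ × ℝ in l ×ˢ 𝓝 z,
      0 < ((Ψ w.1 w.2.1 - Ψ w.1 w.2.2) / (φ w.2.1 - φ w.2.2)).re := by
  have h1 : Tendsto (fun w : ι × ℝ × ℝ => w.2) (l ×ˢ 𝓝 z) (𝓝 z) := tendsto_snd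
  have hx : Tendsto (fun w : ι × ℝ × ℝ => w.2.1) (l ×ˢ 𝓝 z) (𝓝 z.1) :=
    (continuous_fst.tendsto z).comp h1
  have hy : Tendsto (fun w : ι × ℝ × ℝ => w.2.2) (l ×ˢ 𝓝 z) (𝓝 z.2) :=
    (continuous_snd.tendsto z).comp h1
  have hc : C1Tendsto (fun w : ι × ℝ × ℝ => Ψ w.1) (l ×ˢ 𝓝 z) φ := h.comp tendsto_fst
  have := ((hc.tendsto hx).sub (hc.tendsto hy)).div
    (((φ.continuous.tendsto _).comp hx).sub ((φ.continuous.tendsto _).comp hy)) (sub_ne_zero.2 hz)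
  have hre := (Complex.continuous_re.tendsto _).comp this
  rw [div_self (sub_ne_zero.2 hz)] at hre
  exact hre.eventually (lt_mem_nhds (by simp))

end

lemma hasDerivAt_arg_div {N D : ℝ → ℂ} {N' D' : ℂ} {x : ℝ} (hN : HasDerivAt N N' x)
    (hD : HasDerivAt D D' x) (h : 0 < (N x / D x).re) :
    HasDerivAt (fun y => (N y / D y).arg) ((N' / N x).im - (D' / D x).im) x := by
  have hND : N x / D x ≠ 0 := by intro h0; rw [h0] at h; simp at h
  have hN0 : N x ≠ 0 := fun h0 => hND (by rw [h0, zero_div])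
  have hD0 : D x ≠ 0 := fun h0 => hND (by rw [h0, div_zero])
  have := hasDerivAt_arg_const_mul (c := 1) (hN.div hD hD0)
    (by rw [one_mul]; exact Or.inl h)
  simp only [Pi.div_apply, one_mul] at this
  refine this.congr_deriv ?_
  rw [← Complex.sub_im]
  congr 1
  field_simp

namespace ImmersedCurve

/-- The angle from the chord of `φ` to the chord of `ψ` with the same parameters. -/
def chordAngle (φ ψ : ImmersedCurve) (z : ℝ × ℝ) : ℝ :=
  ((ψ z.1 - ψ z.2) / (φ z.1 - φ z.2)).arg

variable {φ ψ : ImmersedCurve}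

lemma ne_of_chord_re_pos {x y : ℝ} (h : 0 < ((ψ x - ψ y) / (φ x - φ y)).re) :
    φ x ≠ φ y ∧ ψ x ≠ ψ y := by
  constructor
  all_goals
    intro h0
    rw [h0, sub_self] at h
    simp at h

lemma contDiffAt_chordAngle {z : ℝ × ℝ} (h : 0 < ((ψ z.1 - ψ z.2) / (φ z.1 - φ z.2)).re) :
    ContDiffAt ℝ 1 (chordAngle φ ψ) z := by
  have h0 := sub_ne_zero.2 (ne_of_chord_re_pos h).1
  have h1 : ∀ χ : ImmersedCurve, ContDiffAt ℝ 1 (fun z : ℝ × ℝ => χ z.1 - χ z.2) z := fun χ =>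
    (((χ.smooth.comp contDiff_fst).sub (χ.smooth.comp contDiff_snd)).contDiffAt).of_le
      (by norm_cast)
  have h2 : ContDiffAt ℝ 1 (fun z : ℝ × ℝ => (ψ z.1 - ψ z.2) / (φ z.1 - φ z.2)) z := by
    simp only [div_eq_mul_inv]
    exact (h1 ψ).mul ((h1 φ).inv h0)
  have h3 : ContDiffAt ℝ 1 Complex.log ((ψ z.1 - ψ z.2) / (φ z.1 - φ z.2)) :=
    (Complex.contDiffAt_log (Or.inl h)).restrict_scalars ℝ
  have h4 := Complex.imCLM.contDiff.contDiffAt.comp z (h3.comp z h2)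
  refine h4.congr_of_eventuallyEq (Eventually.of_forall fun z => ?_)
  exact (Complex.log_im _).symm

lemma measurable_chordAngle (φ ψ : ImmersedCurve) : Measurable (chordAngle φ ψ) := by
  have h1 : ∀ χ : ImmersedCurve, Measurable (fun z : ℝ × ℝ => χ z.1 - χ z.2) := fun χ =>
    ((χ.continuous.comp continuous_fst).sub (χ.continuous.comp continuous_snd)).measurable
  exact Complex.measurable_arg.comp ((h1 ψ).div (h1 φ))

lemma hasDerivAt_chordAngle_fst {z : ℝ × ℝ} (h : 0 < ((ψ z.1 - ψ z.2) / (φ z.1 - φ z.2)).re) :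
    HasDerivAt (fun a => chordAngle φ ψ (a, z.2))
      (ψ.angularSpeed (ψ z.2) z.1 - φ.angularSpeed (φ z.2) z.1) z.1 :=
  hasDerivAt_arg_div ((ψ.hasDerivAt z.1).sub_const (ψ z.2)) ((φ.hasDerivAt z.1).sub_const (φ z.2)) h

lemma chordAngle_swap (φ ψ : ImmersedCurve) (x y : ℝ) :
    chordAngle φ ψ (x, y) = chordAngle φ ψ (y, x) := by
  simp only [chordAngle]
  rw [← neg_sub (ψ y), ← neg_sub (φ y), neg_div_neg_eq]

lemma hasDerivAt_chordAngle_snd {z : ℝ × ℝ} (h : 0 < ((ψ z.1 - ψ z.2) / (φ z.1 - φ z.2)).re) :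
    HasDerivAt (fun u => chordAngle φ ψ (z.1, u))
      (ψ.angularSpeed (ψ z.1) z.2 - φ.angularSpeed (φ z.1) z.2) z.2 := by
  have h' : 0 < ((ψ z.2 - ψ z.1) / (φ z.2 - φ z.1)).re := by
    rwa [← neg_sub (ψ z.1), ← neg_sub (φ z.1), neg_div_neg_eq]
  have := hasDerivAt_chordAngle_fst (z := (z.2, z.1)) h'
  refine this.congr_of_eventuallyEq (Eventually.of_forall fun u => ?_)
  exact chordAngle_swap φ ψ _ _

lemma intervalIntegrable_mul_chordAngle (φ ψ : ImmersedCurve) {k : ℝ → ℝ} (hk : Continuous k)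
    {p : ℝ → ℝ × ℝ} (hp : Continuous p) (a b : ℝ) :
    IntervalIntegrable (fun u => chordAngle φ ψ (p u) * k u) volume a b := by
  have hm : Measurable fun u => chordAngle φ ψ (p u) :=
    (measurable_chordAngle φ ψ).comp hp.measurable
  have : IntervalIntegrable (fun u => chordAngle φ ψ (p u)) volume a b := by
    refine (intervalIntegrable_const (c := π)).mono_fun hm.aestronglyMeasurable ?_
    refine Eventually.of_forall fun u => ?_
    simp only [Real.norm_eq_abs]
    rw [abs_of_pos Real.pi_pos]
    exact Complex.abs_arg_le_pi _
  exact this.mul_continuousOn hk.continuousOn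

lemma tendsto_chord_div (φ ψ : ImmersedCurve) (x : ℝ) :
    Tendsto (fun u => (ψ u - ψ x) / (φ u - φ x)) (𝓝[≠] x) (𝓝 (deriv ψ x / deriv φ x)) := by
  have h1 := hasDerivAt_iff_tendsto_slope.1 (ψ.hasDerivAt x)
  have h2 := hasDerivAt_iff_tendsto_slope.1 (φ.hasDerivAt x)
  refine (h1.div h2 (φ.immersion x)).congr' ?_
  filter_upwards [self_mem_nhdsWithin] with u hu
  have hu' : ((u - x : ℝ) : ℂ) ≠ 0 := by
    rw [Complex.ofReal_ne_zero]; exact sub_ne_zero.2 hu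
  simp only [Pi.div_apply, slope_def_module, Complex.real_smul]
  rw [mul_div_mul_left _ _ (by push_cast at hu' ⊢; exact inv_ne_zero hu')]

/-- Rouché's principle: if the chords of `φ` and `ψ` are never opposite where the weight varies,
both curves have the same weighted number of double points.  A base point that is a double point
may cross over to the other branch, which is seen from the base point at the index. -/
theorem weightedCount_add_ind_eq {g : ℝ × ℝ → ℝ} {c : ℝ} (hg : IsWeight g) (hφ : IsFlat φ g)
    (hψ : IsFlat ψ g)
    (h : ∀ z ∈ box, (∀ᶠ y in 𝓝 z, g y = g z) ∨ 0 < ((ψ z.1 - ψ z.2) / (φ z.1 - φ z.2)).re)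
    (h0 : ∀ u ∈ Ioo 0 (2 * π), (∀ᶠ v in 𝓝 u, g (0, v) + g (v, 2 * π) = 2 * c) ∨
      0 < ((ψ u - ψ 0) / (φ u - φ 0)).re)
    (hd : 0 < (deriv ψ 0 / deriv φ 0).re) :
    ψ.weightedCount g + 2 * c * ψ.ind (ψ 0) = φ.weightedCount g + 2 * c * φ.ind (φ 0) := by
  have hpi := Real.two_pi_pos
  set α := chordAngle φ ψ with hα
  -- the directions of the chords differ by `α`, so the two forms differ by `dg ∧ dα`
  have hwedge : ∀ z ∈ box, ψ.wedgeAngle g z - φ.wedgeAngle g z =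
      partialFst g z * partialSnd α z - partialSnd g z * partialFst α z := by
    intro z hz
    rcases h z hz with h | h
    · obtain ⟨h1, h2⟩ := partials_eq_zero_of_eventuallyEq_const h
      simp [wedgeAngle, h1.eq_of_nhds, h2.eq_of_nhds]
    · have hd := (contDiffAt_chordAngle h).differentiableAt (by simp)
      rw [partialFst_eq hd (hasDerivAt_chordAngle_fst h),
        partialSnd_eq hd (hasDerivAt_chordAngle_snd h), wedgeAngle, wedgeAngle]
      ring
  obtain ⟨-, hint⟩ := integral_wedge (α := α) hg.contDiff
    (fun z hz => (h z hz).imp id contDiffAt_chordAngle)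
  rw [← setIntegral_congr_fun measurableSet_box hwedge,
    integral_sub (integrableOn_wedgeAngle hg hψ) (integrableOn_wedgeAngle hg hφ)] at hint
  -- the weight vanishes near two edges of the square
  have b1 : ∫ a in (0 : ℝ)..(2 * π), α (a, 0) * partialFst g (a, 0) = 0 := by
    refine intervalIntegral.integral_zero_ae (ae_of_all _ fun u hu => ?_)
    rw [uIoc_of_le hpi.le] at hu
    rw [(hg.partials_eq_zero (fun h => absurd h.1 (not_lt.2 hu.1.le))).1, mul_zero]
  have b2 : ∫ u in (0 : ℝ)..(2 * π), α (2 * π, u) * partialSnd g (2 * π, u) = 0 := by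
    refine intervalIntegral.integral_zero_ae (ae_of_all _ fun u hu => ?_)
    rw [uIoc_of_le hpi.le] at hu
    rw [(hg.partials_eq_zero (fun h => absurd h.1 (not_lt.2 hu.2))).2, mul_zero]
  rw [b1, b2] at hint
  have hper : ∀ χ : ImmersedCurve, χ (2 * π) = χ 0 := fun χ => by simpa using χ.periodic 0
  have hperd : ∀ χ : ImmersedCurve, deriv χ (2 * π) = deriv χ 0 := fun χ => by
    simpa using χ.periodic_deriv 0
  -- the other two edges consist of the chords through the base point; integration by parts with the
  -- factor `q`, which vanishes near the double points on the edges, compares them with the indices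
  set A : ℝ → ℝ := fun u => α (u, 0) with hA
  have hA1 : ∀ u, α (u, 2 * π) = A u := fun u => by
    simp only [hA, hα, chordAngle, hper]
  have hA2 : ∀ u, α (0, u) = A u := fun u => chordAngle_swap φ ψ 0 u
  simp only [hA1, hA2] at hint
  have c1 : Continuous (partialFst g) := (contDiff_partialFst hg.contDiff).continuous
  have c2 : Continuous (partialSnd g) := (contDiff_partialSnd hg.contDiff).continuous
  have i1 : IntervalIntegrable (fun u => A u * partialFst g (u, 2 * π)) volume 0 (2 * π) :=
    intervalIntegrable_mul_chordAngle φ ψ (by fun_prop) (by fun_prop) _ _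
  have i2 : IntervalIntegrable (fun u => A u * partialSnd g (0, u)) volume 0 (2 * π) :=
    intervalIntegrable_mul_chordAngle φ ψ (by fun_prop) (by fun_prop) _ _
  set q : ℝ → ℝ := fun u => 2 * c - (g (0, u) + g (u, 2 * π)) with hq
  have hqd : ∀ u, HasDerivAt q (-(partialSnd g (0, u) + partialFst g (u, 2 * π))) u := fun u => by
    have d1 := hasDerivAt_partialSnd (hg.contDiff.differentiable (by simp) (0, u))
    have d2 := hasDerivAt_partialFst (hg.contDiff.differentiable (by simp) (u, 2 * π))
    exact (d1.add d2).const_sub (2 * c)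
  set Δ : ℝ → ℝ := fun u => ψ.angularSpeed (ψ 0) u - φ.angularSpeed (φ 0) u with hΔ
  have iΔ : IntervalIntegrable Δ volume 0 (2 * π) :=
    (ψ.intervalIntegrable_angularSpeed _ _ _).sub (φ.intervalIntegrable_angularSpeed _ _ _)
  have hcg := hg.contDiff.continuous
  have hcq : Continuous q := by fun_prop
  have iq : IntervalIntegrable (fun u => q u * Δ u) volume 0 (2 * π) :=
    iΔ.continuousOn_mul hcq.continuousOn
  -- at both ends of the interval the chord turns into the tangent at the base point
  have hlim : ∀ x, φ x = φ 0 → ψ x = ψ 0 → deriv φ x = deriv φ 0 → deriv ψ x = deriv ψ 0 →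
      q x = 2 * c →
      Tendsto (fun u => q u * A u) (𝓝[≠] x) (𝓝 (2 * c * (deriv ψ 0 / deriv φ 0).arg)) := by
    intro x e1 e2 e3 e4 e5
    have t := tendsto_chord_div φ ψ x
    rw [e1, e2, e3, e4] at t
    have t2 := (Complex.continuousAt_arg (Or.inl hd)).tendsto.comp t
    have t3 : Tendsto q (𝓝[≠] x) (𝓝 (2 * c)) := by
      rw [← e5]; exact (hcq.tendsto x).mono_left nhdsWithin_le_nhds
    exact t3.mul t2
  have hq0 : q 0 = 2 * c := by
    simp only [hq]
    rw [hg.eq_zero (z := (0, 0)) (fun h => absurd h.1 (lt_irrefl _)),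
      hg.eq_zero (z := (0, 2 * π)) (fun h => absurd h.2 (by simp))]
    ring
  have hq1 : q (2 * π) = 2 * c := by
    simp only [hq]
    rw [hg.eq_zero (z := (2 * π, 2 * π)) (fun h => absurd h.1 (lt_irrefl _)),
      hg.eq_zero (z := (0, 2 * π)) (fun h => absurd h.2 (by simp))]
    ring
  have hftc := intervalIntegral.integral_eq_sub_of_hasDerivAt_of_tendsto (a := 0) (b := 2 * π)
    (f := fun u => q u * A u)
    (f' := fun u => -(A u * partialSnd g (0, u) + A u * partialFst g (u, 2 * π)) + q u * Δ u)
    hpi ?_ ((i2.add i1).neg.add iq)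
    ((hlim 0 rfl rfl rfl rfl hq0).mono_left (nhdsWithin_mono _ fun x hx => ne_of_gt hx))
    ((hlim (2 * π) (hper φ) (hper ψ) (hperd φ) (hperd ψ) hq1).mono_left
      (nhdsWithin_mono _ fun x hx => ne_of_lt hx))
  · have s1 : ∫ u in (0 : ℝ)..(2 * π),
        -(A u * partialSnd g (0, u) + A u * partialFst g (u, 2 * π)) + q u * Δ u =
        -((∫ u in (0 : ℝ)..(2 * π), A u * partialSnd g (0, u)) +
          ∫ u in (0 : ℝ)..(2 * π), A u * partialFst g (u, 2 * π)) +
          ∫ u in (0 : ℝ)..(2 * π), q u * Δ u := by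
      have i3 : IntervalIntegrable
          (fun u => -(A u * partialSnd g (0, u) + A u * partialFst g (u, 2 * π))) volume
          0 (2 * π) := (i2.add i1).neg
      rw [intervalIntegral.integral_add i3 iq, intervalIntegral.integral_neg,
        intervalIntegral.integral_add i2 i1]
    have jψ := ψ.intervalIntegrable_edge hg
    have jφ := φ.intervalIntegrable_edge hg
    have kψ := (ψ.intervalIntegrable_angularSpeed (ψ 0) 0 (2 * π)).const_mul (2 * c)
    have kφ := (φ.intervalIntegrable_angularSpeed (φ 0) 0 (2 * π)).const_mul (2 * c)
    have s2 : ∫ u in (0 : ℝ)..(2 * π), q u * Δ u =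
        (2 * c * (∫ u in (0 : ℝ)..(2 * π), ψ.angularSpeed (ψ 0) u) -
          2 * c * ∫ u in (0 : ℝ)..(2 * π), φ.angularSpeed (φ 0) u) -
        ((∫ u in (0 : ℝ)..(2 * π), (g (0, u) + g (u, 2 * π)) * ψ.angularSpeed (ψ 0) u) -
          ∫ u in (0 : ℝ)..(2 * π), (g (0, u) + g (u, 2 * π)) * φ.angularSpeed (φ 0) u) := by
      rw [← intervalIntegral.integral_sub jψ jφ, ← intervalIntegral.integral_const_mul,
        ← intervalIntegral.integral_const_mul, ← intervalIntegral.integral_sub kψ kφ,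
        ← intervalIntegral.integral_sub (kψ.sub kφ) (jψ.sub jφ)]
      refine intervalIntegral.integral_congr fun u _ => ?_
      simp only [hq, hΔ]
      ring
    rw [s1, s2] at hftc
    simp only [weightedCount, ind_eq]
    linear_combination (-(2 * π)⁻¹) * hint + (2 * π)⁻¹ * hftc
  · intro u hu
    rcases h0 u hu with h | h
    · have hz : q =ᶠ[𝓝 u] fun _ => 0 := by
        filter_upwards [h] with v hv
        simp only [hq, hv, sub_self]
      have h1 : -(partialSnd g (0, u) + partialFst g (u, 2 * π)) = 0 :=
        (hqd u).unique ((hasDerivAt_const u (0 : ℝ)).congr_of_eventuallyEq hz)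
      have h2 : -(A u * partialSnd g (0, u) + A u * partialFst g (u, 2 * π)) + q u * Δ u = 0 := by
        rw [hz.eq_of_nhds]; linear_combination A u * h1
      rw [h2]
      refine (hasDerivAt_const u (0 : ℝ)).congr_of_eventuallyEq ?_
      filter_upwards [hz] with v hv
      rw [hv, zero_mul]
    · refine ((hqd u).mul (hasDerivAt_chordAngle_fst (z := (u, 0)) h)).congr_deriv ?_
      simp only [hA, hΔ]
      ring

end ImmersedCurve

section

variable {ι : Type*} {Ψ : ι → ImmersedCurve} {l : Filter ι} {φ : ImmersedCurve}

lemma C1Tendsto.eventually_flat_or_chord (h : C1Tendsto Ψ l φ) {g : ℝ × ℝ → ℝ} (hg : IsWeight g)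
    (hφ : IsFlat φ g) : ∀ᶠ i in l, ∀ z ∈ box,
      (∀ᶠ y in 𝓝 z, g y = g z) ∨ 0 < ((Ψ i z.1 - Ψ i z.2) / (φ z.1 - φ z.2)).re := by
  refine eventually_forall_of_isCompact isCompact_box fun z hz => ?_
  by_cases hzφ : φ z.1 = φ z.2
  · have h1 := hφ.eventually_eq hg hz hzφ
    have h2 : ∀ᶠ y in 𝓝 z, ∀ᶠ x in 𝓝 y, g x = g y := by
      filter_upwards [h1.eventually_nhds, h1] with y hy hy1
      filter_upwards [hy] with x hx
      rw [hx, hy1]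
    filter_upwards [h2.prod_inr l] with w hw
    exact Or.inl hw
  · filter_upwards [h.eventually_chord_of_ne hzφ] with w hw
    exact Or.inr hw

lemma C1Tendsto.eventually_isFlat (h : C1Tendsto Ψ l φ) {g : ℝ × ℝ → ℝ} (hg : IsWeight g)
    (hφ : IsFlat φ g) : ∀ᶠ i in l, IsFlat (Ψ i) g := by
  filter_upwards [h.eventually_flat_or_chord hg hφ] with i hi z hz _ hzi
  refine (hi z hz).resolve_right fun hre => (ImmersedCurve.ne_of_chord_re_pos hre).2 hzi

/-- The number `weightedCount + 2 c ind` is locally constant near `φ` if the weight takes the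
value `c` at the double points that pass through the base point `φ 0`. -/
theorem C1Tendsto.eventually_weightedCount (h : C1Tendsto Ψ l φ) {g : ℝ × ℝ → ℝ} {c : ℝ}
    (hg : IsWeight g) (hφ : IsFlat φ g)
    (hc : ∀ u ∈ Ioo 0 (2 * π), φ u = φ 0 → g (0, u) = c ∧ g (u, 2 * π) = c) :
    ∀ᶠ i in l, (Ψ i).weightedCount g + 2 * c * (Ψ i).ind (Ψ i 0) =
      φ.weightedCount g + 2 * c * φ.ind (φ 0) := by
  have hpi := Real.two_pi_pos
  have hper : ∀ χ : ImmersedCurve, ∀ x, χ (x - 2 * π) = χ x := fun χ x => χ.periodic.sub_eq x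
  have hedge : ∀ᶠ i in l, ∀ u ∈ Icc 0 (2 * π), u ∈ Ioo 0 (2 * π) →
      (∀ᶠ v in 𝓝 u, g (0, v) + g (v, 2 * π) = 2 * c) ∨
        0 < ((Ψ i u - Ψ i 0) / (φ u - φ 0)).re := by
    refine eventually_forall_of_isCompact isCompact_Icc fun u hu => ?_
    have hpair : ∀ s : ℝ, Tendsto (fun w : ι × ℝ => (w.1, (w.2 - s, (0 : ℝ)))) (l ×ˢ 𝓝 u)
        (l ×ˢ 𝓝 (u - s, 0)) := fun s => by
      refine tendsto_fst.prodMk ?_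
      exact (Continuous.tendsto' (f := fun x : ℝ => (x - s, (0 : ℝ))) (by fun_prop) u _ rfl).comp
        tendsto_snd
    by_cases hu0 : u = 0 ∨ u = 2 * π
    · have : u - u = 0 := sub_self u
      have hch := (hpair u).eventually (by rw [this]; exact h.eventually_chord 0)
      filter_upwards [hch] with w hw hmem
      right
      rcases hu0 with rfl | rfl
      · simp only [sub_zero] at hw; exact hw hmem.1.ne'
      · simp only [hper] at hw; exact hw (by linarith [hmem.2])
    · rw [not_or] at hu0
      have hu' : u ∈ Ioo 0 (2 * π) :=
        ⟨lt_of_le_of_ne hu.1 (Ne.symm hu0.1), lt_of_le_of_ne hu.2 hu0.2⟩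
      by_cases hφu : φ u = φ 0
      · have e0 : φ (2 * π) = φ 0 := by simpa using φ.periodic 0
        have f1 := hφ (0, u) (mem_box.2 ⟨⟨le_rfl, hpi.le⟩, hu.1, hu.2⟩)
          ⟨hu'.1, by simpa using hu'.2⟩ hφu.symm
        have f2 := hφ (u, 2 * π) (mem_box.2 ⟨⟨hu.1, hu.2⟩, hpi.le, le_rfl⟩)
          ⟨hu'.2, by simpa using hu'.1⟩ (by rw [e0]; exact hφu)
        rw [(hc u hu' hφu).1] at f1
        rw [(hc u hu' hφu).2] at f2
        have g1 : ∀ᶠ v in 𝓝 u, g (0, v) = c :=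
          (Continuous.tendsto' (f := fun v : ℝ => ((0 : ℝ), v)) (by fun_prop) u _ rfl).eventually f1
        have g2 : ∀ᶠ v in 𝓝 u, g (v, 2 * π) = c :=
          (Continuous.tendsto' (f := fun v : ℝ => (v, 2 * π)) (by fun_prop) u _ rfl).eventually f2
        filter_upwards [((g1.and g2).eventually_nhds).prod_inr l] with w hw _
        left
        filter_upwards [hw] with v hv
        rw [hv.1, hv.2, two_mul]
      · have hch := (hpair 0).eventually (by
          rw [sub_zero]; exact h.eventually_chord_of_ne (z := (u, 0)) hφu)
        filter_upwards [hch] with w hw _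
        right
        simpa using hw
  have hderiv : ∀ᶠ i in l, 0 < (deriv (Ψ i) 0 / deriv φ 0).re := by
    have h1 := (h.tendsto_deriv (tendsto_const_nhds (x := (0 : ℝ)))).div_const (deriv φ 0)
    rw [div_self (φ.immersion 0)] at h1
    exact ((Complex.continuous_re.tendsto _).comp h1).eventually (lt_mem_nhds (by simp))
  filter_upwards [h.eventually_flat_or_chord hg hφ, h.eventually_isFlat hg hφ, hedge, hderiv]
    with i h1 h2 h3 h4
  exact ImmersedCurve.weightedCount_add_ind_eq hg hφ h2 h1
    (fun u hu => h3 u (Ioo_subset_Icc_self hu) hu) h4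

end

/-! ### The contribution of a transverse double point -/

lemma integral_deriv_comp_sq_add_sq {h : ℝ → ℝ} (hh : ContDiff ℝ 1 h) {R : ℝ} (hR : 0 < R)
    (h0 : ∀ t, R ≤ t → h t = 0) :
    ∫ z : ℝ × ℝ, 2 * deriv h (z.1 ^ 2 + z.2 ^ 2) = -(2 * π) * h 0 := by
  have hd : Differentiable ℝ h := hh.differentiable (by simp)
  have hc : Continuous (deriv h) := hh.continuous_deriv (by simp)
  have h0' : ∀ t, R < t → deriv h t = 0 := by
    intro t ht
    have : h =ᶠ[𝓝 t] fun _ => 0 := by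
      filter_upwards [lt_mem_nhds ht] with s hs using h0 s hs.le
    rw [this.deriv_eq, deriv_const]
  rw [← integral_comp_polarCoord_symm]
  have e1 : ∀ p : ℝ × ℝ, p.1 • (2 * deriv h ((polarCoord.symm p).1 ^ 2 +
      (polarCoord.symm p).2 ^ 2)) = (deriv h (p.1 ^ 2) * (2 * p.1)) * (fun _ => (1 : ℝ)) p.2 := by
    intro p
    have : (polarCoord.symm p).1 ^ 2 + (polarCoord.symm p).2 ^ 2 = p.1 ^ 2 := by
      simp only [polarCoord_symm_apply]
      linear_combination p.1 ^ 2 * Real.sin_sq_add_cos_sq p.2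
    rw [this, smul_eq_mul]; ring
  have e2 : polarCoord.target = Ioi (0 : ℝ) ×ˢ Ioo (-π) π := rfl
  simp only [e1]
  rw [e2, Measure.volume_eq_prod, setIntegral_prod_mul (fun r : ℝ => deriv h (r ^ 2) * (2 * r))
    (fun _ => (1 : ℝ))]
  have hder : ∀ r : ℝ, HasDerivAt (fun r => h (r ^ 2)) (deriv h (r ^ 2) * (2 * r)) r := fun r => by
    exact ((hd (r ^ 2)).hasDerivAt.comp r (hasDerivAt_pow 2 r)).congr_deriv (by simp)
  have hint : IntegrableOn (fun r : ℝ => deriv h (r ^ 2) * (2 * r)) (Ioi 0) := by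
    have hcont : Continuous fun r : ℝ => deriv h (r ^ 2) * (2 * r) := by fun_prop
    have hsupp : HasCompactSupport fun r : ℝ => deriv h (r ^ 2) * (2 * r) := by
      refine HasCompactSupport.intro (isCompact_Icc (a := -(R + 1)) (b := R + 1)) fun x hx => ?_
      rw [h0', zero_mul]
      by_contra hc
      push Not at hc
      refine hx (abs_le.1 (abs_le_of_sq_le_sq ?_ (by positivity)))
      nlinarith
    exact (hcont.integrable_of_hasCompactSupport hsupp).integrableOn
  have hlim : Tendsto (fun r => h (r ^ 2)) atTop (𝓝 0) := by
    refine tendsto_const_nhds.congr' ?_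
    filter_upwards [(tendsto_pow_atTop (α := ℝ) two_ne_zero).eventually_ge_atTop R] with r hr
    exact (h0 _ hr).symm
  rw [integral_Ioi_of_hasDerivAt_of_tendsto (f := fun r => h (r ^ 2)) (m := 0)
    (hder 0).continuousAt.continuousWithinAt (fun r _ => hder r) hint hlim]
  have : ∫ _ in Ioo (-π) π, (1 : ℝ) = 2 * π := by
    rw [setIntegral_const, Measure.real, Real.volume_Ioo, ENNReal.toReal_ofReal]
    · simp; ring
    · linarith [Real.pi_pos]
  rw [this]
  simp [mul_comm]

namespace ImmersedCurve

variable {φ : ImmersedCurve}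

/-- Near a transverse double point the chord is homotopic to an affine isomorphism that is complex
linear or antilinear. -/
lemma exists_linear_model {a u κ : ℝ} (hφ : φ a = φ u)
    (hκ : 0 < κ * cross (deriv φ u) (deriv φ a)) (hκ2 : κ * κ = 1) :
    ∃ γ : ℂ, ∀ᶠ z : ℝ × ℝ in 𝓝 (a, u), z ≠ (a, u) →
      0 < ((φ z.1 - φ z.2) / (γ * ((z.1 - a : ℝ) + (κ * (z.2 - u) : ℝ) * Complex.I))).re := by
  set A := deriv φ a
  set B := -deriv φ u with hB
  set γ : ℂ := (A - κ * (Complex.I * B)) / 2 with hγ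
  set δ : ℂ := (A + κ * (Complex.I * B)) / 2 with hδ
  have hlt : ‖δ‖ < ‖γ‖ := by
    refine lt_of_pow_lt_pow_left₀ 2 (norm_nonneg _) ?_
    rw [Complex.sq_norm, Complex.sq_norm, Complex.normSq_apply, Complex.normSq_apply]
    simp only [hγ, hδ, hB, cross] at hκ ⊢
    simp
    nlinarith
  set ε := (‖γ‖ - ‖δ‖) / 4 with hε
  have hε0 : 0 < ε := by simp only [hε]; linarith
  have h1 := (φ.hasDerivAt a).isLittleO.def hε0
  have h2 := (φ.hasDerivAt u).isLittleO.def hε0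
  refine ⟨γ, ?_⟩
  rw [nhds_prod_eq]
  filter_upwards [h1.prod_mk h2] with z ⟨h1, h2⟩ hz
  set x := z.1 - a
  set y := z.2 - u
  set ζ : ℂ := (x : ℝ) + (κ * y : ℝ) * Complex.I with hζ
  have hn : ‖ζ‖ ^ 2 = x ^ 2 + y ^ 2 := by
    rw [Complex.sq_norm, Complex.normSq_apply]
    simp [hζ]
    linear_combination y ^ 2 * hκ2
  have hx : |x| ≤ ‖ζ‖ := abs_le_of_sq_le_sq (by nlinarith [sq_nonneg y]) (norm_nonneg _)
  have hy : |y| ≤ ‖ζ‖ := abs_le_of_sq_le_sq (by nlinarith [sq_nonneg x]) (norm_nonneg _)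
  have hζ0 : 0 < ‖ζ‖ := by
    rw [norm_pos_iff]
    intro h0
    rw [h0, norm_zero] at hx hy
    refine hz (Prod.ext ?_ ?_)
    · have := abs_nonpos_iff.1 hx; simp only [x] at this; linarith
    · have := abs_nonpos_iff.1 hy; simp only [y] at this; linarith
  apply re_div_pos_of_norm_sub_lt
  have hconj : ‖(x : ℂ) - (κ * y : ℝ) * Complex.I‖ = ‖ζ‖ := by
    rw [← RCLike.norm_conj ζ]
    congr 1
    simp [hζ, sub_eq_add_neg]
  have hκ2' : (κ : ℂ) * κ = 1 := by exact_mod_cast hκ2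
  have hdec : φ z.1 - φ z.2 - γ * ζ = (φ z.1 - φ a - x • A) - (φ z.2 - φ u - y • deriv φ u) +
      δ * ((x : ℂ) - (κ * y : ℝ) * Complex.I) := by
    rw [hφ]
    simp only [hγ, hδ, hζ, hB, Complex.real_smul, Complex.ofReal_mul]
    linear_combination -(y * deriv φ u) * hκ2' * Complex.I ^ 2 - (y * deriv φ u) * Complex.I_sq
  have hx' : ‖x‖ ≤ ‖ζ‖ := hx
  have hy' : ‖y‖ ≤ ‖ζ‖ := hy
  calc ‖φ z.1 - φ z.2 - γ * ζ‖ ≤ (ε * ‖x‖ + ε * ‖y‖) + ‖δ‖ * ‖ζ‖ := by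
        rw [hdec]
        refine (norm_add_le _ _).trans (add_le_add ((norm_sub_le _ _).trans (add_le_add h1 h2)) ?_)
        rw [norm_mul, hconj]
    _ < ‖γ * ζ‖ := by
        rw [norm_mul]
        have : ε * ‖x‖ ≤ ε * ‖ζ‖ := by gcongr
        have : ε * ‖y‖ ≤ ε * ‖ζ‖ := by gcongr
        have : ‖γ‖ = 4 * ε + ‖δ‖ := by simp only [hε]; ring
        rw [this]
        nlinarith [mul_pos hε0 hζ0]

/-- A bump function at a transverse double point counts its sign. -/
theorem exists_bump {a u : ℝ} (ha : 0 < a) (hau : a < u) (hu : u < 2 * π) (hφ : φ a = φ u)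
    (hc : cross (deriv φ u) (deriv φ a) ≠ 0) {U : Set (ℝ × ℝ)} (hU : U ∈ 𝓝 (a, u)) :
    ∃ k : ℝ × ℝ → ℝ, IsWeight k ∧ IsFlat φ k ∧ tsupport k ⊆ U ∧ (∀ᶠ z in 𝓝 (a, u), k z = 1) ∧
      φ.weightedCount k = φ.doubleSign a u := by
  set κ : ℝ := φ.doubleSign a u with hκdef
  have hκ : 0 < κ * cross (deriv φ u) (deriv φ a) ∧ κ * κ = 1 := by
    rw [hκdef, doubleSign]
    rcases lt_or_gt_of_ne hc with h | h
    · rw [sign_neg h]; simp [h]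
    · rw [sign_pos h]; simp [h]
  obtain ⟨hκ, hκ2⟩ := hκ
  obtain ⟨γ, hγ⟩ := exists_linear_model hφ hκ hκ2
  have hV : {z : ℝ × ℝ | 0 < z.1 ∧ z.1 < z.2 ∧ z.2 < 2 * π} ∈ 𝓝 (a, u) := by
    refine IsOpen.mem_nhds ?_ ⟨ha, hau, hu⟩
    exact (isOpen_lt continuous_const continuous_fst).inter
      ((isOpen_lt continuous_fst continuous_snd).inter (isOpen_lt continuous_snd continuous_const))
  obtain ⟨r, hr, hrs⟩ := Metric.mem_nhds_iff.1 (inter_mem (inter_mem hU hV) hγ)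
  set R := r ^ 2 / 4 with hRdef
  have hR : 0 < R := by positivity
  set Q : ℝ × ℝ → ℝ := fun z => (z.1 - a) ^ 2 + (z.2 - u) ^ 2 with hQ
  have hQc : Continuous Q := by fun_prop
  have hQr : ∀ z, Q z ≤ 2 * R → z ∈ Metric.ball (a, u) r := by
    intro z hz
    rw [Metric.mem_ball, Prod.dist_eq, max_lt_iff, Real.dist_eq, Real.dist_eq]
    simp only [hQ, hRdef] at hz
    constructor
    · exact abs_lt_of_sq_lt_sq (by nlinarith [sq_nonneg (z.2 - u)]) hr.le
    · exact abs_lt_of_sq_lt_sq (by nlinarith [sq_nonneg (z.1 - a)]) hr.le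
  -- the bump is a function of the radius: its integral against the form of the linear model is
  -- computed in polar coordinates
  set h : ℝ → ℝ := fun t => Real.smoothTransition (2 - t / R) with hh
  have hsm : ContDiff ℝ ∞ h :=
    Real.smoothTransition.contDiff.comp (contDiff_const.sub (contDiff_id.div_const R))
  have h1 : ∀ t, t ≤ R → h t = 1 := fun t ht => Real.smoothTransition.one_of_one_le (by
    rw [le_sub_comm]; rw [div_le_iff₀ hR]; linarith)
  have h0 : ∀ t, 2 * R ≤ t → h t = 0 := fun t ht => Real.smoothTransition.zero_of_nonpos (by
    rw [sub_nonpos, le_div_iff₀ hR]; linarith)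
  set k : ℝ × ℝ → ℝ := fun z => h (Q z) with hk
  have hks : ContDiff ℝ ∞ k := hsm.comp (by fun_prop)
  have hsupp : tsupport k ⊆ {z | Q z ≤ 2 * R} := by
    refine closure_minimal (fun z hz => ?_) (isClosed_le hQc continuous_const)
    by_contra hlt
    exact hz (h0 _ (not_le.1 hlt).le)
  have hball : ∀ z ∈ tsupport k, (z ∈ U ∧ 0 < z.1 ∧ z.1 < z.2 ∧ z.2 < 2 * π) ∧ (z ≠ (a, u) →
      0 < ((φ z.1 - φ z.2) / (γ * ((z.1 - a : ℝ) + (κ * (z.2 - u) : ℝ) * Complex.I))).re) :=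
    fun z hz => hrs (hQr z (hsupp hz))
  have hw : IsWeight k := by
    refine ⟨hks, fun z hz => ?_⟩
    have := (hball z hz).1.2
    exact ⟨this.2.1, by linarith⟩
  have hone : ∀ z, Q z < R → ∀ᶠ y in 𝓝 z, k y = 1 := fun z hz => by
    filter_upwards [(hQc.tendsto z).eventually (gt_mem_nhds hz)] with y hy using h1 _ hy.le
  have hQ0 : Q (a, u) < R := by simpa [hQ] using hR
  have hflat : IsFlat φ k := by
    intro z _ _ hzφ
    by_cases hz : z ∈ tsupport k
    · have : z = (a, u) := by
        by_contra hne
        have := (hball z hz).2 hne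
        rw [hzφ, sub_self, zero_div] at this
        simp at this
      rw [this]
      filter_upwards [hone _ hQ0] with y hy
      rw [hy, (hone _ hQ0).self_of_nhds]
    · have := notMem_tsupport_iff_eventuallyEq.1 hz
      rw [this.self_of_nhds]
      exact this
  refine ⟨k, hw, hflat, fun z hz => (hball z hz).1.1, hone _ hQ0, ?_⟩
  have hzero : ∀ z : ℝ × ℝ, ¬ (0 < z.1 ∧ z.2 < 2 * π) → k =ᶠ[𝓝 z] 0 := fun z hz =>
    notMem_tsupport_iff_eventuallyEq.1 fun h => hz
      ⟨(hball z h).1.2.1, (hball z h).1.2.2.2⟩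
  have hedge : ∫ v in (0 : ℝ)..(2 * π), (k (0, v) + k (v, 2 * π)) * φ.angularSpeed (φ 0) v = 0 := by
    have : ∀ v : ℝ, (k (0, v) + k (v, 2 * π)) * φ.angularSpeed (φ 0) v = 0 := fun v => by
      rw [(hzero (0, v) (by simp)).self_of_nhds, (hzero (v, 2 * π) (by simp)).self_of_nhds]
      simp
    simp [this]
  set α : ℝ × ℝ → ℝ := fun z =>
    ((φ z.1 - φ z.2) / (γ * ((z.1 - a : ℝ) + (κ * (z.2 - u) : ℝ) * Complex.I))).arg with hα
  -- the derivatives of `k`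
  have hQ1 : ∀ z, HasDerivAt (fun x => k (x, z.2)) (deriv h (Q z) * (2 * (z.1 - a))) z.1 := by
    intro z
    have e : HasDerivAt (fun x => Q (x, z.2)) (2 * (z.1 - a)) z.1 := by
      exact ((((hasDerivAt_id z.1).sub_const a).pow 2).add_const ((z.2 - u) ^ 2)).congr_deriv
        (by simp)
    exact ((hsm.differentiable (by simp) (Q z)).hasDerivAt).comp z.1 e
  have hQ2 : ∀ z, HasDerivAt (fun y => k (z.1, y)) (deriv h (Q z) * (2 * (z.2 - u))) z.2 := by
    intro z
    have e : HasDerivAt (fun y => Q (z.1, y)) (2 * (z.2 - u)) z.2 := by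
      exact ((((hasDerivAt_id z.2).sub_const u).pow 2).const_add ((z.1 - a) ^ 2)).congr_deriv
        (by simp)
    exact ((hsm.differentiable (by simp) (Q z)).hasDerivAt).comp z.2 e
  have hp1 : ∀ z, partialFst k z = deriv h (Q z) * (2 * (z.1 - a)) := fun z =>
    partialFst_eq (hks.differentiable (by simp) z) (hQ1 z)
  have hp2 : ∀ z, partialSnd k z = deriv h (Q z) * (2 * (z.2 - u)) := fun z =>
    partialSnd_eq (hks.differentiable (by simp) z) (hQ2 z)
  have hcases : ∀ z, ((∀ᶠ y in 𝓝 z, k y = k z) ∧ deriv h (Q z) = 0) ∨ (0 < Q z ∧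
      0 < ((φ z.1 - φ z.2) / (γ * ((z.1 - a : ℝ) + (κ * (z.2 - u) : ℝ) * Complex.I))).re) := by
    intro z
    rcases lt_or_ge (Q z) R with hz | hz
    · left
      constructor
      · filter_upwards [hone z hz] with y hy
        rw [hy, (hone z hz).self_of_nhds]
      · have : h =ᶠ[𝓝 (Q z)] fun _ => 1 := by
          filter_upwards [gt_mem_nhds hz] with t ht using h1 t ht.le
        rw [this.deriv_eq, deriv_const]
    rcases lt_or_ge (2 * R) (Q z) with hz2 | hz2
    · left
      constructor
      · have : ∀ᶠ y in 𝓝 z, k y = 0 := by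
          filter_upwards [(hQc.tendsto z).eventually (lt_mem_nhds hz2)] with y hy using h0 _ hy.le
        filter_upwards [this] with y hy
        rw [hy, this.self_of_nhds]
      · have : h =ᶠ[𝓝 (Q z)] fun _ => 0 := by
          filter_upwards [lt_mem_nhds hz2] with t ht using h0 t ht.le
        rw [this.deriv_eq, deriv_const]
    · right
      refine ⟨hR.trans_le hz, (hrs (hQr z hz2)).2 ?_⟩
      rintro rfl
      exact absurd hQ0 (not_lt.2 hz)
  have hαd : ∀ z, 0 < ((φ z.1 - φ z.2) /
      (γ * ((z.1 - a : ℝ) + (κ * (z.2 - u) : ℝ) * Complex.I))).re → ContDiffAt ℝ 1 α z := by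
    intro z hz
    have hD : γ * ((z.1 - a : ℝ) + (κ * (z.2 - u) : ℝ) * Complex.I) ≠ 0 := by
      intro h0; rw [h0, div_zero] at hz; simp at hz
    have hN : ContDiffAt ℝ 1 (fun z : ℝ × ℝ => φ z.1 - φ z.2) z :=
      (((φ.smooth.comp contDiff_fst).sub (φ.smooth.comp contDiff_snd)).contDiffAt).of_le
        (by norm_cast)
    have hD' : ContDiff ℝ 1 (fun z : ℝ × ℝ =>
        γ * (((z.1 - a : ℝ) : ℂ) + ((κ * (z.2 - u) : ℝ) : ℂ) * Complex.I)) := by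
      have c1 : ContDiff ℝ 1 (fun z : ℝ × ℝ => ((z.1 - a : ℝ) : ℂ)) :=
        Complex.ofRealCLM.contDiff.comp (f := fun z : ℝ × ℝ => z.1 - a) (by fun_prop)
      have c2 : ContDiff ℝ 1 (fun z : ℝ × ℝ => ((κ * (z.2 - u) : ℝ) : ℂ)) :=
        Complex.ofRealCLM.contDiff.comp (f := fun z : ℝ × ℝ => κ * (z.2 - u)) (by fun_prop)
      exact contDiff_const.mul (c1.add (c2.mul contDiff_const))
    have h2 : ContDiffAt ℝ 1 (fun z : ℝ × ℝ => (φ z.1 - φ z.2) /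
        (γ * (((z.1 - a : ℝ) : ℂ) + ((κ * (z.2 - u) : ℝ) : ℂ) * Complex.I))) z := by
      simp only [div_eq_mul_inv]
      exact hN.mul (hD'.contDiffAt.inv hD)
    have h3 := (Complex.contDiffAt_log (n := 1) (Or.inl hz)).restrict_scalars ℝ
    refine (Complex.imCLM.contDiff.contDiffAt.comp z (h3.comp z h2)).congr_of_eventuallyEq
      (Eventually.of_forall fun z => ?_)
    exact (Complex.log_im _).symm
  -- `α` is the angle between the chord and its linear model, for which the form is
  -- `κ * (2 * deriv h (Q z))`
  have hwedge : ∀ z ∈ box, φ.wedgeAngle k z - κ * (2 * deriv h (Q z)) =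
      partialFst k z * partialSnd α z - partialSnd k z * partialFst α z := by
    intro z _
    rcases hcases z with ⟨hz, hz'⟩ | ⟨hQz, hz⟩
    · rw [wedgeAngle, hp1, hp2, hz']; ring
    · have hda := (hαd z hz).differentiableAt (by simp)
      set ζ : ℂ := (z.1 - a : ℝ) + (κ * (z.2 - u) : ℝ) * Complex.I with hζ
      have hγ0 : γ ≠ 0 := by
        rintro rfl; simp at hz
      have hnsq : Complex.normSq ζ = Q z := by
        rw [Complex.normSq_apply]; simp [hζ, hQ]; linear_combination (z.2 - u) ^ 2 * hκ2
      have dD1 : HasDerivAt (fun x : ℝ => γ * ((x - a : ℝ) + (κ * (z.2 - u) : ℝ) * Complex.I))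
          γ z.1 := by
        have e1 : HasDerivAt (fun x : ℝ => ((x - a : ℝ) : ℂ)) 1 z.1 := by
          simpa using ((hasDerivAt_id z.1).sub_const a).ofReal_comp
        simpa using (e1.add_const ((κ * (z.2 - u) : ℝ) * Complex.I)).const_mul γ
      have dD2 : HasDerivAt (fun y : ℝ => γ * ((z.1 - a : ℝ) + (κ * (y - u) : ℝ) * Complex.I))
          (γ * (κ * Complex.I)) z.2 := by
        have e1 : HasDerivAt (fun y : ℝ => ((κ * (y - u) : ℝ) : ℂ)) κ z.2 := by
          simpa using (((hasDerivAt_id z.2).sub_const u).const_mul κ).ofReal_comp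
        exact ((e1.mul_const Complex.I).const_add _).const_mul γ
      have dα1 : partialFst α z = φ.angularSpeed (φ z.2) z.1 - (γ / (γ * ζ)).im :=
        partialFst_eq hda (hasDerivAt_arg_div ((φ.hasDerivAt z.1).sub_const (φ z.2)) dD1 hz)
      have dα2 : partialSnd α z = (-deriv φ z.2 / (φ z.1 - φ z.2)).im -
          (γ * (κ * Complex.I) / (γ * ζ)).im :=
        partialSnd_eq hda (hasDerivAt_arg_div ((φ.hasDerivAt z.2).const_sub (φ z.1)) dD2 hz)
      have s1 : -deriv φ z.2 / (φ z.1 - φ z.2) = deriv φ z.2 / (φ z.2 - φ z.1) := by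
        rw [← neg_sub (φ z.2), neg_div_neg_eq]
      have s2 : (γ / (γ * ζ)).im = -(κ * (z.2 - u)) / Q z := by
        rw [div_mul_cancel_left₀ hγ0, Complex.inv_im, hnsq]
        simp [hζ]
      have s3 : (γ * (κ * Complex.I) / (γ * ζ)).im = κ * (z.1 - a) / Q z := by
        rw [mul_div_mul_left _ _ hγ0, Complex.div_im, hnsq]
        simp [hζ]
      rw [dα1, dα2, s1, s2, s3, wedgeAngle, hp1, hp2, angularSpeed, angularSpeed]
      have hQne := hQz.ne'
      field_simp
      simp only [hQ]
      ring
  obtain ⟨-, hint⟩ := integral_wedge (α := α) hks (fun z _ => (hcases z).imp And.left (fun h =>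
    hαd z h.2))
  have hcd : Continuous (deriv h) := hsm.continuous_deriv (by simp)
  have i2 : IntegrableOn (fun z => κ * (2 * deriv h (Q z))) box :=
    (by fun_prop : Continuous fun z => κ * (2 * deriv h (Q z))).continuousOn.integrableOn_compact
      isCompact_box
  rw [← setIntegral_congr_fun measurableSet_box hwedge,
    integral_sub (integrableOn_wedgeAngle hw hflat) i2] at hint
  have hz : ∀ z : ℝ × ℝ, ¬ (0 < z.1 ∧ z.1 < z.2 ∧ z.2 < 2 * π) →
      partialFst k z = 0 ∧ partialSnd k z = 0 := by
    intro z hz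
    have : k =ᶠ[𝓝 z] fun _ => 0 := notMem_tsupport_iff_eventuallyEq.1 fun h => hz (hball z h).1.2
    have := partials_eq_zero_of_eventuallyEq_const this
    exact ⟨this.1.eq_of_nhds, this.2.eq_of_nhds⟩
  have hpi := Real.two_pi_pos
  have e1 : ∫ x in (0 : ℝ)..(2 * π), α (x, 2 * π) * partialFst k (x, 2 * π) = 0 := by
    have : ∀ x : ℝ, α (x, 2 * π) * partialFst k (x, 2 * π) = 0 := fun x => by
      rw [(hz (x, 2 * π) (by simp)).1, mul_zero]
    simp [this]
  have e2 : ∫ x in (0 : ℝ)..(2 * π), α (x, 0) * partialFst k (x, 0) = 0 := by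
    have : ∀ x : ℝ, α (x, 0) * partialFst k (x, 0) = 0 := fun x => by
      rw [(hz (x, 0) (by simp; intros; linarith)).1, mul_zero]
    simp [this]
  have e3 : ∫ y in (0 : ℝ)..(2 * π), α (2 * π, y) * partialSnd k (2 * π, y) = 0 := by
    have : ∀ y : ℝ, α (2 * π, y) * partialSnd k (2 * π, y) = 0 := fun y => by
      rw [(hz (2 * π, y) (by simp; intros; linarith)).2, mul_zero]
    simp [this]
  have e4 : ∫ y in (0 : ℝ)..(2 * π), α (0, y) * partialSnd k (0, y) = 0 := by
    have : ∀ y : ℝ, α (0, y) * partialSnd k (0, y) = 0 := fun y => by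
      rw [(hz (0, y) (by simp)).2, mul_zero]
    simp [this]
  rw [e1, e2, e3, e4] at hint
  have hm : ∫ z in box, κ * (2 * deriv h (Q z)) = κ * (-(2 * π)) := by
    rw [setIntegral_eq_integral_of_forall_compl_eq_zero, integral_const_mul]
    · have := integral_sub_right_eq_self
        (fun z : ℝ × ℝ => 2 * deriv h (z.1 ^ 2 + z.2 ^ 2)) (a, u) (μ := volume)
      have hQ' : ∀ z : ℝ × ℝ, 2 * deriv h (Q z) =
        2 * deriv h ((z - (a, u)).1 ^ 2 + (z - (a, u)).2 ^ 2) := fun z => rfl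
      simp only [hQ']
      rw [this, integral_deriv_comp_sq_add_sq (hsm.of_le (by norm_cast)) (by positivity) h0,
        h1 0 hR.le, mul_one]
    · intro z hzb
      rcases hcases z with hz1 | ⟨hQz, _⟩
      · rw [hz1.2]; ring
      · have := hz z (fun h => hzb (mem_box.2 ⟨⟨h.1.le, by linarith⟩, by linarith, h.2.2.le⟩))
        rw [hp1, hp2] at this
        have hor : z.1 - a ≠ 0 ∨ z.2 - u ≠ 0 := by
          by_contra hc
          push Not at hc
          simp only [hQ, hc.1, hc.2] at hQz
          simp at hQz
        have : deriv h (Q z) = 0 := by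
          rcases hor with h' | h'
          · exact (mul_eq_zero.1 this.1).resolve_right (mul_ne_zero two_ne_zero h')
          · exact (mul_eq_zero.1 this.2).resolve_right (mul_ne_zero two_ne_zero h')
        rw [this]; ring
  rw [hm] at hint
  rw [weightedCount, hedge]
  have : ∫ z in box, φ.wedgeAngle k z = -(2 * π) * κ := by linarith
  rw [this]
  field_simp
  ring

end ImmersedCurve

/-! ### Weights adapted to a curve -/

/-- The double points in the square of parameters. -/
def ImmersedCurve.doubleSet (φ : ImmersedCurve) : Set (ℝ × ℝ) :=
  {z | z ∈ box ∧ z ∈ pairRegion ∧ φ z.1 = φ z.2}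

section

variable {ι : Type*} {Ψ : ι → ImmersedCurve} {l : Filter ι} {φ : ImmersedCurve}

/-- Limits of double points are double points. -/
lemma C1Tendsto.eventually_mem_doubleSet (h : C1Tendsto Ψ l φ) {z : ℝ × ℝ} (hz : z ∈ box) :
    ∀ᶠ w : ι × ℝ × ℝ in l ×ˢ 𝓝 z, w.2 ∈ pairRegion → Ψ w.1 w.2.1 = Ψ w.1 w.2.2 →
      z ∈ φ.doubleSet := by
  by_cases hφ : φ z.1 = φ z.2
  · by_cases hr : z ∈ pairRegion
    · exact Eventually.of_forall fun w _ _ => ⟨hz, hr, hφ⟩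
    · have hzb := mem_box.1 hz
      rcases lt_trichotomy z.1 z.2 with hlt | heq | hgt
      · have h2 : z.1 + 2 * π ≤ z.2 := by
          by_contra hc; exact hr ⟨hlt, not_le.1 hc⟩
        have e1 : z.1 = 0 := by linarith [hzb.1.1, hzb.2.2]
        have e2 : z.2 = 2 * π := by linarith [hzb.1.1, hzb.2.2]
        have ht : Tendsto (fun w : ι × ℝ × ℝ => (w.1, (w.2.1, w.2.2 - 2 * π))) (l ×ˢ 𝓝 z)
            (l ×ˢ 𝓝 (0, 0)) := by
          refine tendsto_fst.prodMk ?_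
          exact (Continuous.tendsto' (f := fun x : ℝ × ℝ => (x.1, x.2 - 2 * π)) (by fun_prop) z _
            (by rw [e1, e2, sub_self])).comp tendsto_snd
        filter_upwards [ht.eventually (h.eventually_chord 0)] with w hw hwr hwe
        have := hw (ne_of_gt (by change w.2.2 - 2 * π < w.2.1; linarith [hwr.2]))
        simp only [(Ψ w.1).periodic.sub_eq, hwe, sub_self, zero_div] at this
        simp at this
      · have hch := h.eventually_chord z.1
        have hz' : z = (z.1, z.1) := Prod.ext rfl heq.symm
        rw [← hz'] at hch
        filter_upwards [hch] with w hw hwr hwe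
        have := hw hwr.1.ne
        simp [hwe] at this
      · have : ∀ᶠ y : ℝ × ℝ in 𝓝 z, y.2 < y.1 :=
          (isOpen_lt continuous_snd continuous_fst).mem_nhds hgt
        filter_upwards [this.prod_inr l] with w hw hwr
        exact absurd hwr.1 (not_lt.2 hw.le)
  · filter_upwards [h.eventually_chord_of_ne hφ] with w hw _ hwe
    simp [hwe] at hw

lemma C1Tendsto.eventually_ind_eq_prod (h : C1Tendsto Ψ l φ) {z : ℝ × ℝ} (hz : z ∈ φ.doubleSet)
    (hφ : φ.OnlyTwo z.1 z.2) : ∀ᶠ w : ι × ℝ × ℝ in l ×ˢ 𝓝 z, (Ψ w.1).OnlyTwo w.2.1 w.2.2 →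
      Ψ w.1 w.2.1 = Ψ w.1 w.2.2 → (Ψ w.1).ind (Ψ w.1 w.2.1) = φ.ind (φ z.1) :=
  (h.comp tendsto_fst).eventually_ind_eq
    ((continuous_fst.tendsto z).comp tendsto_snd) ((continuous_snd.tendsto z).comp tendsto_snd)
    hz.2.1.1 hz.2.1.2 hz.2.2 hφ

end

namespace ImmersedCurve

variable {φ : ImmersedCurve}

lemma isCompact_doubleSet (φ : ImmersedCurve) : IsCompact φ.doubleSet := by
  refine isCompact_box.of_isClosed_subset ?_ fun z hz => hz.1
  rw [isClosed_iff_frequently]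
  intro z hz
  have hzb : z ∈ box := isCompact_box.isClosed.mem_of_frequently_of_tendsto
    (hz.mono fun y hy => hy.1) tendsto_id
  have h := (c1Tendsto_const φ (pure ())).eventually_mem_doubleSet hzb
  rw [pure_prod, eventually_map] at h
  obtain ⟨y, hy, hy2⟩ := (hz.and_eventually h).exists
  exact hy2 hy.2.1 hy.2.2

lemma NoTriple.onlyTwo_of_mem (hφ : φ.NoTriple) {z : ℝ × ℝ} (hz : z ∈ φ.doubleSet) :
    φ.OnlyTwo z.1 z.2 := hφ.onlyTwo hz.2.1.1 hz.2.1.2 hz.2.2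

lemma eventually_ind_eq_of_onlyTwo {z : ℝ × ℝ} (hz : z ∈ φ.doubleSet) (hφ : φ.OnlyTwo z.1 z.2) :
    ∀ᶠ y in 𝓝 z, φ.OnlyTwo y.1 y.2 → y ∈ φ.doubleSet → φ.ind (φ y.1) = φ.ind (φ z.1) := by
  have h := (c1Tendsto_const φ (pure ())).eventually_ind_eq_prod hz hφ
  rw [pure_prod, eventually_map] at h
  filter_upwards [h] with y hy h2 hyd using hy h2 hyd.2.2

/-- A locally constant function on the set of double points extends to a weight which is
constant near each double point. -/
lemma exists_isWeight (φ : ImmersedCurve) (ℓ : ℝ × ℝ → ℝ)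
    (hℓ : ∀ z ∈ φ.doubleSet, ∀ᶠ y in 𝓝 z, y ∈ φ.doubleSet → ℓ y = ℓ z) :
    ∃ g, IsWeight g ∧ ∀ z ∈ φ.doubleSet, ∀ᶠ y in 𝓝 z, g y = ℓ z := by
  set D := φ.doubleSet
  have hU : ∀ z : D, ∃ V : Set (ℝ × ℝ), IsOpen V ∧ z.1 ∈ V ∧ V ⊆ pairRegion ∧
      ∀ y ∈ V, y ∈ D → ℓ y = ℓ z := by
    intro z
    obtain ⟨V, hV, hVo, hzV⟩ := mem_nhds_iff.1
      (inter_mem (hℓ z z.2) (isOpen_pairRegion.mem_nhds z.2.2.1))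
    exact ⟨V, hVo, hzV, fun y hy => (hV hy).2, fun y hy => (hV hy).1⟩
  choose V hVo hzV hVr hVℓ using hU
  obtain ⟨ε, hε, hεV⟩ := lebesgue_number_lemma_of_metric φ.isCompact_doubleSet hVo
    (fun z hz => mem_iUnion.2 ⟨⟨z, hz⟩, hzV _⟩)
  -- smooth selection from the convex conditions: the value is prescribed at the distance `≤ ε / 3`
  -- from a double point, and it is `0` at the distance `> ε / 2` from all of them
  have hsame : ∀ z ∈ D, ∀ y ∈ D, dist y z < ε → ℓ y = ℓ z := by
    intro z hz y hy hd
    obtain ⟨i, hi⟩ := hεV z hz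
    rw [hVℓ i y (hi hd) hy, hVℓ i z (hi (Metric.mem_ball_self hε)) hz]
  set t : ℝ × ℝ → Set ℝ := fun y =>
    {v | (∀ z ∈ D, dist y z ≤ ε / 3 → v = ℓ z) ∧ ((∀ z ∈ D, ε / 2 < dist y z) → v = 0)} with ht
  have hconv : ∀ y, Convex ℝ (t y) := by
    intro y a ha b hb p q _ _ hpq
    refine ⟨fun z hz hd => ?_, fun hd => ?_⟩
    · rw [ha.1 z hz hd, hb.1 z hz hd, ← add_smul, hpq, one_smul]
    · rw [ha.2 hd, hb.2 hd]; simp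
  obtain ⟨g, hg⟩ := exists_contMDiffMap_forall_mem_convex_of_local_const (n := (⊤ : ℕ∞))
    (modelWithCornersSelf ℝ (ℝ × ℝ)) hconv (fun x => by
      by_cases hx : ∃ z ∈ D, dist x z < ε / 2
      · obtain ⟨z, hz, hxz⟩ := hx
        refine ⟨ℓ z, ?_⟩
        filter_upwards [Metric.ball_mem_nhds x (ε := (ε / 2 - dist x z)) (by linarith)] with y hy
        have hyz : dist y z < ε / 2 := by
          have := dist_triangle y x z; rw [Metric.mem_ball] at hy; linarith
        refine ⟨fun z' hz' hd => (hsame z' hz' z hz ?_), fun hd => absurd (hd z hz)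
          (not_lt.2 hyz.le)⟩
        have := dist_triangle_left z z' y
        linarith
      · push Not at hx
        refine ⟨0, ?_⟩
        filter_upwards [Metric.ball_mem_nhds x (ε := ε / 6) (by linarith)] with y hy
        refine ⟨fun z hz hd => ?_, fun _ => rfl⟩
        have := dist_triangle_left x z y
        rw [Metric.mem_ball] at hy
        linarith [hx z hz])
  refine ⟨g, ⟨g.contMDiff.contDiff, ?_⟩, ?_⟩
  · have hcl : IsClosed (Metric.cthickening (ε / 2) D) := Metric.isClosed_cthickening
    refine (closure_minimal (fun y hy => ?_) hcl).trans fun y hy => ?_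
    · by_contra hc
      refine hy ((hg y).2 fun z hz => ?_)
      by_contra hd
      exact hc (Metric.mem_cthickening_of_dist_le y z (ε / 2) D hz (not_lt.1 hd))
    · rw [φ.isCompact_doubleSet.cthickening_eq_biUnion_closedBall (by linarith)] at hy
      obtain ⟨z, hz, hyz⟩ := mem_iUnion₂.1 hy
      obtain ⟨i, hi⟩ := hεV z hz
      refine hVr i (hi ?_)
      rw [Metric.mem_closedBall] at hyz
      rw [Metric.mem_ball]; linarith
  · intro z hz
    filter_upwards [Metric.ball_mem_nhds z (ε := ε / 3) (by linarith)] with y hy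
    exact (hg y).1 z hz (Metric.mem_ball.1 hy).le

/-- The weight takes the value `f (i(x))` near each double point `x`. -/
structure IsAdapted (φ : ImmersedCurve) (f : ℝ → ℝ) (g : ℝ × ℝ → ℝ) : Prop where
  isWeight : IsWeight g
  eventually_eq : ∀ z ∈ φ.doubleSet, ∀ᶠ y in 𝓝 z, g y = f (φ.ind (φ z.1))

lemma IsAdapted.isFlat {f : ℝ → ℝ} {g : ℝ × ℝ → ℝ} (h : φ.IsAdapted f g) : IsFlat φ g := by
  intro z h1 h2 h3
  have := h.eventually_eq z ⟨h1, h2, h3⟩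
  filter_upwards [this] with y hy
  rw [hy, this.self_of_nhds]

lemma NoTriple.exists_isAdapted (hφ : φ.NoTriple) (f : ℝ → ℝ) : ∃ g, φ.IsAdapted f g := by
  obtain ⟨g, h1, h2⟩ := φ.exists_isWeight (fun z => f (φ.ind (φ z.1))) fun z hz => by
    filter_upwards [eventually_ind_eq_of_onlyTwo hz (hφ.onlyTwo_of_mem hz)] with y hy hyd
    rw [hy (hφ.onlyTwo_of_mem hyd) hyd]
  exact ⟨g, h1, h2⟩

lemma IsAdapted.weightedCount_eq {f : ℝ → ℝ} {g k : ℝ × ℝ → ℝ} (hg : φ.IsAdapted f g)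
    (hk : φ.IsAdapted f k) : φ.weightedCount g = φ.weightedCount k := by
  have h1 := weightedCount_add hg.isWeight (hk.isWeight.const_mul (-1)) hg.isFlat
    (hk.isFlat.const_mul (-1))
  rw [weightedCount_const_mul hk.isWeight, weightedCount_eq_zero
    (hg.isWeight.add (hk.isWeight.const_mul (-1)))] at h1
  · linarith
  · intro z a b c
    filter_upwards [hg.eventually_eq z ⟨a, b, c⟩, hk.eventually_eq z ⟨a, b, c⟩] with y h2 h3
    rw [h2, h3]; ring

end ImmersedCurve

/-! ### The moments of curves with degenerate double points -/

lemma binom_succ (x : ℝ) (β : ℕ) : binom (x + 1) (β + 1) - binom x (β + 1) = binom x β := by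
  have h1 : ∏ j ∈ Finset.range (β + 1), (x + 1 - (j : ℝ)) =
      (∏ j ∈ Finset.range β, (x - (j : ℝ))) * (x + 1) := by
    rw [Finset.prod_range_succ']
    congr 1
    · refine Finset.prod_congr rfl fun j _ => ?_
      push_cast; ring
    · simp
  rw [binom, binom, binom, h1, Finset.prod_range_succ, Nat.factorial_succ]
  have : (β.factorial : ℝ) ≠ 0 := by positivity
  have h2 : (β : ℝ) + 1 ≠ 0 := by positivity
  push_cast
  field_simp
  ring

lemma exists_mem_Ico_angle_eq (s x : ℝ) : ∃ y ∈ Ico s (s + 2 * π), (y : Real.Angle) = x :=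
  ⟨_, toIcoMod_mem_Ico Real.two_pi_pos s x, Real.Angle.coe_toIcoMod x s⟩

namespace ImmersedCurve

variable {φ : ImmersedCurve}

lemma IsBasePoint.exists_int {s : ℝ} (hs : φ.IsBasePoint s) :
    ∃ n : ℤ, φ.ind (φ s) = n + 1 / 2 := by
  obtain ⟨n, hn⟩ := (isStrandSet_singleton hs).exists_int
  exact ⟨n, by simpa using hn⟩

lemma exists_eq_of_not_isBasePoint {s : ℝ} (hs : ¬ φ.IsBasePoint s) :
    ∃ u ∈ Ioo s (s + 2 * π), φ s = φ u := by
  rw [IsBasePoint] at hs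
  push Not at hs
  obtain ⟨x, hx, hxs⟩ := hs
  obtain ⟨y, hy, hyx⟩ := exists_mem_Ico_angle_eq s x
  refine ⟨y, ⟨lt_of_le_of_ne hy.1 ?_, hy.2⟩, ?_⟩
  · rintro rfl; exact hxs hyx.symm
  · rw [← hx, φ.eq_of_angle_eq hyx]

lemma exists_int_of_onlyTwo {a b : ℝ} (h1 : a < b) (h2 : b < a + 2 * π) (hab : φ a = φ b)
    (h : φ.OnlyTwo a b) : ∃ n : ℤ, φ.ind (φ a) = n :=
  (isStrandSet_pair h1 h2 hab h).exists_int_of_pair h1.ne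

open Classical in
/-- The contribution of the base point `φ 0` to the moment.  If it is a double point, a small shift
changes it to a regular point and splits off half of the double point. -/
def baseTerm (φ : ImmersedCurve) (β : ℕ) : ℝ :=
  if φ.IsBasePoint 0 then 2 * binom (φ.ind (φ 0) + 1 / 2) (β + 1)
  else 2 * binom (φ.ind (φ 0)) (β + 1) + binom (φ.ind (φ 0)) β

end ImmersedCurve

lemma abs_int_sub_int_lt {n m : ℤ} (h : |(n : ℝ) - m| < 1) : n = m := by
  have h3 : |n - m| < 1 := by exact_mod_cast h
  rwa [Int.abs_lt_one_iff, sub_eq_zero] at h3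

section

variable {ι : Type*} {Ψ : ι → ImmersedCurve} {l : Filter ι} {φ : ImmersedCurve}

lemma hasSides_self (q : ι → ℂ) (x : ι → ℝ) {s : ℝ} (hx : Tendsto x l (𝓝 s))
    (hq : ∀ i, q i = Ψ i (x i)) : HasSides Ψ l φ q s fun _ => 0 :=
  ⟨x, hx, 1, one_pos, Eventually.of_forall fun i => Or.inl ⟨rfl, hq i⟩⟩

/-- When the base point passes through a double point, the change of its contribution is
proportional to the change of the index. -/
lemma C1Tendsto.eventually_baseTerm (h : C1Tendsto Ψ l φ) (β : ℕ)
    (hφ : ∀ u ∈ Ioo 0 (2 * π), φ 0 = φ u → φ.OnlyTwo 0 u) :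
    ∀ᶠ i in l, (Ψ i).NoTriple →
      (Ψ i).baseTerm β - 2 * binom (φ.ind (φ 0)) β * (Ψ i).ind (Ψ i 0) =
        φ.baseTerm β - 2 * binom (φ.ind (φ 0)) β * φ.ind (φ 0) := by
  have hq : Tendsto (fun i => Ψ i 0) l (𝓝 (φ 0)) := h.tendsto tendsto_const_nhds
  have hint : ∀ i, (Ψ i).NoTriple → ¬ (Ψ i).IsBasePoint 0 → ∃ n : ℤ, (Ψ i).ind (Ψ i 0) = n := by
    intro i hi hb
    obtain ⟨u, hu, hu0⟩ := ImmersedCurve.exists_eq_of_not_isBasePoint hb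
    exact ImmersedCurve.exists_int_of_onlyTwo hu.1 hu.2 hu0 (hi.onlyTwo hu.1 hu.2 hu0)
  by_cases hb : φ.IsBasePoint 0
  · have hT := h.tendsto_ind hq (isStrandSet_singleton hb) (σ := fun _ _ => 0) fun s hs => by
      rw [Finset.mem_singleton.1 hs]
      exact hasSides_self _ (fun _ => 0) tendsto_const_nhds fun i => rfl
    simp only [Finset.sum_const_zero, mul_zero, sub_zero] at hT
    obtain ⟨m, hm⟩ := hb.exists_int
    filter_upwards [hT.eventually (Metric.ball_mem_nhds _ one_half_pos)] with i hi hno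
    rw [Real.dist_eq, hm] at hi
    have hbi : (Ψ i).IsBasePoint 0 := by
      by_contra hbi
      obtain ⟨n, hn⟩ := hint i hno hbi
      rw [hn, abs_lt] at hi
      have h1 : (m : ℝ) < n := by linarith [hi.1]
      have h2 : (n : ℝ) < m + 1 := by linarith [hi.2]
      have h3 : m < n := by exact_mod_cast h1
      have h4 : n < m + 1 := by exact_mod_cast h2
      omega
    obtain ⟨n, hn⟩ := hbi.exists_int
    have : n = m := by
      refine abs_int_sub_int_lt ?_
      rw [hn, show (n : ℝ) + 1 / 2 - (m + 1 / 2) = n - m by ring] at hi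
      linarith
    rw [ImmersedCurve.baseTerm, ImmersedCurve.baseTerm, if_pos hb, if_pos hbi, hn, hm, this]
  · obtain ⟨u, hu, hu0⟩ := ImmersedCurve.exists_eq_of_not_isBasePoint hb
    have hu2 : u < 2 * π := by simpa using hu.2
    have hS := isStrandSet_pair hu.1 hu.2 hu0 (hφ u ⟨hu.1, hu2⟩ hu0)
    obtain ⟨σ, hσ, hσ1⟩ := h.exists_hasSides (q := fun i => Ψ i 0) (s := u) (by rwa [← hu0])
    have hT := h.tendsto_ind hq hS (σ := fun s i => if s = 0 then 0 else σ i) fun s hs => by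
      simp only [Finset.mem_insert, Finset.mem_singleton] at hs
      rcases hs with rfl | rfl
      · simp only [if_pos]
        exact hasSides_self _ (fun _ => 0) tendsto_const_nhds fun i => rfl
      · simpa only [if_neg hu.1.ne'] using hσ
    obtain ⟨m, hm⟩ := ImmersedCurve.exists_int_of_onlyTwo hu.1 hu.2 hu0 (hφ u ⟨hu.1, hu2⟩ hu0)
    filter_upwards [hT.eventually (Metric.ball_mem_nhds _ one_half_pos)] with i hi hno
    have h1 : |(Ψ i).ind (Ψ i 0) - m| < 1 := by
      rw [Finset.sum_pair hu.1.ne, if_pos rfl, if_neg hu.1.ne', Real.dist_eq, hm, abs_lt] at hi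
      have := abs_le.1 (hσ1 i)
      rw [abs_lt]
      constructor <;> linarith [hi.1, hi.2]
    have e1 := binom_succ m β
    rw [ImmersedCurve.baseTerm, ImmersedCurve.baseTerm, if_neg hb, hm]
    by_cases hbi : (Ψ i).IsBasePoint 0
    · obtain ⟨n, hn⟩ := hbi.exists_int
      rw [hn, abs_lt] at h1
      have h2 : (n : ℝ) < m + 1 := by linarith [h1.2]
      have h3 : (m : ℝ) < n + 2 := by linarith [h1.1]
      have h4 : n < m + 1 := by exact_mod_cast h2
      have h5 : m < n + 2 := by exact_mod_cast h3
      rw [if_pos hbi, hn]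
      obtain rfl | rfl : n = m ∨ n = m - 1 := by omega
      · rw [add_assoc, add_halves]
        linarith
      · push_cast
        rw [show (m : ℝ) - 1 + 1 / 2 + 1 / 2 = m by ring]
        ring
    · obtain ⟨n, hn⟩ := hint i hno hbi
      rw [hn] at h1
      rw [if_neg hbi, hn, abs_int_sub_int_lt h1]

end

namespace ImmersedCurve

variable {φ : ImmersedCurve}

open Classical in
/-- The `β`-th moment of a curve without triple points whose double points may be arbitrarily
degenerate, computed with the base point `φ 0`.  It does not depend on the choice of the weight
(`IsAdapted.doodleMoment_eq`); adapted weights exist for all curves without triple points. -/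
def doodleMoment (φ : ImmersedCurve) (β : ℕ) : ℝ :=
  if h : ∃ g, φ.IsAdapted (fun x => binom x β) g then
    φ.baseTerm β + φ.weightedCount h.choose else 0

lemma IsAdapted.doodleMoment_eq {β : ℕ} {g : ℝ × ℝ → ℝ}
    (hg : φ.IsAdapted (fun x => binom x β) g) :
    φ.doodleMoment β = φ.baseTerm β + φ.weightedCount g := by
  have h : ∃ g, φ.IsAdapted (fun x => binom x β) g := ⟨g, hg⟩
  rw [doodleMoment, dif_pos h, h.choose_spec.weightedCount_eq hg]

end ImmersedCurve

section

variable {ι : Type*} {Ψ : ι → ImmersedCurve} {l : Filter ι} {φ : ImmersedCurve}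

lemma C1Tendsto.eventually_isAdapted (h : C1Tendsto Ψ l φ) (hφ : φ.NoTriple) {f : ℝ → ℝ}
    {g : ℝ × ℝ → ℝ} (hg : φ.IsAdapted f g) :
    ∀ᶠ i in l, (Ψ i).NoTriple → (Ψ i).IsAdapted f g := by
  have key : ∀ᶠ i in l, ∀ z ∈ box, z ∈ pairRegion → Ψ i z.1 = Ψ i z.2 → (Ψ i).OnlyTwo z.1 z.2 →
      ∀ᶠ y in 𝓝 z, g y = f ((Ψ i).ind (Ψ i z.1)) := by
    refine eventually_forall_of_isCompact isCompact_box fun z hz => ?_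
    by_cases hzd : z ∈ φ.doubleSet
    · filter_upwards [h.eventually_ind_eq_prod hzd (hφ.onlyTwo_of_mem hzd),
        (hg.eventually_eq z hzd).eventually_nhds.prod_inr l] with w h1 h2 h3 h4 h5
      filter_upwards [h2] with y hy
      rw [hy, h1 h5 h4]
    · filter_upwards [h.eventually_mem_doubleSet hz] with w h1 h2 h3
      exact absurd (h1 h2 h3) hzd
  filter_upwards [key] with i hi hno
  exact ⟨hg.isWeight, fun z hz => hi z hz.1 hz.2.1 hz.2.2 (hno.onlyTwo_of_mem hz)⟩

lemma C1Tendsto.eventually_weightedCount_add_baseTerm (h : C1Tendsto Ψ l φ) {β : ℕ}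
    {g : ℝ × ℝ → ℝ} (hg : φ.IsAdapted (fun x => binom x β) g)
    (hφ : ∀ u ∈ Ioo 0 (2 * π), φ 0 = φ u → φ.OnlyTwo 0 u) :
    ∀ᶠ i in l, (Ψ i).NoTriple → (Ψ i).baseTerm β + (Ψ i).weightedCount g =
      φ.baseTerm β + φ.weightedCount g := by
  have hc : ∀ u ∈ Ioo 0 (2 * π), φ u = φ 0 →
      g (0, u) = binom (φ.ind (φ 0)) β ∧ g (u, 2 * π) = binom (φ.ind (φ 0)) β := by
    intro u hu hu0
    have hpi := Real.two_pi_pos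
    have e0 : φ (2 * π) = φ 0 := by simpa using φ.periodic 0
    constructor
    · exact (hg.eventually_eq (0, u) ⟨mem_box.2 ⟨⟨le_rfl, hpi.le⟩, hu.1.le, hu.2.le⟩,
        ⟨hu.1, by simpa using hu.2⟩, hu0.symm⟩).self_of_nhds
    · rw [← hu0]
      exact (hg.eventually_eq (u, 2 * π) ⟨mem_box.2 ⟨⟨hu.1.le, hu.2.le⟩, hpi.le, le_rfl⟩,
        ⟨hu.2, by simpa using hu.1⟩, by rw [hu0, e0]⟩).self_of_nhds
  filter_upwards [h.eventually_weightedCount hg.isWeight hg.isFlat hc,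
    h.eventually_baseTerm β hφ] with i h1 h2 hno
  linarith [h2 hno]

/-- The moment is locally constant on curves without triple points. -/
theorem C1Tendsto.eventually_doodleMoment (h : C1Tendsto Ψ l φ) (hφ : φ.NoTriple) (β : ℕ) :
    ∀ᶠ i in l, (Ψ i).NoTriple → (Ψ i).doodleMoment β = φ.doodleMoment β := by
  obtain ⟨g, hg⟩ := hφ.exists_isAdapted (fun x => binom x β)
  filter_upwards [h.eventually_isAdapted hφ hg, h.eventually_weightedCount_add_baseTerm hg
    fun u hu hu0 => hφ.onlyTwo hu.1 (by simpa using hu.2) hu0] with i h1 h2 hno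
  rw [(h1 hno).doodleMoment_eq, hg.doodleMoment_eq, h2 hno]

end

/-! ### Invariance along paths -/

lemma c1Tendsto_of_continuous {X : Type*} [TopologicalSpace X] {γ : X → ImmersedCurve}
    (h0 : Continuous fun p : X × ℝ => γ p.1 p.2)
    (h1 : Continuous fun p : X × ℝ => deriv (γ p.1) p.2) (t : X) : C1Tendsto γ (𝓝 t) (γ t) := by
  have key : ∀ f : X → ℝ → ℂ, Continuous (fun p : X × ℝ => f p.1 p.2) →
      (∀ x, Function.Periodic (f x) (2 * π)) → TendstoUniformly f (f t) (𝓝 t) := by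
    intro f hf hp
    rw [Metric.tendstoUniformly_iff]
    intro ε hε
    have h : ∀ᶠ x in 𝓝 t, ∀ s ∈ Icc (0 : ℝ) (2 * π), dist (f t s) (f x s) < ε := by
      refine eventually_forall_of_isCompact isCompact_Icc fun s _ => ?_
      have hc : Continuous fun p : X × ℝ => dist (f t p.2) (f p.1 p.2) :=
        (hf.comp (continuous_const.prodMk continuous_snd)).dist hf
      have := (hc.tendsto (t, s)).eventually (gt_mem_nhds (show dist (f t s) (f t s) < ε by simpa))
      rwa [nhds_prod_eq] at this
    filter_upwards [h] with x hx s
    obtain ⟨y, hy, hys⟩ := Function.Periodic.exists_mem_Ico₀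
      (f := fun s => (f t s, f x s)) (fun s => Prod.ext (hp t s) (hp x s)) Real.two_pi_pos s
    rw [Prod.mk.injEq] at hys
    rw [hys.1, hys.2]
    exact hx y ⟨hy.1, hy.2.le⟩
  exact ⟨key (fun x => γ x) h0 fun x => (γ x).periodic,
    key (fun x => deriv (γ x)) h1 fun x => (γ x).periodic_deriv⟩

lemma doodleMoment_eq_of_path {X : Type*} [TopologicalSpace X] [PreconnectedSpace X]
    {γ : X → ImmersedCurve} (h0 : Continuous fun p : X × ℝ => γ p.1 p.2)
    (h1 : Continuous fun p : X × ℝ => deriv (γ p.1) p.2) (hγ : ∀ t, (γ t).NoTriple) (β : ℕ)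
    (s t : X) : (γ s).doodleMoment β = (γ t).doodleMoment β := by
  have : IsLocallyConstant fun t => (γ t).doodleMoment β := by
    rw [IsLocallyConstant.iff_eventually_eq]
    intro t
    filter_upwards [(c1Tendsto_of_continuous h0 h1 t).eventually_doodleMoment (hγ t) β] with x hx
    exact hx (hγ x)
  exact this.apply_eq_of_preconnectedSpace s t

lemma IDoodle.Equivalent.doodleMoment_eq {φ ψ : IDoodle} (h : φ.Equivalent ψ) (β : ℕ) :
    φ.doodleMoment β = ψ.doodleMoment β := by
  obtain ⟨γ, h0, h1, hc⟩ := h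
  have e := doodleMoment_eq_of_path (γ := fun t => (γ t).toImmersedCurve)
    (by simpa using hc 0) (by simpa using hc 1) (fun t => (γ t).no_triple) β 0 1
  simpa only [h0, h1] using e

/-! ### Shifting the parameter -/

namespace ImmersedCurve

/-- The same curve with its parameter shifted by `s`. -/
def shift (φ : ImmersedCurve) (s : ℝ) : ImmersedCurve where
  toFun x := φ (x + s)
  smooth := φ.smooth.comp (contDiff_id.add contDiff_const)
  periodic x := by
    change φ (x + 2 * π + s) = φ (x + s)
    rw [add_right_comm, φ.periodic]
  immersion x := by rw [deriv_comp_add_const]; exact φ.immersion _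

variable {φ : ImmersedCurve}

lemma shift_apply (s x : ℝ) : φ.shift s x = φ (x + s) := rfl

lemma deriv_shift (s x : ℝ) : deriv (φ.shift s) x = deriv φ (x + s) :=
  deriv_comp_add_const φ.toFun s x

lemma ind_shift (s : ℝ) (p : ℂ) : (φ.shift s).ind p = φ.ind p := by
  rw [φ.ind_eq_integral p s, ind_eq]
  simp only [angularSpeed, shift_apply, deriv_shift]
  rw [intervalIntegral.integral_comp_add_right (fun x => (deriv φ x / (φ x - p)).im), zero_add,
    add_comm]

lemma indNear_shift (s : ℝ) (p w : ℂ) : (φ.shift s).indNear p w = φ.indNear p w := by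
  simp only [indNear, ind_shift]

lemma IsTriple.of_shift {s x y z : ℝ} (h : (φ.shift s).IsTriple x y z) :
    φ.IsTriple (x + s) (y + s) (z + s) := by
  obtain ⟨h1, h2, h3, h4, h5⟩ := h
  refine ⟨?_, ?_, ?_, h4, h5⟩
  all_goals
    rw [Real.Angle.coe_add, Real.Angle.coe_add]
    intro h
    have := add_right_cancel h
    contradiction

lemma NoTriple.shift (h : φ.NoTriple) (s : ℝ) : (φ.shift s).NoTriple :=
  fun _ _ _ ht => h _ _ _ ht.of_shift

lemma NoTriple.doodleMoment_shift (h : φ.NoTriple) (s : ℝ) (β : ℕ) :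
    (φ.shift s).doodleMoment β = φ.doodleMoment β := by
  have e := doodleMoment_eq_of_path (γ := fun t : ℝ => φ.shift t)
    (φ.continuous.comp (continuous_snd.add continuous_fst)) (by
      simp only [deriv_shift]
      exact φ.continuous_deriv.comp (continuous_snd.add continuous_fst)) (fun t => h.shift t) β s 0
  have h0 : φ.shift 0 = φ := by
    obtain ⟨f, _, _, _⟩ := φ
    simp [ImmersedCurve.shift]
  rw [e, h0]

lemma isBasePoint_shift {s : ℝ} : (φ.shift s).IsBasePoint 0 ↔ φ.IsBasePoint s := by
  constructor
  · intro h x hx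
    have := h (x - s) (by simpa [shift_apply] using hx)
    rw [Real.Angle.coe_sub, Real.Angle.coe_zero, sub_eq_zero] at this
    exact this
  · intro h x hx
    have := h (x + s) (by simpa [shift_apply] using hx)
    rw [Real.Angle.coe_add, add_eq_right] at this
    rw [this, Real.Angle.coe_zero]

end ImmersedCurve

/-- The same regular I-doodle with its parameter shifted by `s`. -/
def RegularIDoodle.shift (φ : RegularIDoodle) (s : ℝ) : RegularIDoodle where
  toImmersedCurve := φ.toImmersedCurve.shift s
  no_triple := ImmersedCurve.NoTriple.shift φ.no_triple s
  transverse x y hxy h := by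
    have := φ.transverse (x + s) (y + s) (by
      rw [Real.Angle.coe_add, Real.Angle.coe_add]
      exact fun h => hxy (add_right_cancel h)) h
    rwa [← ImmersedCurve.deriv_shift, ← ImmersedCurve.deriv_shift] at this

lemma RegularIDoodle.moment_shift (φ : RegularIDoodle) (β : ℕ) (s : ℝ) :
    (φ.shift s).moment β 0 = φ.moment β s := by
  have e1 : ∀ a b, (φ.shift s).doubleSign a b = φ.doubleSign (a + s) (b + s) := fun a b => by
    simp only [ImmersedCurve.doubleSign, RegularIDoodle.shift, ImmersedCurve.deriv_shift]
  have e2 : ∀ a b, (φ.shift s).doubleIndex a b = φ.doubleIndex (a + s) (b + s) := fun a b => by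
    simp only [ImmersedCurve.doubleIndex, RegularIDoodle.shift, ImmersedCurve.deriv_shift,
      ImmersedCurve.indNear_shift, ImmersedCurve.shift_apply]
  have e3 : (φ.shift s).baseIndex 0 = φ.baseIndex s := by
    simp only [ImmersedCurve.baseIndex, RegularIDoodle.shift, ImmersedCurve.deriv_shift,
      ImmersedCurve.indNear_shift, ImmersedCurve.shift_apply, zero_add]
  have e4 : ∀ p : ℝ × ℝ, p ∈ (φ.shift s).doublePairs 0 ↔
      (Equiv.addRight (s, s)) p ∈ φ.doublePairs s := by
    intro p
    simp only [ImmersedCurve.doublePairs, RegularIDoodle.shift, ImmersedCurve.shift_apply,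
      Set.mem_ofPred_eq, Equiv.coe_addRight, Prod.fst_add, Prod.snd_add]
    refine and_congr ?_ (and_congr ?_ (and_congr ?_ Iff.rfl))
    · constructor <;> intro h <;> linarith
    · constructor <;> intro h <;> linarith
    · constructor <;> intro h <;> linarith
  rw [RegularIDoodle.moment, RegularIDoodle.moment, e3]
  congr 1
  refine Eq.trans ?_ (finsum_comp_equiv (Equiv.addRight (s, s)))
  refine finsum_congr fun p => ?_
  rw [e1, e2]
  refine finsum_congr_Prop (propext (e4 p)) fun _ => rfl

/-! ### Regular curves -/

namespace ImmersedCurve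

variable {φ : ImmersedCurve}

/-- Transverse double points are isolated. -/
lemma eventually_eq_of_transverse {z : ℝ × ℝ} (hz : φ z.1 = φ z.2)
    (hc : cross (deriv φ z.2) (deriv φ z.1) ≠ 0) : ∀ᶠ y in 𝓝 z, φ y.1 = φ y.2 → y = z := by
  obtain ⟨κ, hκ, hκ2⟩ : ∃ κ : ℝ, 0 < κ * cross (deriv φ z.2) (deriv φ z.1) ∧ κ * κ = 1 := by
    rcases lt_or_gt_of_ne hc with h | h
    · exact ⟨-1, by linarith, by norm_num⟩
    · exact ⟨1, by linarith, by norm_num⟩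
  obtain ⟨γ, hγ⟩ := exists_linear_model hz hκ hκ2
  filter_upwards [hγ] with y hy hyφ
  by_contra hne
  have := hy hne
  rw [hyφ, sub_self, zero_div] at this
  simp at this

lemma finite_doubleSet
    (h : ∀ z ∈ φ.doubleSet, cross (deriv φ z.2) (deriv φ z.1) ≠ 0) : φ.doubleSet.Finite := by
  obtain ⟨t, ht⟩ := φ.isCompact_doubleSet.elim_nhds_subcover'
    (fun z hz => {y | φ y.1 = φ y.2 → y = z})
    (fun z hz => eventually_eq_of_transverse hz.2.2 (h z hz))
  refine (t.finite_toSet.image Subtype.val).subset fun y hy => ?_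
  obtain ⟨z, hz, hyz⟩ := mem_iUnion₂.1 (ht hy)
  exact ⟨z, hz, (hyz hy.2.2).symm⟩

/-- If all double points are transverse, the weighted count is the sum over the double points. -/
lemma IsAdapted.weightedCount_eq_sum {f : ℝ → ℝ} {g : ℝ × ℝ → ℝ} (hg : φ.IsAdapted f g)
    (h : ∀ z ∈ φ.doubleSet, cross (deriv φ z.2) (deriv φ z.1) ≠ 0)
    (hint : ∀ z ∈ φ.doubleSet, 0 < z.1 ∧ z.2 < 2 * π) {S : Finset (ℝ × ℝ)}
    (hS : (S : Set (ℝ × ℝ)) = φ.doubleSet) :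
    φ.weightedCount g = ∑ z ∈ S, φ.doubleSign z.1 z.2 * f (φ.ind (φ z.1)) := by
  classical
  have hmem : ∀ z, z ∈ S ↔ z ∈ φ.doubleSet := fun z => by rw [← hS, Finset.mem_coe]
  have hk : ∀ z : ℝ × ℝ, ∃ k : ℝ × ℝ → ℝ, z ∈ S → IsWeight k ∧ IsFlat φ k ∧
      tsupport k ⊆ (↑(S.erase z))ᶜ ∧ (∀ᶠ y in 𝓝 z, k y = 1) ∧
      φ.weightedCount k = φ.doubleSign z.1 z.2 := by
    intro z
    by_cases hz : z ∈ S
    · have hzD := (hmem z).1 hz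
      obtain ⟨k, hk⟩ := exists_bump (U := (↑(S.erase z))ᶜ) (hint z hzD).1 hzD.2.1.1
        (hint z hzD).2 hzD.2.2 (h z hzD) ((S.erase z).finite_toSet.isClosed.isOpen_compl.mem_nhds
          (by simp))
      exact ⟨k, fun _ => hk⟩
    · exact ⟨0, fun h => absurd h hz⟩
  choose k hk using hk
  obtain ⟨w1, w2, w3⟩ := weightedCount_sum (φ := φ) S
    (g := fun z y => f (φ.ind (φ z.1)) * k z y) (fun z hz => (hk z hz).1.const_mul _)
    (fun z hz => (hk z hz).2.1.const_mul _)
  have hadm : φ.IsAdapted f (fun y => ∑ z ∈ S, f (φ.ind (φ z.1)) * k z y) := by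
    refine ⟨w1, fun z hz => ?_⟩
    have hzS := (hmem z).2 hz
    have h0 : ∀ᶠ y in 𝓝 z, ∀ x ∈ S.erase z, k x y = 0 := by
      rw [Finset.eventually_all]
      intro x hx
      have hxS := Finset.mem_of_mem_erase hx
      refine notMem_tsupport_iff_eventuallyEq.1 fun hzx => (hk x hxS).2.2.1 hzx ?_
      exact Finset.mem_coe.2 (Finset.mem_erase.2 ⟨(Finset.ne_of_mem_erase hx).symm, hzS⟩)
    filter_upwards [h0, (hk z hzS).2.2.2.1] with y hy hy1
    rw [← Finset.add_sum_erase S _ hzS, hy1,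
      Finset.sum_eq_zero fun x hx => by rw [hy x hx, mul_zero]]
    simp
  rw [hg.weightedCount_eq hadm, w3]
  refine Finset.sum_congr rfl fun z hz => ?_
  rw [weightedCount_const_mul (hk z hz).1, (hk z hz).2.2.2.2, mul_comm]

lemma angle_ne_of_mem_pairRegion {z : ℝ × ℝ} (hz : z ∈ pairRegion) : (z.1 : Real.Angle) ≠ z.2 :=
  angle_ne_of_lt hz.1 hz.2

/-- If the base point is a regular point, the pairs of parameters of the double points are in the
interior of the square. -/
lemma IsBasePoint.mem_interior (h : φ.IsBasePoint 0) {z : ℝ × ℝ} (hz : z ∈ φ.doubleSet) :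
    0 < z.1 ∧ z.2 < 2 * π := by
  obtain ⟨hb, hr, hφ⟩ := hz
  rw [mem_box] at hb
  constructor
  · refine lt_of_le_of_ne hb.1.1 fun h0 => ?_
    have := h z.2 (by rw [← hφ, ← h0])
    rw [h0] at this
    exact angle_ne_of_mem_pairRegion hr this.symm
  · refine lt_of_le_of_ne hb.2.2 fun h0 => ?_
    have := h z.1 (by rw [hφ, h0]; simpa using φ.periodic 0)
    refine angle_ne_of_mem_pairRegion hr ?_
    rw [this, h0, Real.Angle.coe_two_pi, Real.Angle.coe_zero]

lemma IsBasePoint.doublePairs_eq (h : φ.IsBasePoint 0) : φ.doublePairs 0 = φ.doubleSet := by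
  ext z
  constructor
  · rintro ⟨h1, h2, h3, h4⟩
    rw [zero_add] at h3
    exact ⟨mem_box.2 ⟨⟨h1.le, by linarith⟩, by linarith, h3.le⟩, ⟨h2, by linarith⟩, h4⟩
  · intro hz
    have := h.mem_interior hz
    exact ⟨this.1, hz.2.1.1, by simpa using this.2, hz.2.2⟩

end ImmersedCurve

namespace RegularIDoodle

lemma cross_ne_zero (φ : RegularIDoodle) {z : ℝ × ℝ} (hz : z ∈ φ.doubleSet) :
    cross (deriv φ z.2) (deriv φ z.1) ≠ 0 :=
  φ.transverse _ _ (ImmersedCurve.angle_ne_of_mem_pairRegion hz.2.1).symm hz.2.2.symm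

lemma noTriple (φ : RegularIDoodle) : φ.NoTriple := φ.no_triple

lemma doubleIndex_eq_ind (φ : RegularIDoodle) {z : ℝ × ℝ} (hz : z ∈ φ.doubleSet) :
    φ.doubleIndex z.1 z.2 = φ.ind (φ z.1) :=
  ImmersedCurve.doubleIndex_eq hz.2.1.1 hz.2.1.2 hz.2.2 (φ.noTriple.onlyTwo_of_mem hz)
    (φ.transverse _ _ (ImmersedCurve.angle_ne_of_mem_pairRegion hz.2.1) hz.2.2)

lemma moment_zero_eq_sum (φ : RegularIDoodle) {β : ℕ} (h : φ.IsBasePoint 0) {S : Finset (ℝ × ℝ)}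
    (hS : (S : Set (ℝ × ℝ)) = φ.doubleSet) : φ.moment β 0 =
      (∑ z ∈ S, φ.doubleSign z.1 z.2 * binom (φ.ind (φ z.1)) β) +
        2 * binom (φ.ind (φ 0) + 1 / 2) (β + 1) := by
  rw [moment, h.doublePairs_eq, ImmersedCurve.baseIndex_eq h, ← hS, finsum_mem_coe_finset]
  congr 1
  refine Finset.sum_congr rfl fun z hz => ?_
  rw [φ.doubleIndex_eq_ind (by rw [← hS]; exact hz)]

lemma moment_zero_eq (φ : RegularIDoodle) {β : ℕ} (h : φ.IsBasePoint 0) :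
    φ.moment β 0 = φ.doodleMoment β := by
  obtain ⟨g, hg⟩ := φ.noTriple.exists_isAdapted (fun x => binom x β)
  have hfin := ImmersedCurve.finite_doubleSet fun z hz => φ.cross_ne_zero hz
  have hS : (hfin.toFinset : Set (ℝ × ℝ)) = φ.doubleSet := hfin.coe_toFinset
  rw [hg.doodleMoment_eq, hg.weightedCount_eq_sum (fun z hz => φ.cross_ne_zero hz)
    (fun z hz => h.mem_interior hz) hS, φ.moment_zero_eq_sum h hS, ImmersedCurve.baseTerm, if_pos h,
    add_comm]

theorem moment_eq_doodleMoment (φ : RegularIDoodle) {β : ℕ} {s : ℝ} (h : φ.IsBasePoint s) :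
    φ.moment β s = φ.doodleMoment β := by
  rw [← φ.moment_shift, moment_zero_eq _ (ImmersedCurve.isBasePoint_shift.2 h)]
  exact φ.noTriple.doodleMoment_shift s β

lemma exists_isBasePoint (φ : RegularIDoodle) : ∃ s, φ.IsBasePoint s := by
  have hfin := ImmersedCurve.finite_doubleSet fun z hz => φ.cross_ne_zero hz
  obtain ⟨s, hs, hsn⟩ := (Ioo_infinite Real.two_pi_pos).exists_notMem_finite
    ((hfin.image Prod.fst).union (hfin.image Prod.snd))
  refine ⟨s, fun x hx => ?_⟩
  obtain ⟨y, hy, hyx⟩ := exists_mem_Ico_angle_eq 0 x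
  rw [zero_add] at hy
  rw [← hyx]
  have hys : φ y = φ s := by rw [φ.eq_of_angle_eq hyx, hx]
  rcases lt_trichotomy y s with h | h | h
  · refine absurd (Or.inr ⟨(y, s), ⟨mem_box.2 ⟨⟨hy.1, hy.2.le⟩, hs.1.le, hs.2.le⟩, ⟨h, ?_⟩, hys⟩,
      rfl⟩) hsn
    change s < y + 2 * π
    linarith [hy.1, hs.2]
  · rw [h]
  · refine absurd (Or.inl ⟨(s, y), ⟨mem_box.2 ⟨⟨hs.1.le, hs.2.le⟩, hy.1, hy.2.le⟩, ⟨h, ?_⟩,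
      hys.symm⟩, rfl⟩) hsn
    change y < s + 2 * π
    linarith [hy.2, hs.1]

lemma exists_int_doodleMoment_one (φ : RegularIDoodle) : ∃ n : ℤ, φ.doodleMoment 1 = n := by
  obtain ⟨s, hs⟩ := φ.exists_isBasePoint
  set ψ := φ.shift s
  have hψ : ψ.IsBasePoint 0 := ImmersedCurve.isBasePoint_shift.2 hs
  have hfin := ImmersedCurve.finite_doubleSet fun z hz => ψ.cross_ne_zero hz
  have h1 : φ.doodleMoment 1 = ψ.moment 1 0 := by
    rw [φ.moment_shift, φ.moment_eq_doodleMoment hs]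
  rw [h1, ψ.moment_zero_eq_sum hψ hfin.coe_toFinset]
  obtain ⟨m, hm⟩ := hψ.exists_int
  have h2 : 2 * binom (ψ.ind (ψ 0) + 1 / 2) (1 + 1) = ((m + 1) * m : ℤ) := by
    rw [hm]
    simp [binom, Finset.prod_range_succ]
    ring
  have h3 : ∀ z ∈ hfin.toFinset, ∃ n : ℤ,
      ψ.doubleSign z.1 z.2 * binom (ψ.ind (ψ z.1)) 1 = n := by
    intro z hz
    rw [Set.Finite.mem_toFinset] at hz
    obtain ⟨n, hn⟩ := ImmersedCurve.exists_int_of_onlyTwo hz.2.1.1 hz.2.1.2 hz.2.2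
      (ψ.noTriple.onlyTwo_of_mem hz)
    refine ⟨SignType.sign (cross (deriv ψ z.2) (deriv ψ z.1)) * n, ?_⟩
    rw [hn, ImmersedCurve.doubleSign]
    simp [binom]
  choose! n hn using h3
  refine ⟨∑ z ∈ hfin.toFinset, n z + (m + 1) * m, ?_⟩
  rw [h2, Finset.sum_congr rfl hn]
  push_cast
  ring

end RegularIDoodle

/-! ### Passing a triple point -/

section

variable {γ : ℝ → ImmersedCurve}

lemma deriv_curve_eq (hγ : ContDiff ℝ ∞ fun p : ℝ × ℝ => γ p.1 p.2) (t x : ℝ) :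
    deriv (γ t) x = fderiv ℝ (fun p : ℝ × ℝ => γ p.1 p.2) (t, x) (0, 1) :=
  (HasFDerivAt.comp_hasDerivAt (f := fun x : ℝ => (t, x)) x
    ((hγ.differentiable (by simp)) (t, x)).hasFDerivAt
    ((hasDerivAt_const x t).prodMk (hasDerivAt_id x))).deriv

lemma deriv_time_eq (hγ : ContDiff ℝ ∞ fun p : ℝ × ℝ => γ p.1 p.2) (t x : ℝ) :
    deriv (fun τ => γ τ x) t = fderiv ℝ (fun p : ℝ × ℝ => γ p.1 p.2) (t, x) (1, 0) :=
  (HasFDerivAt.comp_hasDerivAt (f := fun t : ℝ => (t, x)) t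
    ((hγ.differentiable (by simp)) (t, x)).hasFDerivAt
    ((hasDerivAt_id t).prodMk (hasDerivAt_const t x))).deriv

lemma c1Tendsto_of_contDiff (hγ : ContDiff ℝ ∞ fun p : ℝ × ℝ => γ p.1 p.2) (t : ℝ) :
    C1Tendsto γ (𝓝 t) (γ t) := by
  refine c1Tendsto_of_continuous hγ.continuous ?_ t
  simp only [deriv_curve_eq hγ]
  exact (hγ.continuous_fderiv (by simp)).clm_apply continuous_const

variable {X : Type*} {L : Filter X}

lemma isLittleO_curve (hγ : ContDiff ℝ ∞ fun p : ℝ × ℝ => γ p.1 p.2) {t₀ a : ℝ} {t x : X → ℝ}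
    (ht : Tendsto t L (𝓝 t₀)) (hx : Tendsto x L (𝓝 a)) :
    (fun z => γ (t z) (x z) - γ t₀ a - ((t z - t₀) • deriv (fun τ => γ τ a) t₀ +
      (x z - a) • deriv (γ t₀) a)) =o[L] fun z => |t z - t₀| + |x z - a| := by
  have h := ((hγ.differentiable (by simp)) (t₀, a)).hasFDerivAt.isLittleO.comp_tendsto
    (ht.prodMk_nhds hx)
  refine (h.congr_left fun z => ?_).trans_le fun z => ?_
  · simp only [Function.comp_apply]
    rw [deriv_curve_eq hγ, deriv_time_eq hγ, ← map_smul, ← map_smul, ← map_add]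
    simp
  · simp only [Function.comp_apply, Prod.norm_def, Prod.fst_sub, Prod.snd_sub, Real.norm_eq_abs]
    exact (max_le (le_add_of_nonneg_right (abs_nonneg _))
      (le_add_of_nonneg_left (abs_nonneg _))).trans (le_abs_self _)

lemma isLittleO_cross {r : X → ℂ} {N : X → ℝ} (h : r =o[L] N) (u : ℂ) :
    (fun z => cross (r z) u) =o[L] N := by
  refine Asymptotics.IsBigO.trans_isLittleO (g := r) (Asymptotics.IsBigO.of_bound ‖u‖ ?_) h
  exact Eventually.of_forall fun z => by
    rw [Real.norm_eq_abs, mul_comm]; exact norm_cross_le _ _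

/-- When a triple point is resolved, the crossing of two strands near it is on that side of the
third strand which the defect tells. -/
lemma hasSides_of_defect_ne_zero (hγ : ContDiff ℝ ∞ fun p : ℝ × ℝ => γ p.1 p.2) {t₀ a b c : ℝ}
    (hab : γ t₀ a = γ t₀ b) (hac : γ t₀ a = γ t₀ c)
    (hc : cross (deriv (γ t₀) a) (deriv (γ t₀) b) ≠ 0) (hD : defectAt γ t₀ a b c ≠ 0)
    {t x y : X → ℝ} (ht : Tendsto t L (𝓝[≠] t₀)) (hx : Tendsto x L (𝓝 a))
    (hy : Tendsto y L (𝓝 b)) (heq : ∀ᶠ z in L, γ (t z) (x z) = γ (t z) (y z)) :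
    HasSides (fun z => γ (t z)) L (γ t₀) (fun z => γ (t z) (x z)) c fun z =>
      -(SignType.sign (t z - t₀) : ℝ) * (SignType.sign (defectAt γ t₀ a b c) : ℝ) *
        (SignType.sign (cross (deriv (γ t₀) a) (deriv (γ t₀) b)) : ℝ) := by
  have ht' : Tendsto t L (𝓝 t₀) := ht.mono_right nhdsWithin_le_nhds
  have hne : ∀ᶠ z in L, t z ≠ t₀ := ht.eventually self_mem_nhdsWithin
  set p := γ t₀ a with hp
  have ra := isLittleO_curve hγ ht' hx
  have rb := isLittleO_curve hγ ht' hy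
  have rc := isLittleO_curve hγ ht' (tendsto_const_nhds (x := c))
  rw [← hab] at rb
  rw [← hac] at rc
  rw [← hp] at ra
  simp only [sub_self, abs_zero, add_zero, zero_smul] at rc
  rw [defectAt] at hD ⊢
  set ua := deriv (γ t₀) a
  set ub := deriv (γ t₀) b
  set uc := deriv (γ t₀) c
  set va := deriv (fun τ => γ τ a) t₀
  set vb := deriv (fun τ => γ τ b) t₀
  set vc := deriv (fun τ => γ τ c) t₀
  set D := crossingDefect ua ub uc va vb vc with hDdef
  set k := cross ua ub with hk
  set Ra : X → ℂ := fun z => γ (t z) (x z) - p - ((t z - t₀) • va + (x z - a) • ua) with hRa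
  set Rb : X → ℂ := fun z => γ (t z) (y z) - p - ((t z - t₀) • vb + (y z - b) • ub) with hRb
  set Rc : X → ℂ := fun z => γ (t z) c - p - (t z - t₀) • vc with hRc
  set N : X → ℝ := fun z => |t z - t₀| + |x z - a| + |y z - b| with hN
  have ra' : Ra =o[L] N := ra.trans_le fun z => by
    rw [Real.norm_of_nonneg (by positivity : 0 ≤ |t z - t₀| + |x z - a|),
      Real.norm_of_nonneg (by positivity : 0 ≤ N z)]
    exact le_add_of_nonneg_right (abs_nonneg _)
  have rb' : Rb =o[L] N := rb.trans_le fun z => by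
    rw [Real.norm_of_nonneg (by positivity : 0 ≤ |t z - t₀| + |y z - b|),
      Real.norm_of_nonneg (by positivity : 0 ≤ N z)]
    simp only [hN]
    linarith [abs_nonneg (x z - a)]
  have rba : (fun z => Rb z - Ra z) =o[L] N := rb'.sub ra'
  -- the position of the crossing on the two strands, to first order
  have e1 : ∀ z, γ (t z) (x z) = γ (t z) (y z) →
      (x z - a) * k = cross (Rb z - Ra z) ub + (t z - t₀) * cross (vb - va) ub ∧
      (y z - b) * k = cross (Rb z - Ra z) ua + (t z - t₀) * cross (vb - va) ua := by
    intro z hz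
    simp only [hRa, hRb, hz, hk, cross]
    constructor
    all_goals
      simp
      ring
  have hkpos : 0 < |k| := abs_pos.2 hc
  -- the crossing moves with bounded speed
  have hNO : N =O[L] fun z => t z - t₀ := by
    have s1 := (isLittleO_cross rba ub).def (c := |k| / 4) (by positivity)
    have s2 := (isLittleO_cross rba ua).def (c := |k| / 4) (by positivity)
    refine Asymptotics.IsBigO.of_bound
      (2 * (|k| + |cross (vb - va) ub| + |cross (vb - va) ua|) / |k|) ?_
    filter_upwards [s1, s2, heq] with z s1 s2 hz
    obtain ⟨f1, f2⟩ := e1 z hz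
    simp only [Real.norm_eq_abs] at s1 s2 ⊢
    have hN0 : 0 ≤ N z := by positivity
    rw [abs_of_nonneg hN0] at s1 s2 ⊢
    have g1 : |x z - a| * |k| ≤ |k| / 4 * N z + |t z - t₀| * |cross (vb - va) ub| := by
      rw [← abs_mul, f1, ← abs_mul]; exact (abs_add_le _ _).trans (add_le_add_left s1 _)
    have g2 : |y z - b| * |k| ≤ |k| / 4 * N z + |t z - t₀| * |cross (vb - va) ua| := by
      rw [← abs_mul, f2, ← abs_mul]; exact (abs_add_le _ _).trans (add_le_add_left s2 _)
    have g3 : N z * |k| = |t z - t₀| * |k| + |x z - a| * |k| + |y z - b| * |k| := by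
      simp only [hN]; ring
    rw [div_mul_eq_mul_div, le_div_iff₀ hkpos]
    nlinarith
  have Ra'' := ra'.trans_isBigO hNO
  have Rba'' := rba.trans_isBigO hNO
  have rc' : Rc =o[L] fun z => t z - t₀ := rc.trans_le fun z => by simp
  set v : X → ℂ := fun z => γ (t z) (x z) - γ (t z) c with hv
  -- the position of the crossing relative to the third strand, to first order
  have hmain : (fun z => k * cross uc (v z) + D * (t z - t₀)) =o[L] fun z => t z - t₀ := by
    have h1 := ((isLittleO_cross (Ra''.sub rc') uc).const_mul_left (-k)).add
      ((isLittleO_cross Rba'' ub).const_mul_left (cross uc ua))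
    refine h1.congr' ?_ (EventuallyEq.refl _ _)
    filter_upwards [heq] with z hz
    simp only [hRa, hRb, hRc, hz, hk, hv, hDdef, crossingDefect, cross]
    simp
    ring
  have hvO : v =O[L] fun z => t z - t₀ := by
    have hxa : (fun z => x z - a) =O[L] fun z => t z - t₀ :=
      (Asymptotics.IsBigO.of_norm_le fun z => by
        rw [Real.norm_eq_abs]
        simp only [hN]
        linarith [abs_nonneg (t z - t₀), abs_nonneg (y z - b)]).trans hNO
    have h1 : (fun z => (Ra z - Rc z) + ((t z - t₀) • (va - vc) + (x z - a) • ua)) =O[L]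
        fun z => t z - t₀ := by
      refine ((Ra''.sub rc').isBigO).add (Asymptotics.IsBigO.add ?_ ?_)
      · refine Asymptotics.IsBigO.of_bound ‖va - vc‖ (Eventually.of_forall fun z => ?_)
        rw [norm_smul, mul_comm]
      · refine Asymptotics.IsBigO.trans (g := fun z => x z - a)
          (Asymptotics.IsBigO.of_bound ‖ua‖ (Eventually.of_forall fun z => ?_)) hxa
        rw [norm_smul, mul_comm]
    refine h1.congr_left fun z => ?_
    simp only [hRa, hRc, hv, smul_sub]
    ring
  obtain ⟨K, hK, hvK⟩ := hvO.exists_pos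
  refine ⟨fun _ => c, tendsto_const_nhds, |D| / (2 * |k| * K), by positivity, ?_⟩
  filter_upwards [hmain.def (c := |D| / 2) (by positivity), hvK.bound, hne] with z h1 h2 h3
  simp only [Real.norm_eq_abs] at h1 h2
  have hτ : 0 < |t z - t₀| := abs_pos.2 (sub_ne_zero.2 h3)
  have hDpos : 0 < |D| := abs_pos.2 hD
  set cr := cross uc (v z) with hcr
  set σ : ℝ := -(SignType.sign (t z - t₀) : ℝ) * (SignType.sign D : ℝ) * (SignType.sign k : ℝ)
    with hσ
  have hτ0 : t z - t₀ ≠ 0 := sub_ne_zero.2 h3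
  have hσ1 : (σ = 1 ∨ σ = -1) ∧ |D| / 2 * |t z - t₀| ≤ |k| * (σ * cr) := by
    have h1' := abs_le.1 h1
    rcases lt_or_gt_of_ne hτ0 with i1 | i1 <;> rcases lt_or_gt_of_ne hD with i2 | i2 <;>
      rcases lt_or_gt_of_ne hc with i3 | i3 <;>
      simp only [hσ, i1, i2, i3, sign_neg, sign_pos, abs_of_neg, abs_of_pos] at h1' ⊢ <;>
      norm_num <;> nlinarith [h1'.1, h1'.2]
  obtain ⟨hσ1, hσc⟩ := hσ1
  have hvz : |D| / (2 * |k| * K) * ‖v z‖ ≤ σ * cr := by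
    have : |D| / (2 * |k| * K) * ‖v z‖ ≤ |D| / (2 * |k| * K) * (K * |t z - t₀|) := by gcongr
    refine this.trans ?_
    rw [show |D| / (2 * |k| * K) * (K * |t z - t₀|) = |D| / 2 * |t z - t₀| / |k| by field_simp,
      div_le_iff₀ hkpos]
    linarith
  have hcr0 : 0 < |k| * (σ * cr) := lt_of_lt_of_le (by positivity) hσc
  right
  refine ⟨fun h0 => ?_, ?_⟩
  · have : v z = 0 := sub_eq_zero.2 h0
    have : cr = 0 := by rw [hcr, this]; simp [cross]
    rw [this] at hcr0
    simp at hcr0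
  · rcases hσ1 with h | h
    · left; exact ⟨h, by rw [h, one_mul] at hvz; exact hvz⟩
    · right; exact ⟨h, by rw [h, neg_one_mul] at hvz; exact hvz⟩

end

section

variable {γ : ℝ → ImmersedCurve}

/-- The index of the double point of two strands near a triple point: it differs by `1 / 2`, up to
sign, from the principal value at the triple point, according to the side of the third strand. -/
lemma eventually_ind_of_triple (hγ : ContDiff ℝ ∞ fun p : ℝ × ℝ => γ p.1 p.2) {t₀ a b c x₀ : ℝ}
    (hS : IsStrandSet (γ t₀) (γ t₀ a) x₀ {a, b, c}) (hac : a ≠ c) (hbc : b ≠ c) (h1 : a < b)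
    (h2 : b < a + 2 * π) (hc : cross (deriv (γ t₀) a) (deriv (γ t₀) b) ≠ 0)
    (hD : defectAt γ t₀ a b c ≠ 0) :
    ∀ᶠ w : ℝ × ℝ × ℝ in 𝓝[≠] t₀ ×ˢ 𝓝 (a, b), (γ w.1).OnlyTwo w.2.1 w.2.2 →
      γ w.1 w.2.1 = γ w.1 w.2.2 → (γ w.1).ind (γ w.1 w.2.1) = (γ t₀).ind (γ t₀ a) +
        (SignType.sign (w.1 - t₀) : ℝ) * (-(1 / 2) * ((SignType.sign (defectAt γ t₀ a b c) : ℝ) *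
          (SignType.sign (cross (deriv (γ t₀) a) (deriv (γ t₀) b)) : ℝ))) := by
  set L : Filter (ℝ × ℝ × ℝ) := (𝓝[≠] t₀ ×ˢ 𝓝 (a, b)) ⊓ 𝓟 {w | γ w.1 w.2.1 = γ w.1 w.2.2}
    with hL
  have hle : L ≤ 𝓝[≠] t₀ ×ˢ 𝓝 (a, b) := inf_le_left
  have ht : Tendsto (fun w : ℝ × ℝ × ℝ => w.1) L (𝓝[≠] t₀) := tendsto_fst.mono_left hle
  have hx : Tendsto (fun w : ℝ × ℝ × ℝ => w.2.1) (𝓝[≠] t₀ ×ˢ 𝓝 (a, b)) (𝓝 a) :=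
    (continuous_fst.tendsto (a, b)).comp tendsto_snd
  have hy : Tendsto (fun w : ℝ × ℝ × ℝ => w.2.2) (𝓝[≠] t₀ ×ˢ 𝓝 (a, b)) (𝓝 b) :=
    (continuous_snd.tendsto (a, b)).comp tendsto_snd
  have heq : ∀ᶠ w in L, γ w.1 w.2.1 = γ w.1 w.2.2 := by
    rw [hL, eventually_inf_principal]; exact Eventually.of_forall fun w hw => hw
  have hΨ : C1Tendsto (fun w : ℝ × ℝ × ℝ => γ w.1) L (γ t₀) :=
    (c1Tendsto_of_contDiff hγ t₀).comp (ht.mono_right nhdsWithin_le_nhds)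
  have hb : γ t₀ b = γ t₀ a := hS.eq b (by simp)
  have hcc : γ t₀ c = γ t₀ a := hS.eq c (by simp)
  set D := defectAt γ t₀ a b c
  set k := cross (deriv (γ t₀) a) (deriv (γ t₀) b)
  have hside := hasSides_of_defect_ne_zero hγ hb.symm hcc.symm hc hD ht (hx.mono_left hle)
    (hy.mono_left hle) heq
  have hT := hΨ.tendsto_ind (q := fun w => γ w.1 w.2.1) (hΨ.tendsto (hx.mono_left hle)) hS
    (σ := fun s w => if s = c then -(SignType.sign (w.1 - t₀) : ℝ) * (SignType.sign D : ℝ) *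
      (SignType.sign k : ℝ) else 0) (fun s hs => by
        simp only [Finset.mem_insert, Finset.mem_singleton] at hs
        rcases hs with rfl | rfl | rfl
        · simp only [if_neg hac]
          exact hasSides_self _ _ (hx.mono_left hle) fun _ => rfl
        · simp only [if_neg hbc]
          refine ⟨_, hy.mono_left hle, 1, one_pos, ?_⟩
          filter_upwards [heq] with w hw
          exact Or.inl ⟨rfl, hw⟩
        · simpa only [if_pos] using hside)
  have e1 := hT.eventually (Metric.ball_mem_nhds _ one_half_pos)
  rw [hL, eventually_inf_principal] at e1
  have e2 : ∀ᶠ w : ℝ × ℝ × ℝ in 𝓝[≠] t₀ ×ˢ 𝓝 (a, b), w.2.1 < w.2.2 := by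
    filter_upwards [(hy.sub hx).eventually_const_lt (sub_pos.2 h1)] with i hi
    linarith
  have e3 : ∀ᶠ w : ℝ × ℝ × ℝ in 𝓝[≠] t₀ ×ˢ 𝓝 (a, b), w.2.2 < w.2.1 + 2 * π := by
    filter_upwards [(hy.sub hx).eventually_lt_const (show b - a < 2 * π by linarith)] with i hi
    linarith
  have e4 : ∀ᶠ w : ℝ × ℝ × ℝ in 𝓝[≠] t₀ ×ˢ 𝓝 (a, b), w.1 ≠ t₀ :=
    tendsto_fst.eventually self_mem_nhdsWithin
  filter_upwards [e1, e2, e3, e4] with w e1 e2 e3 e4 hno hw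
  have := e1 hw
  obtain ⟨n, hn⟩ := (isStrandSet_pair e2 e3 hw hno).exists_int_of_pair e2.ne
  obtain ⟨m, hm⟩ := hS.exists_int
  rw [Finset.card_eq_three.2 ⟨a, b, c, h1.ne, hac, hbc, rfl⟩] at hm
  rw [Finset.sum_insert (by simp [h1.ne, hac]), Finset.sum_pair hbc, if_neg hac, if_neg hbc,
    if_pos rfl, hn, hm, Real.dist_eq] at this
  rw [hn, hm]
  push_cast at this ⊢
  have hτ : w.1 - t₀ ≠ 0 := sub_ne_zero.2 e4
  have hσ : -(SignType.sign (w.1 - t₀) : ℝ) * (SignType.sign D : ℝ) * (SignType.sign k : ℝ) = 1 ∨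
      -(SignType.sign (w.1 - t₀) : ℝ) * (SignType.sign D : ℝ) * (SignType.sign k : ℝ) = -1 := by
    rcases lt_or_gt_of_ne hτ with i1 | i1 <;> rcases lt_or_gt_of_ne hD with i2 | i2 <;>
      rcases lt_or_gt_of_ne hc with i3 | i3 <;> simp [i1, i2, i3]
  have hgoal : ∀ σ : ℝ, (σ = 1 ∨ σ = -1) →
      |(n : ℝ) - 1 / 2 * (0 + (0 + σ)) - (m + 3 / 2)| < 1 / 2 →
        (n : ℝ) = m + 3 / 2 + 1 / 2 * σ := by
    rintro σ (rfl | rfl) h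
    · have : n = m + 2 := by
        refine abs_int_sub_int_lt ?_
        push_cast
        rw [show (n : ℝ) - 1 / 2 * (0 + (0 + 1)) - (m + 3 / 2) = n - (m + 2) by ring] at h
        linarith
      rw [this]; push_cast; ring
    · have : n = m + 1 := by
        refine abs_int_sub_int_lt ?_
        push_cast
        rw [show (n : ℝ) - 1 / 2 * (0 + (0 + -1)) - (m + 3 / 2) = n - (m + 1) by ring] at h
        linarith
      rw [this]; push_cast; ring
  rw [hgoal _ hσ this]
  ring

end

section

variable {ι : Type*} {Ψ : ι → ImmersedCurve} {l : Filter ι} {φ : ImmersedCurve}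

lemma binom_one (x : ℝ) : binom x 1 = x := by simp [binom]

/-- The first moment near a curve with finitely many bad transverse double points, near which the
indices of the double points of the nearby curves are `s i * e`, up to a constant. -/
theorem C1Tendsto.exists_eventually_doodleMoment_eq (h : C1Tendsto Ψ l φ) {T : Finset (ℝ × ℝ)}
    (hTD : ∀ z ∈ T, z ∈ φ.doubleSet) (hTi : ∀ z ∈ T, 0 < z.1 ∧ z.2 < 2 * π)
    (hTc : ∀ z ∈ T, cross (deriv φ z.2) (deriv φ z.1) ≠ 0)
    (hT : ∀ z ∈ φ.doubleSet, z ∉ T → φ.OnlyTwo z.1 z.2)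
    (h0 : ∀ u ∈ Ioo 0 (2 * π), φ 0 = φ u → φ.OnlyTwo 0 u) {s : ι → ℝ} {e : ℝ × ℝ → ℝ}
    (hind : ∀ z ∈ T, ∀ᶠ w : ι × ℝ × ℝ in l ×ˢ 𝓝 z, (Ψ w.1).OnlyTwo w.2.1 w.2.2 →
      Ψ w.1 w.2.1 = Ψ w.1 w.2.2 → (Ψ w.1).ind (Ψ w.1 w.2.1) = φ.ind (φ z.1) + s w.1 * e z) :
    ∃ C, ∀ᶠ i in l, (Ψ i).NoTriple →
      (Ψ i).doodleMoment 1 = C + s i * ∑ z ∈ T, e z * φ.doubleSign z.1 z.2 := by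
  classical
  have hiso : ∀ z ∈ T, ∀ᶠ y in 𝓝 z, φ y.1 = φ y.2 → y = z := fun z hz =>
    ImmersedCurve.eventually_eq_of_transverse (hTD z hz).2.2 (hTc z hz)
  have hnT : ∀ z, z ∉ T → ∀ᶠ y in 𝓝 z, y ∉ T := fun z hz =>
    T.finite_toSet.isClosed.isOpen_compl.mem_nhds hz
  obtain ⟨g, hg⟩ : ∃ g, φ.IsAdapted (fun x => binom x 1) g := by
    obtain ⟨g, h1, h2⟩ := φ.exists_isWeight (fun z => binom (φ.ind (φ z.1)) 1) fun z hz => by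
      by_cases hzT : z ∈ T
      · filter_upwards [hiso z hzT] with y hy hyd
        rw [hy hyd.2.2]
      · filter_upwards [ImmersedCurve.eventually_ind_eq_of_onlyTwo hz (hT z hz hzT), hnT z hzT]
          with y hy hyT hyd
        rw [hy (hT y hyd hyT) hyd]
    exact ⟨g, h1, h2⟩
  have hk : ∀ z : ℝ × ℝ, ∃ k : ℝ × ℝ → ℝ, z ∈ T → IsWeight k ∧ IsFlat φ k ∧
      (∀ y ∈ φ.doubleSet, y ≠ z → y ∉ tsupport k) ∧ (∀ᶠ y in 𝓝 z, k y = 1) ∧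
      φ.weightedCount k = φ.doubleSign z.1 z.2 := by
    intro z
    by_cases hz : z ∈ T
    · obtain ⟨k, h1, h2, h3, h4⟩ := ImmersedCurve.exists_bump (hTi z hz).1 (hTD z hz).2.1.1
        (hTi z hz).2 (hTD z hz).2.2 (hTc z hz) (hiso z hz)
      exact ⟨k, fun _ => ⟨h1, h2, fun y hy hne hyk => hne (h3 hyk hy.2.2), h4⟩⟩
    · exact ⟨0, fun h => absurd h hz⟩
  choose k hk using hk
  have hk0 : ∀ z ∈ T, ∀ y ∈ φ.doubleSet, y ≠ z → ∀ᶠ x in 𝓝 y, k z x = 0 := fun z hz y hy hne =>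
    notMem_tsupport_iff_eventuallyEq.1 ((hk z hz).2.2.1 y hy hne)
  -- the weight `g` corrected at the bad double points is adapted to the nearby curves
  set G : ι → ℝ × ℝ → ℝ := fun i y => g y + ∑ z ∈ T, s i * e z * k z y with hG
  have hadm : ∀ᶠ i in l, ∀ z ∈ box, z ∈ pairRegion → Ψ i z.1 = Ψ i z.2 →
      (Ψ i).OnlyTwo z.1 z.2 → ∀ᶠ y in 𝓝 z, G i y = binom ((Ψ i).ind (Ψ i z.1)) 1 := by
    refine eventually_forall_of_isCompact isCompact_box fun z hz => ?_
    by_cases hzd : z ∈ φ.doubleSet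
    · by_cases hzT : z ∈ T
      · have h0 : ∀ᶠ y in 𝓝 z, ∀ x ∈ T.erase z, k x y = 0 := by
          rw [Finset.eventually_all]
          exact fun x hx =>
            hk0 x (Finset.mem_of_mem_erase hx) z hzd (Finset.ne_of_mem_erase hx).symm
        filter_upwards [hind z hzT, ((hg.eventually_eq z hzd).and
          (h0.and (hk z hzT).2.2.2.1)).eventually_nhds.prod_inr l] with w h1 h2 h3 h4 h5
        filter_upwards [h2] with y ⟨hy1, hy2, hy3⟩
        rw [h1 h5 h4, hG]
        simp only
        rw [hy1, ← Finset.add_sum_erase T _ hzT, hy3, binom_one, binom_one,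
          Finset.sum_eq_zero fun x hx => by rw [hy2 x hx, mul_zero]]
        ring
      · have h0 : ∀ᶠ y in 𝓝 z, ∀ x ∈ T, k x y = 0 := by
          rw [Finset.eventually_all]
          exact fun x hx => hk0 x hx z hzd fun hxz => hzT (hxz ▸ hx)
        filter_upwards [h.eventually_ind_eq_prod hzd (hT z hzd hzT), ((hg.eventually_eq z hzd).and
          h0).eventually_nhds.prod_inr l] with w h1 h2 h3 h4 h5
        filter_upwards [h2] with y ⟨hy1, hy2⟩
        rw [h1 h5 h4, hG]
        simp only
        rw [hy1, Finset.sum_eq_zero fun x hx => by rw [hy2 x hx, mul_zero], add_zero]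
    · filter_upwards [h.eventually_mem_doubleSet hz] with w h1 h2 h3
      exact absurd (h1 h2 h3) hzd
  have hflat : ∀ᶠ i in l, ∀ z ∈ T, IsFlat (Ψ i) (k z) := by
    rw [Finset.eventually_all]
    exact fun z hz => h.eventually_isFlat (hk z hz).1 (hk z hz).2.1
  have hcount : ∀ᶠ i in l, ∀ z ∈ T, (Ψ i).weightedCount (k z) = φ.doubleSign z.1 z.2 := by
    rw [Finset.eventually_all]
    intro z hz
    have hpi := Real.two_pi_pos
    have e0 : φ (2 * π) = φ 0 := by simpa using φ.periodic 0
    have := h.eventually_weightedCount (c := 0) (hk z hz).1 (hk z hz).2.1 fun u hu hu0 => by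
      constructor
      · refine (hk0 z hz (0, u) ⟨mem_box.2 ⟨⟨le_rfl, hpi.le⟩, hu.1.le, hu.2.le⟩,
          ⟨hu.1, by simpa using hu.2⟩, hu0.symm⟩ ?_).self_of_nhds
        rintro rfl; exact lt_irrefl _ (hTi _ hz).1
      · refine (hk0 z hz (u, 2 * π) ⟨mem_box.2 ⟨⟨hu.1.le, hu.2.le⟩, hpi.le, le_rfl⟩,
          ⟨hu.2, by simpa using hu.1⟩, by rw [hu0, e0]⟩ ?_).self_of_nhds
        rintro rfl; exact lt_irrefl _ (hTi _ hz).2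
    filter_upwards [this] with i hi
    rw [← (hk z hz).2.2.2.2]
    simpa using hi
  refine ⟨φ.baseTerm 1 + φ.weightedCount g, ?_⟩
  filter_upwards [hadm, hflat, hcount, h.eventually_isFlat hg.isWeight hg.isFlat,
    h.eventually_weightedCount_add_baseTerm hg h0] with i h1 h2 h3 h4 h5 hno
  obtain ⟨w1, w2, w3⟩ := ImmersedCurve.weightedCount_sum (φ := Ψ i) T
    (g := fun z y => s i * e z * k z y) (fun z hz => (hk z hz).1.const_mul _)
    (fun z hz => (h2 z hz).const_mul _)
  have hGadm : (Ψ i).IsAdapted (fun x => binom x 1) (G i) :=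
    ⟨hg.isWeight.add w1, fun z hz => h1 z hz.1 hz.2.1 hz.2.2 (hno.onlyTwo_of_mem hz)⟩
  rw [hGadm.doodleMoment_eq, hG, ImmersedCurve.weightedCount_add hg.isWeight w1 h4 w2, w3,
    ← add_assoc, h5 hno, Finset.mul_sum]
  congr 1
  refine Finset.sum_congr rfl fun z hz => ?_
  rw [ImmersedCurve.weightedCount_const_mul (hk z hz).1, h3 z hz, mul_assoc]

end

section

variable {γ : ℝ → ImmersedCurve}

lemma defectAt_rotate (γ : ℝ → ImmersedCurve) (t a b c : ℝ) :
    defectAt γ t b c a = defectAt γ t a b c := by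
  simp only [defectAt, crossingDefect]; ring

lemma defectAt_swap (γ : ℝ → ImmersedCurve) (t a b c : ℝ) :
    defectAt γ t a c b = -defectAt γ t a b c := by
  simp only [defectAt, crossingDefect, cross]; ring

/-- Passing a triple point changes the first moment by the sign of the crossing. -/
theorem exists_eventually_doodleMoment_eq_of_triple
    (hγ : ContDiff ℝ ∞ fun p : ℝ × ℝ => γ p.1 p.2) {t₀ x₁ x₂ x₃ : ℝ} (h0 : 0 < x₁)
    (h3 : x₃ < 2 * π) (hT : (γ t₀).IsOrdinaryTriple x₁ x₂ x₃)
    (hD : defectAt γ t₀ x₁ x₂ x₃ ≠ 0) :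
    ∃ C, ∀ᶠ t in 𝓝[≠] t₀, (γ t).NoTriple → (γ t).doodleMoment 1 =
      C + (SignType.sign (t - t₀) : ℝ) *
        (1 / 2 * (SignType.sign (defectAt γ t₀ x₁ x₂ x₃) : ℝ)) := by
  classical
  obtain ⟨l12, l23, l31, e12, e23, c12, c23, c31, hother⟩ := hT
  set φ := γ t₀ with hφ
  have hpi := Real.two_pi_pos
  have a12 := angle_ne_of_lt l12 (by linarith)
  have a23 := angle_ne_of_lt l23 (by linarith)
  have a13 := angle_ne_of_lt (l12.trans l23) l31
  have hpre : ∀ s, φ s = φ x₁ →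
      (s : Real.Angle) = x₁ ∨ (s : Real.Angle) = x₂ ∨ (s : Real.Angle) = x₃ := by
    intro s hs
    by_cases hs1 : (s : Real.Angle) = x₁
    · exact Or.inl hs1
    · exact hother s x₁ x₂ |> fun hh => by
        by_cases hs2 : (s : Real.Angle) = x₂
        · exact Or.inr (Or.inl hs2)
        · exact hh ⟨hs1, a12, hs2, hs, e12⟩
  have hS := isStrandSet_triple l12 l23 l31 e12 e23 hpre
  -- points with three preimages are the triple point
  have honly : ∀ a b : ℝ, (a : Real.Angle) ≠ b → φ a = φ b → φ a ≠ φ x₁ → φ.OnlyTwo a b := by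
    intro a b hab he hne s hs
    by_contra hc
    rw [not_or] at hc
    have htr : φ.IsTriple a b s := ⟨hab, fun h => hc.2 h.symm, fun h => hc.1 h.symm, he,
      by rw [← he, hs]⟩
    rcases hother a b s htr with h | h | h
    · exact hne (φ.eq_of_angle_eq h)
    · exact hne ((φ.eq_of_angle_eq h).trans e12.symm)
    · exact hne ((φ.eq_of_angle_eq h).trans (e12.trans e23).symm)
  have hval : ∀ s ∈ Icc 0 (2 * π), φ s = φ x₁ → s = x₁ ∨ s = x₂ ∨ s = x₃ := by
    intro s hs he
    have hlt : ∀ x, 0 < x → x < 2 * π → |s - x| < 2 * π := fun x h1 h2 => by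
      rw [abs_lt]; constructor <;> linarith [hs.1, hs.2]
    rcases hpre s he with h | h | h
    · exact Or.inl (eq_of_angle_eq_of_abs_lt h (hlt _ h0 (by linarith)))
    · exact Or.inr (Or.inl (eq_of_angle_eq_of_abs_lt h (hlt _ (by linarith) (by linarith))))
    · exact Or.inr (Or.inr (eq_of_angle_eq_of_abs_lt h (hlt _ (by linarith) h3)))
  set T : Finset (ℝ × ℝ) := {(x₁, x₂), (x₂, x₃), (x₁, x₃)} with hTdef
  have hmemT : ∀ z, z ∈ T ↔ z = (x₁, x₂) ∨ z = (x₂, x₃) ∨ z = (x₁, x₃) := by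
    intro z; simp [hTdef]
  have hne0 : φ 0 ≠ φ x₁ := fun h => by
    rcases hval 0 ⟨le_rfl, hpi.le⟩ h with h | h | h <;> linarith
  have hs : ∀ u v : ℂ, cross u v = -cross v u := fun u v => by simp [cross]; ring
  -- half of the jump of the index at each of the three double points; for `(x₁, x₃)` the order of
  -- the visits is opposite to the cyclic order
  set e : ℝ × ℝ → ℝ := fun z => if z = (x₁, x₃) then
      1 / 2 * (SignType.sign (defectAt γ t₀ x₁ x₂ x₃) : ℝ) *
        (SignType.sign (cross (deriv φ z.1) (deriv φ z.2)) : ℝ)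
    else -(1 / 2) * (SignType.sign (defectAt γ t₀ x₁ x₂ x₃) : ℝ) *
        (SignType.sign (cross (deriv φ z.1) (deriv φ z.2)) : ℝ) with he
  have hne12 : (x₁, x₂) ≠ (x₁, x₃) := fun h => l23.ne (Prod.mk.inj h).2
  have hne23 : (x₂, x₃) ≠ (x₁, x₃) := fun h => l12.ne (Prod.mk.inj h).1.symm
  have hne1223 : (x₁, x₂) ≠ (x₂, x₃) := fun h => l12.ne (Prod.mk.inj h).1
  have hbox : ∀ a b, 0 < a → a < b → b < 2 * π → φ a = φ b → (a, b) ∈ φ.doubleSet :=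
    fun a b h1 h2 h3 h4 => ⟨mem_box.2 ⟨⟨h1.le, by linarith⟩, by linarith, h3.le⟩,
      ⟨h2, by change b < a + 2 * π; linarith⟩, h4⟩
  have c13 : cross (deriv φ x₁) (deriv φ x₃) ≠ 0 := by rw [hs]; exact neg_ne_zero.2 c31
  have hΨ : C1Tendsto γ (𝓝[≠] t₀) φ :=
    (c1Tendsto_of_contDiff hγ t₀).comp (k := id) nhdsWithin_le_nhds
  have hmain := hΨ.exists_eventually_doodleMoment_eq (T := T)
    (s := fun t => (SignType.sign (t - t₀) : ℝ)) (e := e) ?_ ?_ ?_ ?_ ?_ ?_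
  · obtain ⟨C, hC⟩ := hmain
    refine ⟨C, ?_⟩
    filter_upwards [hC] with t ht hno
    rw [ht hno]
    congr 2
    have hsq : ∀ x : ℝ, x ≠ 0 → (SignType.sign x : ℝ) * (SignType.sign x : ℝ) = 1 := by
      intro x hx
      rcases lt_or_gt_of_ne hx with h | h <;> simp [h]
    rw [hTdef, Finset.sum_insert (by simp [l12.ne, l23.ne]), Finset.sum_pair hne23]
    simp only [he, if_neg hne12, if_neg hne23, if_pos, ImmersedCurve.doubleSign]
    rw [hs (deriv φ x₂) (deriv φ x₁), hs (deriv φ x₃) (deriv φ x₂), hs (deriv φ x₃) (deriv φ x₁)]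
    simp only [Left.sign_neg]
    push_cast
    have q1 := hsq _ c12
    have q2 := hsq _ c23
    have q3 := hsq _ c13
    set d : ℝ := (SignType.sign (defectAt γ t₀ x₁ x₂ x₃) : ℝ)
    linear_combination (1 / 2 * d) * q1 + (1 / 2 * d) * q2 - (1 / 2 * d) * q3
  · intro z hz
    rcases (hmemT z).1 hz with rfl | rfl | rfl
    · exact hbox _ _ h0 l12 (by linarith) e12
    · exact hbox _ _ (by linarith) l23 h3 e23
    · exact hbox _ _ h0 (l12.trans l23) h3 (e12.trans e23)
  · intro z hz
    rcases (hmemT z).1 hz with rfl | rfl | rfl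
    · exact ⟨h0, by change x₂ < 2 * π; linarith⟩
    · exact ⟨by change 0 < x₂; linarith, h3⟩
    · exact ⟨h0, h3⟩
  · intro z hz
    rcases (hmemT z).1 hz with rfl | rfl | rfl
    · rw [hs]; exact neg_ne_zero.2 c12
    · rw [hs]; exact neg_ne_zero.2 c23
    · exact c31
  · intro z hz hzT
    refine honly _ _ (ImmersedCurve.angle_ne_of_mem_pairRegion hz.2.1) hz.2.2 fun h => hzT ?_
    have hb := mem_box.1 hz.1
    have h1 := hval z.1 hb.1 h
    have h2 := hval z.2 hb.2 (hz.2.2 ▸ h)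
    have hlt := hz.2.1.1
    rw [hmemT]
    rcases h1 with h1 | h1 | h1 <;> rcases h2 with h2 | h2 | h2 <;> rw [h1, h2] at hlt
    all_goals first
      | exact absurd hlt (by linarith)
      | simp [Prod.ext_iff, h1, h2]
  · intro u hu hu0
    exact honly 0 u (angle_ne_of_lt hu.1 (by simpa using hu.2)) hu0 hne0
  · have hp12 : φ x₂ = φ x₁ := e12.symm
    intro z hz
    rcases (hmemT z).1 hz with rfl | rfl | rfl
    · filter_upwards [eventually_ind_of_triple hγ hS (l12.trans l23).ne l23.ne l12 (by linarith)
        c12 hD] with w hw h1 h2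
      rw [hw h1 h2]
      simp only [he, if_neg hne12]
      ring
    · have hset : ({x₁, x₂, x₃} : Finset ℝ) = {x₂, x₃, x₁} := by
        ext; simp only [Finset.mem_insert, Finset.mem_singleton]; tauto
      rw [hset, ← hp12] at hS
      filter_upwards [eventually_ind_of_triple hγ hS l12.ne' (l12.trans l23).ne' l23 (by linarith)
        c23 (by rw [defectAt_rotate]; exact hD)] with w hw h1 h2
      rw [hw h1 h2, defectAt_rotate]
      simp only [he, if_neg hne23]
      ring
    · have hset : ({x₁, x₂, x₃} : Finset ℝ) = {x₁, x₃, x₂} := by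
        ext; simp only [Finset.mem_insert, Finset.mem_singleton]; tauto
      rw [hset] at hS
      filter_upwards [eventually_ind_of_triple hγ hS l12.ne l23.ne' (l12.trans l23) l31
        c13 (by rw [defectAt_swap]; exact neg_ne_zero.2 hD)] with w hw h1 h2
      rw [hw h1 h2, defectAt_swap, Left.sign_neg]
      simp only [he, if_pos]
      push_cast
      ring

end

/-! ### Strangeness along generic paths -/

/-- A locally constant function with finitely many jumps. -/
lemma sub_eq_sum_of_jumps {S : Finset ℝ} (hS : ∀ t ∈ S, 0 < t ∧ t < 1) {J j : ℝ → ℝ}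
    (h1 : ∀ t₀ ∈ Icc (0 : ℝ) 1, t₀ ∉ S → ∀ᶠ t in 𝓝 t₀, t ∈ Icc (0 : ℝ) 1 → J t = J t₀)
    (h2 : ∀ t₀ ∈ S, ∃ C, ∀ᶠ t in 𝓝[≠] t₀,
      J t = C + (SignType.sign (t - t₀) : ℝ) * (1 / 2 * j t₀)) :
    J 1 - J 0 = ∑ t ∈ S, j t := by
  classical
  choose! C hC using h2
  -- without the jumps, and with the left limits as values at the jumps, the function is locally
  -- constant
  set G : ℝ → ℝ := fun t => (if t ∈ S then C t - 1 / 2 * j t else J t) -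
    ∑ s ∈ S, if s < t then j s else 0 with hG
  have hconst : IsLocallyConstant fun t : unitInterval => G t := by
    rw [IsLocallyConstant.iff_eventually_eq]
    intro t₀
    have hnot : ∀ᶠ t : ℝ in 𝓝 t₀.1, t ∈ S → t = t₀ := by
      have : ∀ᶠ t : ℝ in 𝓝 t₀.1, t ∉ S.erase t₀ :=
        (S.erase t₀.1).finite_toSet.isClosed.isOpen_compl.mem_nhds (by simp)
      filter_upwards [this] with t ht htS
      by_contra hne
      exact ht (Finset.mem_erase.2 ⟨hne, htS⟩)
    have hlt : ∀ᶠ t : ℝ in 𝓝 t₀.1, ∀ s ∈ S, s ≠ t₀ → (s < t ↔ s < t₀) := by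
      rw [Finset.eventually_all]
      intro s _
      rcases lt_trichotomy s t₀ with h | h | h
      · filter_upwards [lt_mem_nhds h] with t ht _
        exact ⟨fun _ => h, fun _ => ht⟩
      · exact Eventually.of_forall fun t hne => absurd h hne
      · filter_upwards [gt_mem_nhds h] with t ht _
        exact ⟨fun h' => absurd h' (not_lt.2 ht.le), fun h' => absurd h' (not_lt.2 h.le)⟩
    have hmain : ∀ᶠ t : ℝ in 𝓝 t₀.1, t ∈ Icc (0 : ℝ) 1 → G t = G t₀ := by
      by_cases hmem : t₀.1 ∈ S
      · filter_upwards [hnot, hlt, eventually_nhdsWithin_iff.1 (hC t₀ hmem)] with t e1 e2 e3 _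
        by_cases htt : t = t₀
        · rw [htt]
        · have e4 := e3 htt
          have hsum : (∑ s ∈ S, if s < t then j s else 0) =
              (∑ s ∈ S, if s < t₀.1 then j s else 0) + if t₀.1 < t then j t₀ else 0 := by
            have : ∀ s ∈ S, (if s < t then j s else 0) = (if s < t₀.1 then j s else 0) +
                if s = t₀ then (if t₀.1 < t then j t₀ else 0) else 0 := by
              intro s hs
              by_cases hst : s = t₀
              · subst hst; simp
              · simp only [e2 s hs hst, if_neg hst, add_zero]
            rw [Finset.sum_congr rfl this, Finset.sum_add_distrib, Finset.sum_ite_eq' S t₀.1,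
              if_pos hmem]
          simp only [hG]
          rw [if_neg fun h => htt (e1 h), if_pos hmem, hsum, e4]
          rcases lt_or_gt_of_ne htt with h | h
          · rw [if_neg (not_lt.2 h.le), sign_neg (sub_neg.2 h)]
            simp
            ring
          · rw [if_pos h, sign_pos (sub_pos.2 h)]
            simp
            ring
      · filter_upwards [hnot, hlt, h1 t₀ t₀.2 hmem] with t e1 e2 e3 ht
        have htS : t ∉ S := fun h => hmem (e1 h ▸ h)
        simp only [hG]
        rw [if_neg htS, if_neg hmem, e3 ht]
        congr 1
        refine Finset.sum_congr rfl fun s hs => ?_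
        simp only [e2 s hs fun h => hmem (h ▸ hs)]
    exact (continuous_subtype_val.tendsto t₀).eventually hmain |>.mono fun t ht => ht t.2
  have h01 := hconst.apply_eq_of_preconnectedSpace 1 0
  simp only [hG, Set.Icc.coe_one, Set.Icc.coe_zero] at h01
  rw [if_neg fun h => lt_irrefl _ (hS 1 h).2, if_neg fun h => lt_irrefl _ (hS 0 h).1,
    Finset.sum_congr rfl fun s hs => if_pos (hS s hs).2,
    Finset.sum_congr rfl fun s hs => if_neg (not_lt.2 (hS s hs).1.le), Finset.sum_const_zero] at h01
  linarith

namespace GenericPath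

lemma noTriple (γ : GenericPath) {t : ℝ} (ht : t ∈ Icc (0 : ℝ) 1) (hts : t ∉ γ.times) :
    (γ.curve t).NoTriple := γ.off_times t ht.1 ht.2 hts

lemma exists_eventually_doodleMoment_eq (γ : GenericPath) {t₀ : ℝ} (h : t₀ ∈ γ.times) :
    ∃ C, ∀ᶠ t in 𝓝[≠] t₀, (γ.curve t).doodleMoment 1 = C + (SignType.sign (t - t₀) : ℝ) *
      (1 / 2 * (SignType.sign (defectAt γ.curve t₀ (γ.x₁ t₀) (γ.x₂ t₀) (γ.x₃ t₀)) : ℝ)) := by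
  obtain ⟨l12, l23, l31, e12, e23, c12, c23, c31, hother⟩ := γ.ordinary t₀ h
  set x₁ := γ.x₁ t₀
  set x₂ := γ.x₂ t₀
  set x₃ := γ.x₃ t₀
  -- shift the parameter so that the triple point is visited inside the interval `(0, 2π)`
  set s := (x₃ - 2 * π + x₁) / 2 with hs
  set ψ : ℝ → ImmersedCurve := fun t => (γ.curve t).shift s with hψ
  have hsm : ContDiff ℝ ∞ fun p : ℝ × ℝ => ψ p.1 p.2 :=
    γ.smooth.comp (contDiff_fst.prodMk (contDiff_snd.add contDiff_const))
  have hdef : defectAt ψ t₀ (x₁ - s) (x₂ - s) (x₃ - s) = defectAt γ.curve t₀ x₁ x₂ x₃ := by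
    simp only [defectAt, hψ, ImmersedCurve.deriv_shift, ImmersedCurve.shift_apply, sub_add_cancel]
  have hord : (ψ t₀).IsOrdinaryTriple (x₁ - s) (x₂ - s) (x₃ - s) := by
    refine ⟨by linarith, by linarith, by linarith, ?_, ?_, ?_, ?_, ?_, ?_⟩
    all_goals
      simp only [hψ, ImmersedCurve.deriv_shift, ImmersedCurve.shift_apply, sub_add_cancel]
    · exact e12
    · exact e23
    · exact c12
    · exact c23
    · exact c31
    · intro x y z hxyz
      simp only [Real.Angle.coe_sub, eq_sub_iff_add_eq, ← Real.Angle.coe_add]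
      exact hother _ _ _ hxyz.of_shift
  obtain ⟨C, hC⟩ := exists_eventually_doodleMoment_eq_of_triple hsm (by linarith) (by linarith) hord
    (by rw [hdef]; exact γ.transversal t₀ h)
  rw [hdef] at hC
  have hnot : ∀ᶠ t in 𝓝[≠] t₀, t ∉ γ.times := by
    have : ∀ᶠ t : ℝ in 𝓝 t₀, t ∉ γ.times.erase t₀ :=
      (γ.times.erase t₀).finite_toSet.isClosed.isOpen_compl.mem_nhds (by simp)
    filter_upwards [nhdsWithin_le_nhds this, self_mem_nhdsWithin] with t ht hne htS
    exact ht (Finset.mem_erase.2 ⟨hne, htS⟩)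
  have hI : ∀ᶠ t in 𝓝[≠] t₀, t ∈ Icc (0 : ℝ) 1 :=
    nhdsWithin_le_nhds (Icc_mem_nhds (γ.times_mem t₀ h).1 (γ.times_mem t₀ h).2)
  refine ⟨C, ?_⟩
  filter_upwards [hC, hnot, hI] with t h1 h2 h3
  have hno := γ.noTriple h3 h2
  rw [← h1 (hno.shift s)]
  exact (hno.doodleMoment_shift s 1).symm

theorem doodleMoment_sub (γ : GenericPath) :
    (γ.curve 1).doodleMoment 1 - (γ.curve 0).doodleMoment 1 = γ.intersectionNumber := by
  rw [sub_eq_sum_of_jumps γ.times_mem (J := fun t => (γ.curve t).doodleMoment 1)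
    (j := fun t => (SignType.sign (defectAt γ.curve t (γ.x₁ t) (γ.x₂ t) (γ.x₃ t)) : ℝ)) ?_
    fun t₀ h => γ.exists_eventually_doodleMoment_eq h]
  · rw [intersectionNumber]
    push_cast
    rfl
  · intro t₀ ht₀ hts
    filter_upwards [(c1Tendsto_of_contDiff γ.smooth t₀).eventually_doodleMoment
      (γ.noTriple ht₀ hts) 1, γ.times.finite_toSet.isClosed.isOpen_compl.mem_nhds hts]
      with t h1 h2 h3
    exact h1 (γ.noTriple h3 h2)

end GenericPath

/-! ### The figure eight -/

section

variable {φ : ImmersedCurve}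

/-- If the curve does not meet the ray from `p` in the direction `w`, except at `p`, the index of
`p` is determined by the strands through `p`. -/
lemma IsStrandSet.ind_add_eq_zero_of_ray {p w : ℂ} {x₀ : ℝ} {S : Finset ℝ}
    (hS : IsStrandSet φ p x₀ S) (hw0 : w ≠ 0) (hw : ∀ s ∈ S, cross (deriv φ s) w ≠ 0)
    (h : ∀ s, ∀ x : ℝ, 0 < x → φ s ≠ p + x * w) :
    φ.ind p + 1 / 2 * ∑ s ∈ S, (SignType.sign (cross (deriv φ s) w) : ℝ) = 0 := by
  refine tendsto_nhds_unique (hS.tendsto_ind_add hw) (tendsto_const_nhds.congr' ?_)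
  filter_upwards [self_mem_nhdsWithin] with ε hε
  refine (φ.ind_eq_zero_of_ray hw0 fun s x hx hs => ?_).symm
  refine h s (ε + x) (add_pos_of_pos_of_nonneg hε hx) ?_
  rw [hs]; push_cast; ring

/-- The index of a base point that is seen from infinity in the direction `w`. -/
lemma ImmersedCurve.IsBasePoint.binom_eq_zero {s : ℝ} (hs : φ.IsBasePoint s) {w : ℂ} (hw0 : w ≠ 0)
    (hw : cross (deriv φ s) w ≠ 0) (h : ∀ y, ∀ x : ℝ, 0 < x → φ y ≠ φ s + x * w) :
    binom (φ.ind (φ s) + 1 / 2) 2 = 0 := by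
  have h1 := (isStrandSet_singleton hs).ind_add_eq_zero_of_ray hw0 (by simpa using hw) h
  rw [Finset.sum_singleton] at h1
  rcases lt_or_gt_of_ne hw with hc | hc
  · rw [sign_neg hc] at h1
    have : φ.ind (φ s) = 1 / 2 := by
      simp only [SignType.coe_neg_one] at h1; linarith
    rw [this]; norm_num [binom, Finset.prod_range_succ]
  · rw [sign_pos hc] at h1
    have : φ.ind (φ s) = -(1 / 2) := by
      simp only [SignType.coe_one] at h1; linarith
    rw [this]; norm_num [binom, Finset.prod_range_succ]

end

lemma angle_eq_of_cos_eq_of_sin_eq {x y : ℝ} (hc : Real.cos x = Real.cos y)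
    (hs : Real.sin x = Real.sin y) : (x : Real.Angle) = y :=
  Real.Angle.cos_sin_inj hc hs

lemma ImmersedCurve.eq_of_coe_eq {φ : ImmersedCurve} {r i : ℝ → ℝ}
    (h : ∀ s, φ s = (r s : ℂ) + (i s : ℂ) * Complex.I) {r' i' : ℝ} {s : ℝ} (hr : HasDerivAt r r' s)
    (hi : HasDerivAt i i' s) : deriv φ s = (r' : ℂ) + (i' : ℂ) * Complex.I := by
  rw [show φ.toFun = fun s => (r s : ℂ) + (i s : ℂ) * Complex.I from funext h]
  exact (hr.ofReal_comp.add (hi.ofReal_comp.mul_const Complex.I)).deriv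

namespace RegularIDoodle

theorem doodleMoment_figureEight (φ : RegularIDoodle) (h : ∀ s, φ s = figureEight s) :
    φ.doodleMoment 1 = 0 := by
  have hpi := Real.pi_pos
  -- shift the parameter to a base point on the right of the curve
  set ψ := φ.shift (π / 2) with hψ
  have hψs : ∀ s, ψ s = (Real.cos s : ℂ) + ((-Real.sin (2 * s) : ℝ) : ℂ) * Complex.I := by
    intro s
    change φ (s + π / 2) = _
    rw [h, figureEight, Real.sin_add_pi_div_two, show 2 * (s + π / 2) = 2 * s + π by ring,
      Real.sin_add_pi]
  have hre : ∀ s, (ψ s).re = Real.cos s := fun s => by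
    rw [hψs]
    simp only [Complex.add_re, Complex.mul_re, Complex.ofReal_re, Complex.ofReal_im, Complex.I_re,
      Complex.I_im]
    ring
  have him : ∀ s, (ψ s).im = -Real.sin (2 * s) := fun s => by
    rw [hψs]
    simp only [Complex.add_im, Complex.mul_im, Complex.ofReal_re, Complex.ofReal_im, Complex.I_re,
      Complex.I_im]
    ring
  have hd0 : deriv ψ 0 = ((-Real.sin 0 : ℝ) : ℂ) + ((-(Real.cos (2 * 0) * 2) : ℝ) : ℂ) *
      Complex.I := by
    refine ImmersedCurve.eq_of_coe_eq hψs (Real.hasDerivAt_cos 0) ?_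
    have : HasDerivAt (fun s : ℝ => 2 * s) 2 0 := by simpa using (hasDerivAt_id (0 : ℝ)).const_mul 2
    exact this.sin.neg
  have hb : ψ.IsBasePoint 0 := by
    intro x hx
    have h1 : Real.cos x = 1 := by rw [← hre, hx, hre, Real.cos_zero]
    have h2 : Real.sin x = 0 := by nlinarith [Real.sin_sq_add_cos_sq x]
    exact angle_eq_of_cos_eq_of_sin_eq (by rw [h1, Real.cos_zero]) (by rw [h2, Real.sin_zero])
  have hB : binom (ψ.ind (ψ 0) + 1 / 2) 2 = 0 := by
    refine hb.binom_eq_zero (w := 1) one_ne_zero ?_ fun y x hx hy => ?_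
    · rw [hd0]; norm_num [cross]
    · have := congrArg Complex.re hy
      rw [Complex.add_re, hre, hre] at this
      simp at this
      linarith [Real.cos_le_one y]
  -- the curve is symmetric with respect to its double point
  have hind0 : φ.ind 0 = 0 := by
    have hneg : ∀ s, φ (-s) = -φ s := fun s => by
      rw [h, h]; simp [figureEight]; ring
    have hdneg : ∀ s, deriv φ (-s) = deriv φ s := fun s => by
      have h1 : deriv (fun s => φ (-s)) s = -deriv φ (-s) := deriv_comp_neg _ _
      rw [show (fun s => φ (-s)) = fun s => -φ s from funext hneg] at h1
      have h2 : deriv (fun s => -φ s) s = -deriv φ s := ((φ.hasDerivAt s).neg).deriv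
      rw [h2] at h1
      exact (neg_injective h1).symm
    have hodd : ∀ s, φ.angularSpeed 0 (-s) = -φ.angularSpeed 0 s := fun s => by
      rw [ImmersedCurve.angularSpeed, ImmersedCurve.angularSpeed, hneg, hdneg]
      simp [div_neg]
    have h1 := intervalIntegral.integral_comp_neg (a := -π) (b := π) (φ.angularSpeed 0)
    simp only [hodd, intervalIntegral.integral_neg, neg_neg] at h1
    rw [φ.ind_eq_integral 0 (-π), show -π + 2 * π = π by ring]
    have : ∫ s in (-π)..π, φ.angularSpeed 0 s = 0 := by linarith
    rw [this, mul_zero]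
  have hzero : ∀ z ∈ ψ.doubleSet, ψ z.1 = 0 := by
    intro z hz
    have h1 : Real.cos z.1 = Real.cos z.2 := by rw [← hre, ← hre, hz.2.2]
    have h2 : Real.sin (2 * z.1) = Real.sin (2 * z.2) := by
      have := congrArg Complex.im hz.2.2
      rw [him, him] at this; linarith
    rw [Real.sin_two_mul, Real.sin_two_mul, ← h1] at h2
    have hc : Real.cos z.1 = 0 := by
      by_contra hc
      refine ImmersedCurve.angle_ne_of_mem_pairRegion hz.2.1 (angle_eq_of_cos_eq_of_sin_eq h1 ?_)
      have : Real.cos z.1 * (Real.sin z.1 - Real.sin z.2) = 0 := by linarith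
      have := (mul_eq_zero.1 this).resolve_left hc
      linarith
    apply Complex.ext
    · rw [hre, hc, Complex.zero_re]
    · rw [him, Real.sin_two_mul, hc, Complex.zero_im]; ring
  have hfin := ImmersedCurve.finite_doubleSet fun z hz => ψ.cross_ne_zero hz
  have e1 : φ.doodleMoment 1 = ψ.doodleMoment 1 := (φ.noTriple.doodleMoment_shift _ 1).symm
  rw [e1, ← ψ.moment_zero_eq hb, ψ.moment_zero_eq_sum hb hfin.coe_toFinset, hB, mul_zero, add_zero]
  refine Finset.sum_eq_zero fun z hz => ?_
  rw [Set.Finite.mem_toFinset] at hz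
  have hi : ψ.ind 0 = 0 := (ImmersedCurve.ind_shift _ _).trans hind0
  rw [hzero z hz, hi, binom_one, mul_zero]

end RegularIDoodle

/-! ### Geometry of the standard curves -/

/-- `h` is the half-distance of the parameters of a double point of the `n`-th standard curve: the
only solution of `|sin (n x)| = (n - 1) sin x` in `(0, π)`, up to the reflection `x ↦ π - x`. -/
structure IsStandardAngle (n : ℕ) (h : ℝ) : Prop where
  pos : 0 < h
  lt_pi : n * h < π
  sin_mul : Real.sin (n * h) = (n - 1) * Real.sin h
  eq_or_eq : ∀ x, 0 < x → x < π → |Real.sin (n * x)| = (n - 1) * Real.sin x → x = h ∨ x = π - h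

lemma exists_isStandardAngle {n : ℕ} (hn : 2 ≤ n) : ∃ h, IsStandardAngle n h := by
  have hpi := Real.pi_pos
  have hn2 : (2 : ℝ) ≤ n := by exact_mod_cast hn
  have hn0 : (0 : ℝ) < n := by linarith
  set c := π / n with hc
  have hc0 : 0 < c := by positivity
  have hnc : n * c = π := by rw [hc]; field_simp
  have hcpi : c ≤ π / 2 := by rw [hc]; gcongr
  -- the ratio `sin (n x) / sin x` decreases on `(0, π / n)`
  have hnx : ∀ x, HasDerivAt (fun x : ℝ => (n : ℝ) * x) n x := fun x => by
    simpa using (hasDerivAt_id x).const_mul (n : ℝ)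
  set D : ℝ → ℝ := fun x => n * Real.cos (n * x) * Real.sin x - Real.sin (n * x) * Real.cos x
    with hD
  have hDd : ∀ x, HasDerivAt D ((1 - (n : ℝ) ^ 2) * (Real.sin (n * x) * Real.sin x)) x := by
    intro x
    refine ((((hnx x).cos.const_mul (n : ℝ)).mul (Real.hasDerivAt_sin x)).sub
      ((hnx x).sin.mul (Real.hasDerivAt_cos x))).congr_deriv ?_
    ring
  have hsin : ∀ x, 0 < x → x < c → 0 < Real.sin (n * x) ∧ 0 < Real.sin x := by
    intro x h1 h2
    refine ⟨Real.sin_pos_of_pos_of_lt_pi (by positivity) ?_,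
      Real.sin_pos_of_pos_of_lt_pi h1 (by linarith)⟩
    rw [← hnc]; gcongr
  have hDneg : ∀ x, 0 < x → x < c → D x < 0 := by
    intro x h1 h2
    have hanti : StrictAntiOn D (Icc 0 c) := by
      refine strictAntiOn_of_deriv_neg (convex_Icc 0 c)
        (fun x _ => (hDd x).continuousAt.continuousWithinAt) fun y hy => ?_
      rw [interior_Icc] at hy
      rw [(hDd y).deriv]
      have := hsin y hy.1 hy.2
      exact mul_neg_of_neg_of_pos (by nlinarith) (mul_pos this.1 this.2)
    have := hanti ⟨le_rfl, hc0.le⟩ ⟨h1.le, h2.le⟩ h1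
    simpa [hD] using this
  have hinj : InjOn (fun x => Real.sin (n * x) / Real.sin x) (Ioo 0 c) := by
    refine StrictAntiOn.injOn ?_
    have hdiv : ∀ y ∈ Ioo 0 c, HasDerivAt (fun x => Real.sin (n * x) / Real.sin x)
        (D y / Real.sin y ^ 2) y := by
      intro y hy
      refine (((hnx y).sin).div (Real.hasDerivAt_sin y) (hsin y hy.1 hy.2).2.ne').congr_deriv ?_
      simp only [hD]; ring
    refine strictAntiOn_of_deriv_neg (convex_Ioo 0 c)
      (fun y hy => (hdiv y hy).continuousAt.continuousWithinAt) fun y hy => ?_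
    rw [interior_Ioo] at hy
    rw [(hdiv y hy).deriv]
    exact div_neg_of_neg_of_pos (hDneg y hy.1 hy.2) (pow_pos (hsin y hy.1 hy.2).2 2)
  obtain ⟨h₀, hh, hh0⟩ : ∃ h₀ ∈ Ioo 0 c, Real.sin (n * h₀) - (n - 1) * Real.sin h₀ = 0 := by
    set δ : ℝ := 1 / (n : ℝ) ^ 2 with hδ
    have hδ0 : 0 < δ := by positivity
    have hnδ : n * δ = 1 / n := by rw [hδ]; field_simp
    have hδc : δ < c := by
      have : n * δ < n * c := by
        rw [hnδ, hnc]
        have : 1 / (n : ℝ) ≤ 1 := by rw [div_le_one hn0]; linarith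
        linarith [Real.pi_gt_three]
      exact lt_of_mul_lt_mul_left this hn0.le
    have hpos : 0 < Real.sin (n * δ) - (n - 1) * Real.sin δ := by
      have h1 := Real.sin_gt_sub_cube (x := n * δ) (by positivity)
      have h2 : (n - 1) * Real.sin δ ≤ (n - 1) * δ :=
        mul_le_mul_of_nonneg_left (Real.sin_lt hδ0).le (by linarith)
      have h3 : (n * δ) ^ 3 / 6 < δ := by
        rw [hnδ, hδ, div_pow, one_pow, div_div, one_div_lt_one_div (by positivity) (by positivity)]
        nlinarith [pow_pos hn0 2]
      linarith
    have hneg : Real.sin (n * c) - (n - 1) * Real.sin c < 0 := by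
      rw [hnc, Real.sin_pi]
      have := Real.sin_pos_of_pos_of_lt_pi hc0 (by linarith)
      nlinarith
    have hcont : ContinuousOn (fun x : ℝ => Real.sin (n * x) - (n - 1) * Real.sin x)
        (Icc δ c) := by fun_prop
    obtain ⟨x, hx, hx0⟩ := intermediate_value_Ioo' hδc.le hcont ⟨hneg, hpos⟩
    exact ⟨x, ⟨hδ0.trans hx.1, hx.2⟩, hx0⟩
  have heq : Real.sin (n * h₀) = (n - 1) * Real.sin h₀ := by linarith
  have hsmall : ∀ x, 0 < x → x ≤ π / 2 → |Real.sin (n * x)| = (n - 1) * Real.sin x → x = h₀ := by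
    intro x h1 h2 h3
    have hxc : x < c := by
      by_contra hxc
      push Not at hxc
      have h4 : 2 / π * x ≤ Real.sin x := Real.mul_le_sin h1.le h2
      have h5 : 2 / n ≤ 2 / π * x := by
        calc 2 / n = 2 / π * c := by rw [hc]; field_simp
          _ ≤ _ := by gcongr
      have h6 := Real.abs_sin_le_one (n * x)
      have h7 : (n - 1) * (2 / n) ≤ (n - 1) * Real.sin x :=
        mul_le_mul_of_nonneg_left (h5.trans h4) (by linarith)
      have h8 : ((n : ℝ) - 1) * (2 / n) = 2 - 2 / n := by field_simp
      have h9 : 2 / (n : ℝ) ≥ 1 := by linarith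
      have h10 : (n : ℝ) ≤ 2 := by
        rw [ge_iff_le, le_div_iff₀ hn0] at h9; linarith
      have h11 : (n : ℝ) = 2 := le_antisymm h10 hn2
      have hx2 : x = π / 2 := by
        refine le_antisymm h2 ?_
        rw [hc, h11] at hxc; exact hxc
      rw [h11, hx2, mul_div_cancel₀ _ two_ne_zero, Real.sin_pi, Real.sin_pi_div_two] at h3
      norm_num at h3
    have hs := hsin x h1 hxc
    rw [abs_of_pos hs.1] at h3
    refine hinj ⟨h1, hxc⟩ hh ?_
    simp only
    rw [h3, heq, mul_div_cancel_right₀ _ hs.2.ne',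
      mul_div_cancel_right₀ _ (hsin h₀ hh.1 hh.2).2.ne']
  refine ⟨h₀, hh.1, by rw [← hnc]; exact mul_lt_mul_of_pos_left hh.2 hn0, heq,
    fun x h1 h2 h3 => ?_⟩
  rcases le_total x (π / 2) with h4 | h4
  · exact Or.inl (hsmall x h1 h4 h3)
  · right
    have := hsmall (π - x) (by linarith) (by linarith) (by
      rw [Real.sin_pi_sub, ← h3, mul_sub, Real.sin_nat_mul_pi_sub, abs_neg, abs_mul, abs_pow,
        abs_neg, abs_one, one_pow, one_mul])
    linarith

/-- The point with the coordinates `x, y` in the plane rotated by `m` and then, if `κ = -1`,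
reflected in the real line. -/
def rotated (κ m x y : ℝ) : ℂ :=
  ((x * Real.cos m - y * Real.sin m : ℝ) : ℂ) +
    ((κ * (x * Real.sin m + y * Real.cos m) : ℝ) : ℂ) * Complex.I

lemma rotated_re (κ m x y : ℝ) : (rotated κ m x y).re = x * Real.cos m - y * Real.sin m := by
  simp only [rotated, Complex.add_re, Complex.mul_re, Complex.ofReal_re, Complex.ofReal_im,
    Complex.I_re, Complex.I_im]
  ring

lemma rotated_im (κ m x y : ℝ) :
    (rotated κ m x y).im = κ * (x * Real.sin m + y * Real.cos m) := by
  simp only [rotated, Complex.add_im, Complex.mul_im, Complex.ofReal_re, Complex.ofReal_im,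
    Complex.I_re, Complex.I_im]
  ring

lemma cross_rotated (κ m x y x' y' : ℝ) :
    cross (rotated κ m x y) (rotated κ m x' y') = κ * (x * y' - y * x') := by
  rw [cross, rotated_re, rotated_im, rotated_re, rotated_im]
  linear_combination κ * (x * y' - y * x') * Real.sin_sq_add_cos_sq m

lemma ofReal_mul_rotated (κ m x y t : ℝ) :
    (t : ℂ) * rotated κ m x y = rotated κ m (t * x) (t * y) := by
  simp only [rotated]; push_cast; ring

lemma rotated_add (κ m x y x' y' : ℝ) :
    rotated κ m x y + rotated κ m x' y' = rotated κ m (x + x') (y + y') := by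
  simp only [rotated]; push_cast; ring

lemma rotated_injective {κ m x y x' y' : ℝ} (hκ : κ = 1 ∨ κ = -1)
    (h : rotated κ m x y = rotated κ m x' y') : x = x' ∧ y = y' := by
  have h1 := congrArg Complex.re h
  have h2 := congrArg Complex.im h
  rw [rotated_re, rotated_re] at h1
  rw [rotated_im, rotated_im] at h2
  have h3 := mul_left_cancel₀ (by rcases hκ with rfl | rfl <;> norm_num) h2
  have h4 := Real.sin_sq_add_cos_sq m
  constructor
  · linear_combination Real.cos m * h1 + Real.sin m * h3 - (x - x') * h4
  · linear_combination Real.cos m * h3 - Real.sin m * h1 - (y - y') * h4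

/-- The double points are, in their direction from the origin, the points of the curve that are
farthest from the origin. -/
lemma IsStandardAngle.le_of_sin_eq {n : ℕ} {h : ℝ} (hh : IsStandardAngle n h) (hn : 2 ≤ n) {t : ℝ}
    (ht : (n - 1) * Real.sin t = Real.sin (n * t)) :
    (n - 1) * Real.cos t - Real.cos (n * t) ≤ (n - 1) * Real.cos h - Real.cos (n * h) := by
  have hpi := Real.pi_pos
  have hn2 : (2 : ℝ) ≤ n := by exact_mod_cast hn
  have h1 := hh.pos
  have hnh := hh.lt_pi
  have hcos : Real.cos (n * h) < Real.cos h :=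
    Real.cos_lt_cos_of_nonneg_of_le_pi h1.le hnh.le (by nlinarith)
  have hc0 : 0 < Real.cos h := Real.cos_pos_of_mem_Ioo ⟨by linarith, by nlinarith⟩
  have hρ0 : 0 < (n - 1) * Real.cos h - Real.cos (n * h) := by nlinarith
  have hρ : (n : ℝ) - 2 ≤ (n - 1) * Real.cos h - Real.cos (n * h) := by
    -- the square of the distance to the origin is `(n - 1) ^ 2 + 1 - 2 (n - 1) cos ((n - 1) h)`
    have e1 : Real.cos (n * h - h) ≤ 1 := Real.cos_le_one _
    rw [Real.cos_sub, hh.sin_mul] at e1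
    have e2 := Real.sin_sq_add_cos_sq (n * h)
    have e3 := Real.sin_sq_add_cos_sq h
    rw [hh.sin_mul] at e2
    refine abs_le_of_sq_le_sq' ?_ hρ0.le |>.2
    nlinarith
  have key : ∀ t, 0 ≤ t → t ≤ π → (n - 1) * Real.sin t = Real.sin (n * t) →
      (n - 1) * Real.cos t - Real.cos (n * t) ≤ (n - 1) * Real.cos h - Real.cos (n * h) := by
    intro t h0 hπ ht
    rcases h0.eq_or_lt with rfl | h0
    · rw [mul_zero, Real.cos_zero]; linarith
    rcases hπ.eq_or_lt with rfl | hπ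
    · rw [Real.cos_pi]
      have := Real.neg_one_le_cos (n * π)
      linarith
    have hs := Real.sin_pos_of_pos_of_lt_pi h0 hπ
    rcases hh.eq_or_eq t h0 hπ (by rw [← ht, abs_of_pos (by nlinarith)]) with rfl | rfl
    · exact le_rfl
    · have e1 : |Real.cos (n * (π - h))| = |Real.cos (n * h)| := by
        rw [mul_sub, Real.cos_nat_mul_pi_sub, abs_mul, abs_pow, abs_neg, abs_one, one_pow, one_mul]
      have e2 := neg_abs_le (Real.cos (n * (π - h)))
      rw [e1] at e2
      rw [Real.cos_pi_sub]
      rcases le_total 0 (Real.cos (n * h)) with e3 | e3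
      · rw [abs_of_nonneg e3] at e2; nlinarith
      · rw [abs_of_nonpos e3] at e2; nlinarith
  obtain ⟨y, hy, hyt⟩ := exists_mem_Ico_angle_eq (-π) t
  obtain ⟨k, hk⟩ := Real.Angle.angle_eq_iff_two_pi_dvd_sub.1 hyt.symm
  have et : t = y + k * (2 * π) := by linarith
  have ent : n * t = n * y + ((n * k : ℤ) : ℝ) * (2 * π) := by rw [et]; push_cast; ring
  rw [ent, Real.sin_add_int_mul_two_pi, et, Real.sin_add_int_mul_two_pi] at ht
  rw [ent, Real.cos_add_int_mul_two_pi, et, Real.cos_add_int_mul_two_pi]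
  rcases le_total 0 y with h0 | h0
  · exact key y h0 (by linarith [hy.2]) ht
  · have := key (-y) (by linarith) (by linarith [hy.1]) (by
      rw [mul_neg, Real.sin_neg, Real.sin_neg]; linarith)
    rwa [mul_neg, Real.cos_neg, Real.cos_neg] at this

lemma standardCurve_eq (n : ℕ) (x : ℝ) : standardCurve n x =
    (((n - 1) * Real.cos x + Real.cos (n * x) : ℝ) : ℂ) +
      (((n - 1) * Real.sin x + Real.sin (n * x) : ℝ) : ℂ) * Complex.I := by
  have e1 : Complex.I * (n * (x : ℂ)) = ((n * x : ℝ) : ℂ) * Complex.I := by push_cast; ring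
  rw [standardCurve, e1, mul_comm Complex.I, Complex.exp_mul_I, Complex.exp_mul_I]
  push_cast
  ring

/-- The parameters of the double points of the standard curves: the curve passes the double points
in the directions `m` for which `cos ((n - 1) m) = -1`. -/
lemma IsStandardAngle.exists_nat {n : ℕ} {h : ℝ} (hh : IsStandardAngle n h) (hn : 2 ≤ n) {a u : ℝ}
    (ha : 0 ≤ a) (hau : a < u) (hu : u ≤ 2 * π) (hu' : u < a + 2 * π)
    (hre : (n - 1) * Real.cos a + Real.cos (n * a) = (n - 1) * Real.cos u + Real.cos (n * u))
    (him : (n - 1) * Real.sin a + Real.sin (n * a) = (n - 1) * Real.sin u + Real.sin (n * u)) :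
    ∃ k ∈ Finset.range (n - 1), ((2 * k + 1) * π / (n - 1) - h, (2 * k + 1) * π / (n - 1) + h) =
      (a, u) := by
  have hpi := Real.pi_pos
  have hn2 : (2 : ℝ) ≤ n := by exact_mod_cast hn
  have h1 := hh.pos
  have hnh := hh.lt_pi
  have hsh : 0 < Real.sin h := Real.sin_pos_of_pos_of_lt_pi h1 (by nlinarith)
  set m := (a + u) / 2 with hm
  set x := (u - a) / 2 with hx
  have ea : a = m - x := by rw [hm, hx]; ring
  have eu : u = m + x := by rw [hm, hx]; ring
  have hx0 : 0 < x := by rw [hx]; linarith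
  have hxπ : x < π := by rw [hx]; linarith
  have hsx := Real.sin_pos_of_pos_of_lt_pi hx0 hxπ
  rw [ea, eu, mul_sub, mul_add, Real.cos_sub, Real.cos_sub, Real.cos_add, Real.cos_add] at hre
  rw [ea, eu, mul_sub, mul_add, Real.sin_sub, Real.sin_sub, Real.sin_add, Real.sin_add] at him
  have e1 : (n - 1) * Real.sin x * Real.sin m = -(Real.sin (n * x) * Real.sin (n * m)) := by
    linarith
  have e2 : (n - 1) * Real.sin x * Real.cos m = -(Real.sin (n * x) * Real.cos (n * m)) := by
    linarith
  have hsin : Real.sin (n * x) * Real.sin (n * m - m) = 0 := by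
    rw [Real.sin_sub]
    linear_combination Real.cos m * e1 - Real.sin m * e2
  have hcos : Real.sin (n * x) * Real.cos (n * m - m) = -((n - 1) * Real.sin x) := by
    rw [Real.cos_sub]
    linear_combination Real.sin m * e1 + Real.cos m * e2 -
      (n - 1) * Real.sin x * Real.sin_sq_add_cos_sq m
  have hpos : 0 < (n - 1) * Real.sin x := mul_pos (by linarith) hsx
  have hsn : Real.sin (n * x) ≠ 0 := by
    intro h0
    rw [h0, zero_mul] at hcos; linarith
  have hd := (mul_eq_zero.1 hsin).resolve_left hsn
  have hd1 : |Real.cos (n * m - m)| = 1 := by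
    rw [← sq_eq_sq₀ (abs_nonneg _) zero_le_one, sq_abs]
    have := Real.sin_sq_add_cos_sq (n * m - m)
    rw [hd] at this; linarith
  have habs : |Real.sin (n * x)| = (n - 1) * Real.sin x := by
    have := congrArg abs hcos
    rwa [abs_mul, hd1, mul_one, abs_neg, abs_of_pos hpos] at this
  rcases hh.eq_or_eq x hx0 hxπ habs with hxh | hxh
  · have hc : Real.cos (n * m - m) = -1 := by
      rw [hxh, hh.sin_mul] at hcos
      have : (n - 1) * Real.sin h ≠ 0 := (mul_pos (by linarith) hsh).ne'
      exact mul_left_cancel₀ this (by rw [hcos]; ring)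
    obtain ⟨k, hk⟩ := Real.cos_eq_neg_one_iff.1 hc
    have hmk : (n - 1) * m = (2 * k + 1) * π := by linarith
    have hk0 : 0 ≤ k := by
      by_contra hk0
      have : (k : ℝ) ≤ -1 := by exact_mod_cast (by omega : k ≤ -1)
      nlinarith [mul_pos (show (0 : ℝ) < n - 1 by linarith) (show 0 < m by linarith)]
    have hk1 : k < n - 1 := by
      by_contra hk1
      have : ((n - 1 : ℤ) : ℝ) ≤ k := by exact_mod_cast (by omega : (n : ℤ) - 1 ≤ k)
      push_cast at this
      nlinarith [mul_lt_mul_of_pos_left (show m < 2 * π by linarith)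
        (show (0 : ℝ) < n - 1 by linarith)]
    obtain ⟨j, rfl⟩ := Int.eq_ofNat_of_zero_le hk0
    refine ⟨j, Finset.mem_range.2 (by omega), ?_⟩
    have hmj : (2 * (j : ℝ) + 1) * π / (n - 1) = m := by
      rw [div_eq_iff (by linarith)]
      push_cast at hmk
      linarith
    rw [hmj, ea, eu, hxh]
  · -- the points of the parameters `m - x` and `m + x` are on opposite sides of the origin
    exfalso
    have hd' : Real.sin ((n - 1) * (m - π)) = 0 := by
      rw [show (n - 1) * (m - π) = n * m - m + π - n * π by ring, Real.sin_sub, Real.sin_add_pi,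
        hd, Real.sin_nat_mul_pi]
      ring
    have hb1 : -h ≤ m - π := by linarith
    have hb2 : m - π ≤ h := by linarith
    have hn0 : (0 : ℝ) ≤ n - 1 := by linarith
    have := (Real.sin_eq_zero_iff_of_lt_of_lt
      (by linarith [mul_le_mul_of_nonneg_left hb1 hn0])
      (by linarith [mul_le_mul_of_nonneg_left hb2 hn0])).1 hd'
    have hmπ : m = π := by
      have := (mul_eq_zero.1 this).resolve_left (by linarith)
      linarith
    have e3 := Real.sin_sq_add_cos_sq (n * π)
    rw [Real.sin_nat_mul_pi] at e3
    rw [hxh, hmπ, mul_sub, Real.sin_sub, Real.sin_nat_mul_pi, Real.cos_sub_pi, Real.sin_pi_sub,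
      hh.sin_mul] at hcos
    have : (n - 1) * Real.sin h > 0 := mul_pos (by linarith) hsh
    nlinarith

/-! ### The strangeness of the standard curves -/

namespace RegularIDoodle

lemma doubleSign_mul_eq_one {φ : RegularIDoodle} {a b κ X y i : ℝ} (hX : 0 < X)
    (hab : cross (deriv φ b) (deriv φ a) = 2 * X * (κ * y)) (h : cross (deriv φ b) (deriv φ a) ≠ 0)
    (hi : i = SignType.sign (κ * y)) : φ.doubleSign a b * i = 1 := by
  have h0 : κ * y ≠ 0 := by rintro h0; rw [hab, h0, mul_zero] at h; exact h rfl
  rw [ImmersedCurve.doubleSign, hab, hi]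
  rcases lt_or_gt_of_ne h0 with h1 | h1
  · rw [sign_neg h1, sign_neg (mul_neg_of_pos_of_neg (by linarith) h1)]; norm_num
  · rw [sign_pos h1, sign_pos (by positivity)]; norm_num

/-- The standard curve and its reversal are treated together: `κ = 1` or `κ = -1`. -/
theorem doodleMoment_standardCurve {n : ℕ} {φ : RegularIDoodle} {κ : ℝ} (hn : 1 ≤ n)
    (hκ : κ = 1 ∨ κ = -1) (h : ∀ s : ℝ, φ s = standardCurve n (κ * s)) :
    φ.doodleMoment 1 = n - 1 := by
  have hpi := Real.pi_pos
  have hn1 : (1 : ℝ) ≤ n := by exact_mod_cast hn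
  have hκ0 : κ ≠ 0 := by rcases hκ with rfl | rfl <;> norm_num
  have hφ : ∀ s, φ s = (((n - 1) * Real.cos s + Real.cos (n * s) : ℝ) : ℂ) +
      ((κ * ((n - 1) * Real.sin s + Real.sin (n * s)) : ℝ) : ℂ) * Complex.I := by
    intro s
    rw [h, standardCurve_eq]
    rcases hκ with rfl | rfl
    · simp only [one_mul]
    · rw [show (n : ℝ) * (-1 * s) = -(n * s) by ring, show -1 * s = -s by ring, Real.cos_neg,
        Real.cos_neg, Real.sin_neg, Real.sin_neg]
      congr 3; ring
  have hd : ∀ s, deriv φ s = ((-(n - 1) * Real.sin s - n * Real.sin (n * s) : ℝ) : ℂ) +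
      ((κ * ((n - 1) * Real.cos s + n * Real.cos (n * s)) : ℝ) : ℂ) * Complex.I := by
    intro s
    have hns : HasDerivAt (fun x : ℝ => (n : ℝ) * x) n s := by
      simpa using (hasDerivAt_id s).const_mul (n : ℝ)
    refine ImmersedCurve.eq_of_coe_eq hφ ?_ ?_
    · exact (((Real.hasDerivAt_cos s).const_mul _).add hns.cos).congr_deriv (by ring)
    · exact ((((Real.hasDerivAt_sin s).const_mul _).add hns.sin).const_mul κ).congr_deriv (by ring)
  have hre : ∀ s, (φ s).re = (n - 1) * Real.cos s + Real.cos (n * s) := fun s => by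
    rw [hφ]
    simp only [Complex.add_re, Complex.mul_re, Complex.ofReal_re, Complex.ofReal_im, Complex.I_re,
      Complex.I_im]
    ring
  have him : ∀ s, (φ s).im = κ * ((n - 1) * Real.sin s + Real.sin (n * s)) := fun s => by
    rw [hφ]
    simp only [Complex.add_im, Complex.mul_im, Complex.ofReal_re, Complex.ofReal_im, Complex.I_re,
      Complex.I_im]
    ring
  have hre0 : (φ 0).re = n := by rw [hre, mul_zero, Real.cos_zero]; ring
  -- the base point is the point of the curve farthest to the right
  have hb : φ.IsBasePoint 0 := by
    intro x hx
    have h1 := hre x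
    rw [hx, hre0] at h1
    have h2 := Real.cos_le_one x
    have h3 := Real.cos_le_one (n * x)
    have h4 : Real.cos x = 1 := by
      rcases hn.eq_or_lt with rfl | hn2
      · rw [Nat.cast_one, one_mul] at h1; linarith
      · have hn2 : (2 : ℝ) ≤ n := by exact_mod_cast hn2
        nlinarith
    have h5 : Real.sin x = 0 := by nlinarith [Real.sin_sq_add_cos_sq x]
    exact angle_eq_of_cos_eq_of_sin_eq (by rw [h4, Real.cos_zero]) (by rw [h5, Real.sin_zero])
  have hB : binom (φ.ind (φ 0) + 1 / 2) 2 = 0 := by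
    refine hb.binom_eq_zero (w := 1) one_ne_zero ?_ fun y x hx hy => ?_
    · have : cross (deriv φ 0) 1 = -(κ * (2 * n - 1)) := by
        rw [hd, mul_zero, Real.cos_zero]
        simp only [cross, Complex.add_im, Complex.mul_im, Complex.ofReal_re, Complex.ofReal_im,
          Complex.I_re, Complex.I_im, Complex.one_re, Complex.one_im]
        ring
      rw [this, neg_ne_zero]
      exact mul_ne_zero hκ0 (by linarith)
    · have := congrArg Complex.re hy
      rw [Complex.add_re, hre0, hre, mul_one, Complex.ofReal_re] at this
      nlinarith [Real.cos_le_one y, Real.cos_le_one (n * y)]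
  have hdouble : ∀ z ∈ φ.doubleSet,
      (n - 1) * Real.cos z.1 + Real.cos (n * z.1) = (n - 1) * Real.cos z.2 + Real.cos (n * z.2) ∧
      (n - 1) * Real.sin z.1 + Real.sin (n * z.1) =
        (n - 1) * Real.sin z.2 + Real.sin (n * z.2) := by
    intro z hz
    refine ⟨by rw [← hre, ← hre, hz.2.2], ?_⟩
    have := congrArg Complex.im hz.2.2
    rw [him, him] at this
    exact mul_left_cancel₀ hκ0 this
  rcases hn.eq_or_lt with rfl | hn2'
  · have hS : ((∅ : Finset (ℝ × ℝ)) : Set (ℝ × ℝ)) = φ.doubleSet := by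
      rw [Finset.coe_empty, eq_comm, eq_empty_iff_forall_notMem]
      intro z hz
      have h1 := hdouble z hz
      simp only [Nat.cast_one, sub_self, zero_mul, zero_add, one_mul] at h1
      exact ImmersedCurve.angle_ne_of_mem_pairRegion hz.2.1
        (angle_eq_of_cos_eq_of_sin_eq h1.1 h1.2)
    rw [← φ.moment_zero_eq hb, φ.moment_zero_eq_sum hb hS, hB]
    simp
  have hn2 : (2 : ℝ) ≤ n := by exact_mod_cast hn2'
  obtain ⟨h₀, hh⟩ := exists_isStandardAngle hn2'
  have hh1 := hh.pos
  have hh2 := hh.lt_pi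
  have hh3 := hh.sin_mul
  have hsh : 0 < Real.sin h₀ := Real.sin_pos_of_pos_of_lt_pi hh1 (by nlinarith)
  set m : ℕ → ℝ := fun k => (2 * k + 1) * π / (n - 1) with hm
  have hmd : ∀ k, Real.cos (n * m k - m k) = -1 ∧ Real.sin (n * m k - m k) = 0 := by
    intro k
    have e1 : n * m k - m k = k * (2 * π) + π := by
      have : (n : ℝ) - 1 ≠ 0 := by linarith
      rw [hm]; field_simp
    rw [e1, Real.cos_add_pi, Real.sin_add_pi, Real.cos_nat_mul_two_pi]
    refine ⟨rfl, ?_⟩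
    rw [← mul_assoc, show (k : ℝ) * 2 = ((k * 2 : ℕ) : ℝ) by push_cast; ring, Real.sin_nat_mul_pi,
      neg_zero]
  have hmn : ∀ k, Real.cos (n * m k) = -Real.cos (m k) ∧ Real.sin (n * m k) = -Real.sin (m k) := by
    intro k
    rw [show n * m k = (n * m k - m k) + m k by ring, Real.cos_add, Real.sin_add, (hmd k).1,
      (hmd k).2]
    constructor <;> ring
  -- the curve is symmetric with respect to the lines in the directions `m k`, which contain its
  -- double points
  have hrot : ∀ k t, φ (m k + t) = rotated κ (m k) ((n - 1) * Real.cos t - Real.cos (n * t))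
      ((n - 1) * Real.sin t - Real.sin (n * t)) := by
    intro k t
    rw [hφ, rotated, mul_add, Real.cos_add, Real.cos_add, Real.sin_add, Real.sin_add, (hmn k).1,
      (hmn k).2]
    congr 2
    · ring_nf
    · ring_nf
  have hdrot : ∀ k t, deriv φ (m k + t) =
      rotated κ (m k) (-(n - 1) * Real.sin t + n * Real.sin (n * t))
        ((n - 1) * Real.cos t - n * Real.cos (n * t)) := by
    intro k t
    rw [hd, rotated, mul_add, Real.cos_add, Real.cos_add, Real.sin_add, Real.sin_add, (hmn k).1,
      (hmn k).2]
    congr 2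
    · ring_nf
    · ring_nf
  set ρ := (n - 1) * Real.cos h₀ - Real.cos (n * h₀) with hρ
  set y := (n - 1) * Real.cos h₀ - n * Real.cos (n * h₀) with hy
  have hp1 : ∀ k, φ (m k + h₀) = rotated κ (m k) ρ 0 := fun k => by
    rw [hrot, hh3, sub_self]
  have hp2 : ∀ k, φ (m k - h₀) = rotated κ (m k) ρ 0 := fun k => by
    rw [sub_eq_add_neg, hrot, mul_neg, Real.cos_neg, Real.cos_neg, Real.sin_neg, Real.sin_neg, hh3]
    congr 1; ring
  have hv1 : ∀ k, deriv φ (m k + h₀) = rotated κ (m k) ((n - 1) ^ 2 * Real.sin h₀) y := fun k => by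
    rw [hdrot, hh3]
    congr 1; ring
  have hv2 : ∀ k, deriv φ (m k - h₀) = rotated κ (m k) (-((n - 1) ^ 2 * Real.sin h₀)) y :=
    fun k => by
    rw [sub_eq_add_neg, hdrot, mul_neg, Real.cos_neg, Real.cos_neg, Real.sin_neg, Real.sin_neg, hh3]
    congr 1; ring
  set S := (Finset.range (n - 1)).image fun k => (m k - h₀, m k + h₀) with hSdef
  have hS : (S : Set (ℝ × ℝ)) = φ.doubleSet := by
    ext z
    rw [Finset.mem_coe, hSdef, Finset.mem_image]
    constructor
    · rintro ⟨k, hk, rfl⟩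
      have hk' : (k : ℝ) ≤ n - 2 := by
        have := Finset.mem_range.1 hk
        have : ((k + 2 : ℕ) : ℝ) ≤ n := by exact_mod_cast (by omega : k + 2 ≤ n)
        push_cast at this; linarith
      have hmk : (n - 1) * m k = (2 * k + 1) * π := by
        have : (n : ℝ) - 1 ≠ 0 := by linarith
        rw [hm]; field_simp
      have hlow : h₀ < m k := by
        have : (n - 1) * h₀ < (n - 1) * m k := by
          rw [hmk]; nlinarith [(Nat.cast_nonneg k : (0 : ℝ) ≤ k)]
        exact lt_of_mul_lt_mul_left this (by linarith)
      have hupp : m k + h₀ < 2 * π := by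
        have : (n - 1) * (m k + h₀) < (n - 1) * (2 * π) := by
          rw [mul_add, hmk]; nlinarith
        exact lt_of_mul_lt_mul_left this (by linarith)
      exact ⟨mem_box.2 ⟨⟨by simp only; linarith, by simp only; linarith⟩,
        by simp only; linarith, hupp.le⟩, ⟨by simp only; linarith, by simp only; linarith⟩,
        (hp2 k).trans (hp1 k).symm⟩
    · intro hz
      have hzb := mem_box.1 hz.1
      exact hh.exists_nat hn2' hzb.1.1 hz.2.1.1 hzb.2.2 hz.2.1.2 (hdouble z hz).1 (hdouble z hz).2
  have hcard : S.card = n - 1 := by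
    rw [hSdef, Finset.card_image_of_injOn, Finset.card_range]
    intro k _ j _ hkj
    have : m k = m j := by linarith [congrArg Prod.fst hkj]
    have hn0 : (n : ℝ) - 1 ≠ 0 := by linarith
    simp only [hm] at this
    rw [div_left_inj' hn0, mul_left_inj' hpi.ne'] at this
    exact_mod_cast (by linarith : (k : ℝ) = j)
  have hterm : ∀ z ∈ S, φ.doubleSign z.1 z.2 * binom (φ.ind (φ z.1)) 1 = 1 := by
    intro z hzS
    have hz : z ∈ φ.doubleSet := by rw [← hS]; exact hzS
    obtain ⟨k, -, rfl⟩ := Finset.mem_image.1 hzS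
    have hX : 0 < ((n : ℝ) - 1) ^ 2 * Real.sin h₀ := by
      have : (0 : ℝ) < n - 1 := by linarith
      positivity
    have hc := φ.cross_ne_zero hz
    have hcr : cross (deriv φ (m k + h₀)) (deriv φ (m k - h₀)) =
        2 * ((n - 1) ^ 2 * Real.sin h₀) * (κ * y) := by
      rw [hv1, hv2, cross_rotated]; ring
    have hy0 : κ * y ≠ 0 := by
      intro h0
      simp only at hc
      rw [hcr, h0, mul_zero] at hc
      exact hc rfl
    refine doubleSign_mul_eq_one hX hcr hc ?_
    have hst := isStrandSet_pair hz.2.1.1 hz.2.1.2 hz.2.2 (φ.noTriple.onlyTwo_of_mem hz)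
    simp only at hst ⊢
    have hw1 : cross (deriv φ (m k + h₀)) (rotated κ (m k) 1 0) = -(κ * y) := by
      rw [hv1, cross_rotated]; ring
    have hw2 : cross (deriv φ (m k - h₀)) (rotated κ (m k) 1 0) = -(κ * y) := by
      rw [hv2, cross_rotated]; ring
    have hw0 : rotated κ (m k) 1 0 ≠ 0 := by
      intro h0
      rw [h0] at hw1
      simp only [cross, Complex.zero_re, Complex.zero_im, mul_zero, sub_zero] at hw1
      exact hy0 (by linarith)
    -- beyond the double point, the ray from the origin does not meet the curve again
    have hray := hst.ind_add_eq_zero_of_ray hw0 (fun s hs => by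
      rw [Finset.mem_insert, Finset.mem_singleton] at hs
      rcases hs with rfl | rfl
      · rw [hw2]; exact neg_ne_zero.2 hy0
      · rw [hw1]; exact neg_ne_zero.2 hy0) fun s x hx hs => by
        rw [hp2, show s = m k + (s - m k) by ring, hrot, ofReal_mul_rotated, rotated_add] at hs
        obtain ⟨i1, i2⟩ := rotated_injective hκ hs
        have := hh.le_of_sin_eq hn2' (t := s - m k) (by linarith)
        linarith
    rw [Finset.sum_pair (by linarith), hw1, hw2] at hray
    rw [binom_one]
    rcases lt_or_gt_of_ne hy0 with h1 | h1
    · rw [sign_neg h1]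
      rw [sign_pos (by linarith)] at hray
      norm_num at hray ⊢; linarith
    · rw [sign_pos h1]
      rw [sign_neg (by linarith)] at hray
      norm_num at hray ⊢; linarith
  rw [← φ.moment_zero_eq hb, φ.moment_zero_eq_sum hb hS, hB, Finset.sum_congr rfl hterm,
    Finset.sum_const, hcard, nsmul_eq_mul, Nat.cast_sub hn]
  norm_num

end RegularIDoodle

end

end PlaneCurve

theorem mainTheorem4 :
    (∀ β : ℕ, 1 ≤ β →
      ∃ M : PlaneCurve.IDoodle → ℝ,
        (∀ φ ψ : PlaneCurve.IDoodle, φ.Equivalent ψ → M φ = M ψ) ∧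
        ∀ (φ : PlaneCurve.RegularIDoodle) (s : ℝ), φ.IsBasePoint s →
          φ.moment β s = M φ.toIDoodle) ∧
    ∃ St : PlaneCurve.RegularIDoodle → ℤ, PlaneCurve.IsStrangeness St ∧
      ∀ (φ : PlaneCurve.RegularIDoodle) (s : ℝ), φ.IsBasePoint s →
        φ.moment 1 s = (St φ : ℝ) := by
  refine ⟨fun β _ => ⟨fun φ => φ.doodleMoment β, fun φ ψ h => h.doodleMoment_eq β,
    fun φ s hs => φ.moment_eq_doodleMoment hs⟩, ?_⟩
  choose St hSt using PlaneCurve.RegularIDoodle.exists_int_doodleMoment_one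
  refine ⟨St, ⟨fun φ ψ h => ?_, fun γ φ ψ h0 h1 => ?_, fun φ h => ?_, fun n φ hn h => ?_,
    fun n φ hn h => ?_⟩, fun φ s hs => (φ.moment_eq_doodleMoment hs).trans (hSt φ)⟩
  · have := h.doodleMoment_eq 1
    rw [hSt, hSt] at this
    exact_mod_cast this
  · have := γ.doodleMoment_sub
    rw [h0, h1] at this
    rw [← Int.cast_inj (α := ℝ), Int.cast_sub, ← hSt, ← hSt]
    exact this
  · have := φ.doodleMoment_figureEight h
    rw [hSt] at this
    exact_mod_cast this
  · have := PlaneCurve.RegularIDoodle.doodleMoment_standardCurve hn (Or.inl rfl)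
      (fun s => by rw [h, one_mul] : ∀ s, φ s = PlaneCurve.standardCurve n (1 * s))
    rw [hSt] at this
    exact_mod_cast this
  · have := PlaneCurve.RegularIDoodle.doodleMoment_standardCurve hn (Or.inr rfl)
      (fun s => by rw [h, neg_one_mul] :
        ∀ s : ℝ, φ s = PlaneCurve.standardCurve n ((-1 : ℝ) * s))
    rw [hSt] at this
    exact_mod_cast this
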